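/- Let $\mathbb{F}_q$ be a finite field with $q$ elements, $K=\mathbb{F}_q(x)$ the rational function field, $\alpha\in\mathbb{F}_q$, $T=(x-\alpha)^{-1}$ (so that $K=\mathbb{F}_q(T)$), and let $n\ge 1$ be an integer. Let $\mathbb{F}_q[T]$ act on an algebraic closure $K^{ac}$ of $K$ by $z^{f(T)}=f(\varphi)(z)$, where $\varphi(z)=z^q+Tz$, let $\Lambda_{T^{n+1}}=\{z\in K^{ac} : z^{T^{n+1}}=0\}$, and let $K_n=K(\Lambda_{T^{n+1}})$ be the cyclotomic function field with modulus $T^{n+1}$. It is a finite abelian extension of $K$. For a finite abelian extension $E/K$, a place $P$ of $K$ and a place $Q$ of $E$ over $P$ with valuation ring $\mathcal{O}_Q$ and normalized valuation $\nu_Q$, let $e(Q|P)$ be the ramification index and $d(Q|P)$ the different exponent, let $G_i(Q|P)=\{\sigma\in\mathrm{Gal}(E/K) : \nu_Q(\sigma(z)-z)\ge i+1 \text{ for all } z\in\mathcal{O}_Q\}$, and let $a(Q|P)$ be the least integer $l\ge 0$ such that $G_i(Q|P)$ is trivial for all $i\ge l$. The conductor of $E/K$ is the divisor $$\mathrm{Cond}(E/K)=\sum_P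 c_P(E/K)\,P,\qquad c_P(E/K)=\frac{d(Q|P)+a(Q|P)}{e(Q|P)},$$ where $Q$ is any place of $E$ over $P$ (the value does not depend on the choice of $Q$). Let $\infty$ be the pole of $x$ and $P_\alpha$ the zero of $x-\alpha$ in $K$. Then $$\mathrm{Cond}(K_n/K)=(n+1)\cdot\infty+\min\{1,q-2\}\cdot P_\alpha .$$ Furthermore, let $F$ be the subfield of $K_n$ fixed by $\mathbb{F}_q^*$, that is, by the automorphisms $\sigma\in\mathrm{Gal}(K_n/K)$ for which there is an $a\in\mathbb{F}_q^*$ with $\sigma(\lambda)=a\lambda$ for all $\lambda\in\Lambda_{T^{n+1}}$. Then $F/K$ is finite abelian and $$\mathrm{Cond}(F/K)=(n+1)\cdot\infty .$$ -/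

import Mathlib

open Polynomial

noncomputable section

/-- A place of a field extension `E / k`, given by its valuation ring: a valuation ring of `E`
that contains `k` and is not all of `E`. -/
@[ext]
structure Place (k E : Type*) [Field k] [Field E] [Algebra k E] where
  /-- The valuation ring `𝒪_Q` of the place. -/
  ring : ValuationSubring E
  algebraMap_mem : ∀ c : k, algebraMap k E c ∈ ring
  ne_top : ring ≠ ⊤

namespace Place

section Extension

variable {k F E : Type*} [Field k] [Field F] [Field E] [Algebra k F] [Algebra k E] [Algebra F E]

/-- `Q` lies over `P`: the valuation ring of `P` is the intersection of that of `Q` with `F`. -/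
def LiesOver (Q : Place k E) (P : Place k F) : Prop :=
  P.ring = Q.ring.comap (algebraMap F E)

/-- The integral closure `𝒪'_P` in `E` of the valuation ring of the place `P` of `F`. -/
abbrev intClosure (P : Place k F) (E : Type*) [Field E] [Algebra F E] : Subalgebra P.ring E :=
  integralClosure P.ring E

theorem LiesOver.mem_ring {Q : Place k E} {P : Place k F} (h : Q.LiesOver P)
    (b : P.intClosure E) : (b : E) ∈ Q.ring := by
  obtain ⟨p, hp, hb⟩ := b.2
  have hr : ∀ r : P.ring, algebraMap P.ring E r ∈ Q.ring := fun r ↦ by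
    have hr : (r : F) ∈ Q.ring.comap (algebraMap F E) := h ▸ r.2
    exact hr
  have hint : IsIntegral Q.ring (b : E) := by
    refine ⟨p.map ((algebraMap P.ring E).codRestrict Q.ring hr), hp.map _, ?_⟩
    rw [Polynomial.eval₂_map]
    exact hb
  obtain ⟨y, hy⟩ := IsIntegrallyClosed.isIntegral_iff.mp hint
  exact hy ▸ y.2

/-- The inclusion of the integral closure of `𝒪_P` into `𝒪_Q`, for `Q` over `P`. -/
def LiesOver.incl {Q : Place k E} {P : Place k F} (h : Q.LiesOver P) :
    P.intClosure E →+* Q.ring :=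
  (P.intClosure E).val.toRingHom.codRestrict Q.ring h.mem_ring

/-- The maximal ideal of the integral closure of `𝒪_P` that corresponds to the place `Q` over
`P`, that is, the intersection of the integral closure with the maximal ideal of `𝒪_Q`. -/
def LiesOver.center {Q : Place k E} {P : Place k F} (h : Q.LiesOver P) :
    Ideal (P.intClosure E) :=
  (IsLocalRing.maximalIdeal Q.ring).comap h.incl

/-- The ramification index `e(Q|P)`. -/
def ramIndex {Q : Place k E} {P : Place k F} (h : Q.LiesOver P) : ℕ :=
  Ideal.ramificationIdx' (IsLocalRing.maximalIdeal P.ring) h.center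

/-- The different over `P`: the inverse in `𝒪'_P` of the complementary module
`{z ∈ E | Tr_{E/F}(z 𝒪'_P) ⊆ 𝒪_P}`. -/
def differentOver (P : Place k F) (E : Type*) [Field E] [Algebra F E] : Ideal (P.intClosure E) :=
  (1 / Submodule.traceDual P.ring F 1 : Submodule (P.intClosure E) E).comap
    (Algebra.linearMap (P.intClosure E) E)

/-- The different exponent `d(Q|P)`: the exponent of the prime of `𝒪'_P` corresponding to `Q` in
the different over `P`. -/
def diffExponent {Q : Place k E} {P : Place k F} (h : Q.LiesOver P) : ℕ :=
  multiplicity h.center (P.differentOver E)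

variable (F) in
/-- The `i`-th ramification group, `i ≥ 0`: the set of all `σ ∈ Gal(E/F)` with
`ν_Q(σ z - z) ≥ i + 1` for all `z ∈ 𝒪_Q`. As `𝒪_Q` is a discrete valuation ring, the inequality
says that `σ z - z` lies in the `(i+1)`-st power of the maximal ideal. -/
def ramGroup (Q : Place k E) (i : ℕ) : Set Gal(E/F) :=
  {σ | ∀ z : Q.ring, ∃ w ∈ IsLocalRing.maximalIdeal Q.ring ^ (i + 1), (w : E) = σ (z : E) - z}

variable (F) in
/-- `a(Q|P)`: the least integer `l ≥ 0` such that the `i`-th ramification group is trivial for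
all `i ≥ l`. -/
def ramBound (Q : Place k E) : ℕ :=
  sInf {l : ℕ | ∀ i, l ≤ i → Q.ramGroup F i = {1}}

/-- `(d(Q|P) + a(Q|P)) / e(Q|P)`. -/
def condExponent {Q : Place k E} {P : Place k F} (h : Q.LiesOver P) : ℚ :=
  ((diffExponent h : ℚ) + (Q.ramBound F : ℚ)) / (ramIndex h : ℚ)

end Extension

end Place

/-- The divisor `D` of `F / k` is the conductor of `E / F`: the extension `E / F` is finite abelian
and the coefficient of `D` at each place `P` is the conductor exponent `c_P(E/F)`, which is
computed at any of the places `Q` of `E` over `P`. -/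
structure IsConductor (k F E : Type*) [Field k] [Field F] [Field E] [Algebra k F] [Algebra k E]
    [Algebra F E] (D : Place k F →₀ ℤ) : Prop where
  finite : FiniteDimensional F E
  abelian : IsAbelianGalois F E
  exists_liesOver : ∀ P : Place k F, ∃ Q : Place k E, Q.LiesOver P
  coeff_eq : ∀ (P : Place k F) (Q : Place k E) (h : Q.LiesOver P),
    (D P : ℚ) = Place.condExponent h

section RationalFunctionField

variable (k : Type*) [Field k]

open scoped Classical in
/-- The place `∞` of the rational function field `k(x)`, the pole of `x`. -/
def placeInfty : Place k (RatFunc k) where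
  ring := (RatFunc.inftyValuation k).valuationSubring
  algebraMap_mem c := by
    rw [Valuation.mem_valuationSubring_iff, RatFunc.algebraMap_eq_C]
    by_cases hc : c = 0
    · simp [hc]
    · rw [RatFunc.inftyValuation.C k hc]
  ne_top h := by
    have hX : (RatFunc.X : RatFunc k) ∈ (RatFunc.inftyValuation k).valuationSubring :=
      h ▸ ValuationSubring.mem_top _
    rw [Valuation.mem_valuationSubring_iff, RatFunc.inftyValuation.X] at hX
    exact absurd hX (by decide)

variable {k} in
/-- The height one prime `(x - α)` of `k[x]`. -/
def primeXSubC (α : k) : IsDedekindDomain.HeightOneSpectrum k[X] where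
  asIdeal := Ideal.span {X - C α}
  isPrime := (Ideal.span_singleton_prime (X_sub_C_ne_zero α)).2 (prime_X_sub_C α)
  ne_bot := by simpa using X_sub_C_ne_zero α

variable {k} in
/-- The place `P_α` of the rational function field `k(x)`, the zero of `x - α`. -/
def placeZero (α : k) : Place k (RatFunc k) where
  ring := ((primeXSubC α).valuation (RatFunc k)).valuationSubring
  algebraMap_mem c := by
    rw [Valuation.mem_valuationSubring_iff, IsScalarTower.algebraMap_apply k k[X] (RatFunc k)]
    exact (primeXSubC α).valuation_le_one _
  ne_top h := by
    have hlt : (primeXSubC α).valuation (RatFunc k) (algebraMap k[X] (RatFunc k) (X - C α)) < 1 :=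
      ((primeXSubC α).valuation_lt_one_iff_mem _).2 (Ideal.mem_span_singleton_self _)
    have hmem : (algebraMap k[X] (RatFunc k) (X - C α))⁻¹ ∈
        ((primeXSubC α).valuation (RatFunc k)).valuationSubring := h ▸ ValuationSubring.mem_top _
    rw [Valuation.mem_valuationSubring_iff, map_inv₀] at hmem
    have hne : (primeXSubC α).valuation (RatFunc k) (algebraMap k[X] (RatFunc k) (X - C α)) ≠ 0 :=
      (Valuation.ne_zero_iff _).2
        (by simpa using (RatFunc.algebraMap_ne_zero (X_sub_C_ne_zero α)))
    exact absurd hmem (not_le.2 ((one_lt_inv₀ (zero_lt_iff.2 hne)).2 hlt))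

end RationalFunctionField

section Carlitz

variable {k : Type*} [Field k] [Fintype k]

/-- The endomorphism `φ(z) = z^q + T z` of an algebraic closure of `K = k(x)`, where `q = |k|`
and `T ∈ K`; it is `k`-linear. -/
def carlitzEnd (T : RatFunc k) : Module.End k (AlgebraicClosure (RatFunc k)) :=
  (FiniteField.frobeniusAlgHom k (AlgebraicClosure (RatFunc k))).toLinearMap +
    LinearMap.mulLeft k (algebraMap (RatFunc k) (AlgebraicClosure (RatFunc k)) T)

/-- The set `Λ_M` of `M`-torsion points, for a polynomial `M` in `T`: the zeros of
`z ↦ z^M = M(φ)(z)`. -/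
def carlitzTorsion (T : RatFunc k) (M : k[X]) : Set (AlgebraicClosure (RatFunc k)) :=
  {z | (aeval (carlitzEnd T) M) z = 0}

/-- The cyclotomic function field `K(Λ_M)` over `K = k(x) = k(T)` with modulus `M(T)`. -/
abbrev cyclotomicFunctionField (T : RatFunc k) (M : k[X]) :
    IntermediateField (RatFunc k) (AlgebraicClosure (RatFunc k)) :=
  IntermediateField.adjoin (RatFunc k) (carlitzTorsion T M)

/-- The image of `k^*` in `Gal(K(Λ_M)/K)`: the automorphisms `σ_a`, `a ∈ k^*`, that act on `Λ_M`
by `λ ↦ λ^a = a λ`. -/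
def constUnits (T : RatFunc k) (M : k[X]) :
    Subgroup Gal(cyclotomicFunctionField T M/RatFunc k) where
  carrier := {σ | ∃ a : kˣ, ∀ z : cyclotomicFunctionField T M,
    (z : AlgebraicClosure (RatFunc k)) ∈ carlitzTorsion T M → σ z = (a : k) • z}
  one_mem' := ⟨1, fun z _ ↦ by simp⟩
  mul_mem' := by
    rintro σ τ ⟨a, ha⟩ ⟨b, hb⟩
    refine ⟨a * b, fun z hz ↦ ?_⟩
    have hl : σ ((b : k) • z) = (b : k) • σ z :=
      LinearMap.map_smul_of_tower σ.toLinearMap (b : k) z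
    rw [AlgEquiv.mul_apply, hb z hz, hl, ha z hz, smul_smul, Units.val_mul, mul_comm]
  inv_mem' := by
    rintro σ ⟨a, ha⟩
    refine ⟨a⁻¹, fun z hz ↦ ?_⟩
    have hl : σ (((a⁻¹ : kˣ) : k) • z) = ((a⁻¹ : kˣ) : k) • σ z :=
      LinearMap.map_smul_of_tower σ.toLinearMap ((a⁻¹ : kˣ) : k) z
    have hz' : σ (((a⁻¹ : kˣ) : k) • z) = z := by
      rw [hl, ha z hz, smul_smul, Units.inv_mul, one_smul]
    exact (AlgEquiv.symm_apply_eq σ).2 hz'.symm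

/-- The subfield `F` of `K(Λ_M)` fixed by `k^*`. -/
abbrev constUnitsFixedField (T : RatFunc k) (M : k[X]) :
    IntermediateField (RatFunc k) (cyclotomicFunctionField T M) :=
  IntermediateField.fixedField (constUnits T M)

/-- The cyclotomic function field `K_n = K(Λ_{T^{n+1}})` for `T = (x - α)⁻¹`. -/
abbrev cyclotomicK (α : k) (n : ℕ) :
    IntermediateField (RatFunc k) (AlgebraicClosure (RatFunc k)) :=
  cyclotomicFunctionField (RatFunc.X - RatFunc.C α)⁻¹ (X ^ (n + 1))

/-- The subfield `F` of `K_n` fixed by `k^*`. -/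
abbrev cyclotomicF (α : k) (n : ℕ) : IntermediateField (RatFunc k) (cyclotomicK α n) :=
  constUnitsFixedField (RatFunc.X - RatFunc.C α)⁻¹ (X ^ (n + 1))

end Carlitz

end

noncomputable section

set_option linter.unusedSectionVars false

/-! ### The normalized valuation of a place, and its ramification data -/

namespace Place

open IsDedekindDomain WithZero

variable {k F E : Type*} [Field k] [Field F] [Field E] [Algebra k F] [Algebra k E] [Algebra F E]
  {P : Place k F} {Q : Place k E}

/-! Write q = |k|, φ(z) = z^q + Tz, and Λ for the T^{n+1}-torsion. A root x of Φ(X) = φ^n(X)^{q-1} +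
T generates Λ as a k[φ]-module. Hence K_n = K(x), and every automorphism sends x to M(φ)(x) for some
polynomial M with M(0) ≠ 0. Moreover F = K(y) with y = x^{q-1}, a root of the polynomial Ψ with Φ(X)
= Ψ(X^{q-1}). Every place is treated by comparing absolute values of torsion points, in three cases.

Zero of T (the place ∞). Φ and Ψ are Eisenstein, so the integral closure is generated by π = x or π
= y. For such π with minimal polynomial f, d = ν(f'(π)) and a is the largest ν(σπ - π) with σ ≠ 1
(`LiesOver.condExponent_eq_of_adjoin_eq_top`). Differentiating φ^{n+1}(X) = φ^n(X) Φ(X), whose left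
side has derivative T^{n+1}, gives Φ'(x) φ^n(x) = T^{n+1}. No nonzero torsion point is smaller than
φ^n(x), and x ↦ x + φ^n(x) defines an automorphism because n ≥ 1. So d + a = ν(T^{n+1}) = (n+1)e.
For y, the smallest difference of conjugates gains a factor |x|^{q-2} and the derivative loses the
same factor, so the product does not change.

T a unit. Then φ^n(x) is a unit, and so are all differences of distinct conjugates: the exponent is
0.

Pole of T (the place P_α). A nonzero torsion point x' of minimal absolute value is a generator and
is smaller than every nonzero point of φ(Λ) (`IsCarlitzGenerator.exists_minimal`). If σ preserves
absolute values, then σx' - M(0)x' lies in φ(Λ) and is no larger than x', hence is 0. So the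
decomposition group acts on Λ through constants. It is therefore trivial for F, and for K_n when q =
2. When q > 2, the relation φ^n(x)^{q-1} = -T forces e = q - 1, which is tame: d = q - 2, a = 1, and
the exponent is 1 (`LiesOver.condExponent_eq_one`). -/

theorem lt_one_iff_le_exp_neg_one (x : ℤᵐ⁰) : x < 1 ↔ x ≤ exp (-1) := by
  by_cases hx : x = 0
  · simp [hx]
  · rw [← exp_zero, ← log_lt_iff_lt_exp hx, ← log_le_iff_le_exp hx]
    lia

theorem exists_eq_exp_neg_natCast {x : ℤᵐ⁰} (hx : x ≠ 0) (hx1 : x ≤ 1) :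
    ∃ m : ℕ, x = exp (-(m : ℤ)) := by
  rw [← exp_zero, ← log_le_iff_le_exp hx] at hx1
  exact ⟨(-log x).toNat, by rw [Int.toNat_of_nonneg (by lia), neg_neg, exp_log hx]⟩

theorem LiesOver.algebraMap_mem_iff (h : Q.LiesOver P) (x : F) :
    algebraMap F E x ∈ Q.ring ↔ x ∈ P.ring := by
  rw [show P.ring = _ from h]; rfl

theorem mem_maximalIdeal_iff_inv_notMem (V : ValuationSubring E) (z : V) (hz : (z : E) ≠ 0) :
    z ∈ IsLocalRing.maximalIdeal V ↔ (z : E)⁻¹ ∉ V := by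
  rw [IsLocalRing.mem_maximalIdeal, mem_nonunits_iff, not_iff_not]
  constructor
  · rintro ⟨u, rfl⟩
    have : ((u : V) : E)⁻¹ = ((u⁻¹ : Vˣ) : V) := by
      rw [inv_eq_iff_eq_inv, ← mul_eq_one_iff_eq_inv₀ (by simp)]
      exact congrArg (fun x : V ↦ (x : E)) (Units.mul_inv u)
    rw [this]
    exact SetLike.coe_mem _
  · intro hi
    exact IsUnit.of_mul_eq_one ⟨_, hi⟩ (Subtype.ext (mul_inv_cancel₀ hz))

theorem LiesOver.mem_center_iff (h : Q.LiesOver P) (b : P.intClosure E) (hb : (b : E) ≠ 0) :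
    b ∈ h.center ↔ (b : E)⁻¹ ∉ Q.ring :=
  mem_maximalIdeal_iff_inv_notMem Q.ring (h.incl b) hb

instance LiesOver.isPrime_center (h : Q.LiesOver P) : h.center.IsPrime :=
  Ideal.comap_isPrime _ _

instance LiesOver.liesOver_center (h : Q.LiesOver P) :
    h.center.LiesOver (IsLocalRing.maximalIdeal P.ring) := by
  constructor
  ext t
  rw [Ideal.under, Ideal.mem_comap]
  by_cases ht : (t : F) = 0
  · have : t = 0 := Subtype.ext ht
    simp [this]
  · have he : ((algebraMap P.ring (P.intClosure E) t : P.intClosure E) : E) = algebraMap F E t := rfl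
    rw [mem_maximalIdeal_iff_inv_notMem _ _ ht, h.mem_center_iff _ (by simpa [he] using ht),
      he, ← map_inv₀, h.algebraMap_mem_iff]

variable (P E) in
theorem isDedekindDomain_intClosure [IsDiscreteValuationRing P.ring] [FiniteDimensional F E]
    [Algebra.IsSeparable F E] : IsDedekindDomain (P.intClosure E) :=
  integralClosure.isDedekindDomain P.ring F E

variable (P E) in
theorem finite_intClosure [IsDiscreteValuationRing P.ring] [FiniteDimensional F E]
    [Algebra.IsSeparable F E] : Module.Finite P.ring (P.intClosure E) :=
  IsIntegralClosure.finite P.ring F E (P.intClosure E)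

variable (P E) in
theorem isFractionRing_intClosure [FiniteDimensional F E] : IsFractionRing (P.intClosure E) E :=
  IsIntegralClosure.isFractionRing_of_finite_extension P.ring F E (P.intClosure E)

variable (P E) in
theorem faithfulSMul_intClosure : FaithfulSMul P.ring (P.intClosure E) := by
  rw [faithfulSMul_iff_algebraMap_injective]
  intro a b hab
  exact Subtype.ext ((algebraMap F E).injective (congrArg Subtype.val hab))

attribute [local instance] FractionRing.liftAlgebra FractionRing.isScalarTower_liftAlgebra
  faithfulSMul_intClosure isDedekindDomain_intClosure finite_intClosure isFractionRing_intClosure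

theorem LiesOver.center_ne_bot [IsDiscreteValuationRing P.ring] (h : Q.LiesOver P) :
    h.center ≠ ⊥ :=
  Ideal.ne_bot_of_liesOver_of_ne_bot (IsDiscreteValuationRing.not_a_field P.ring) h.center

variable [IsDiscreteValuationRing P.ring] [FiniteDimensional F E] [Algebra.IsSeparable F E]

/-- The prime of the integral closure that corresponds to `Q`. -/
def LiesOver.prime (h : Q.LiesOver P) : HeightOneSpectrum (P.intClosure E) :=
  ⟨h.center, h.isPrime_center, h.center_ne_bot⟩

/-- The normalized discrete valuation of `E` that belongs to the place `Q`. -/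
def LiesOver.val (h : Q.LiesOver P) : Valuation E ℤᵐ⁰ :=
  h.prime.valuation E

theorem LiesOver.val_coe_le_one (h : Q.LiesOver P) (b : P.intClosure E) : h.val (b : E) ≤ 1 :=
  h.prime.valuation_le_one b

theorem LiesOver.val_coe_lt_one_iff (h : Q.LiesOver P) (b : P.intClosure E) :
    h.val (b : E) < 1 ↔ b ∈ h.center :=
  h.prime.valuation_lt_one_iff_mem b

theorem LiesOver.val_coe_eq_one_iff (h : Q.LiesOver P) (b : P.intClosure E) :
    h.val (b : E) = 1 ↔ b ∉ h.center := by
  rw [← h.val_coe_lt_one_iff, not_lt, (h.val_coe_le_one b).ge_iff_eq', eq_comm]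

theorem LiesOver.val_coe_le_exp_iff (h : Q.LiesOver P) (b : P.intClosure E) (i : ℕ) :
    h.val (b : E) ≤ exp (-(i : ℤ)) ↔ b ∈ h.center ^ i := by
  have := h.prime.intValuation_le_pow_iff_mem b i
  rwa [← h.prime.valuation_of_algebraMap (K := E) b] at this

theorem LiesOver.exists_eq_div (h : Q.LiesOver P) {x : E} (hx : h.val x ≤ 1) :
    ∃ b s : P.intClosure E, s ∉ h.center ∧ x * s = b := by
  obtain ⟨b, s, hs⟩ := h.prime.exists_primeCompl_mul_eq_of_integer x hx
  exact ⟨b, s, s.2, hs⟩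

theorem LiesOver.inv_mem_of_notMem_center (h : Q.LiesOver P) {s : P.intClosure E}
    (hs : s ∉ h.center) : (s : E)⁻¹ ∈ Q.ring := by
  by_cases h0 : (s : E) = 0
  · simp [h0]
  · by_contra hc
    exact hs ((h.mem_center_iff s h0).2 hc)

/-- `Q.ring` is the localization of the integral closure at the center. If x in `Q.ring` had value >
1, write x⁻¹ = b/s with b in the center and s outside it; then b⁻¹ = x s⁻¹ would lie in `Q.ring`,
which is impossible for b in the center. -/
theorem LiesOver.mem_ring_iff (h : Q.LiesOver P) (x : E) : x ∈ Q.ring ↔ h.val x ≤ 1 := by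
  constructor
  · intro hx
    by_contra! hlt
    have hx0 : x ≠ 0 := by rintro rfl; simp at hlt
    have hi : h.val x⁻¹ < 1 := by rw [map_inv₀]; exact inv_lt_one_of_one_lt₀ hlt
    obtain ⟨b, s, hs, hbs⟩ := h.exists_eq_div hi.le
    have hs1 := (h.val_coe_eq_one_iff s).2 hs
    have hb : b ∈ h.center := by
      rw [← h.val_coe_lt_one_iff, ← hbs, map_mul, hs1, mul_one]; exact hi
    have hs0 : (s : E) ≠ 0 := fun h0 ↦ by simp [h0] at hs1
    have hb0 : (b : E) ≠ 0 := by rw [← hbs]; exact mul_ne_zero (inv_ne_zero hx0) hs0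
    refine (h.mem_center_iff b hb0).1 hb ?_
    have : (b : E)⁻¹ = x * (s : E)⁻¹ := by rw [← hbs]; field_simp
    rw [this]
    exact mul_mem hx (h.inv_mem_of_notMem_center hs)
  · intro hx
    obtain ⟨b, s, hs, hbs⟩ := h.exists_eq_div hx
    have hs0 : (s : E) ≠ 0 := fun h0 ↦ by
      have := (h.val_coe_eq_one_iff s).2 hs
      simp [h0] at this
    have : x = b * (s : E)⁻¹ := by rw [← hbs]; field_simp
    rw [this]
    exact mul_mem (h.mem_ring b) (h.inv_mem_of_notMem_center hs)

theorem LiesOver.exists_val_eq_exp_neg_one (h : Q.LiesOver P) : ∃ x : E, h.val x = exp (-1) :=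
  h.prime.valuation_exists_uniformizer E

theorem LiesOver.mem_maximalIdeal_pow_iff (h : Q.LiesOver P) (z : Q.ring) (i : ℕ) :
    z ∈ IsLocalRing.maximalIdeal Q.ring ^ i ↔ h.val (z : E) ≤ exp (-(i : ℤ)) := by
  obtain ⟨ϖ, hϖ⟩ := h.exists_val_eq_exp_neg_one
  have hϖm : ϖ ∈ Q.ring := (h.mem_ring_iff ϖ).2 (by rw [hϖ, ← exp_zero, exp_le_exp]; simp)
  have hϖ0 : ϖ ≠ 0 := by rintro rfl; rw [map_zero] at hϖ; exact exp_ne_zero hϖ.symm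
  have key : ∀ (j : ℕ) (z : Q.ring), h.val (z : E) ≤ exp (-(j : ℤ)) ↔
      z ∈ Ideal.span {(⟨ϖ, hϖm⟩ : Q.ring) ^ j} := by
    intro j z
    have hj : h.val (ϖ ^ j) = exp (-(j : ℤ)) := by
      rw [map_pow, hϖ, ← exp_nsmul]; simp
    rw [Ideal.mem_span_singleton']
    constructor
    · intro hz
      refine ⟨⟨z * (ϖ ^ j)⁻¹, (h.mem_ring_iff _).2 ?_⟩, Subtype.ext ?_⟩
      · rw [map_mul, map_inv₀, hj]
        exact mul_inv_le_one_of_le₀ hz zero_le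
      · simp [hϖ0]
    · rintro ⟨a, rfl⟩
      have : ((a * (⟨ϖ, hϖm⟩ : Q.ring) ^ j : Q.ring) : E) = a * ϖ ^ j := rfl
      rw [this, map_mul, hj]
      exact mul_le_of_le_one_left' ((h.mem_ring_iff _).1 a.2)
  have hm : IsLocalRing.maximalIdeal Q.ring = Ideal.span {(⟨ϖ, hϖm⟩ : Q.ring)} := by
    ext z
    rw [← pow_one (⟨ϖ, hϖm⟩ : Q.ring), ← key 1 z]
    by_cases hz : (z : E) = 0
    · have : z = 0 := Subtype.ext hz
      simp [this]
    · rw [mem_maximalIdeal_iff_inv_notMem _ _ hz, h.mem_ring_iff, map_inv₀, not_le,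
        one_lt_inv₀ (by simpa [zero_lt_iff] using hz), lt_one_iff_le_exp_neg_one]
      rfl
  rw [hm, Ideal.span_singleton_pow, key]

/-- Both sides measure the largest i with t in the i-th power of the center. This turns the
ideal-theoretic index into a value. -/
theorem LiesOver.val_algebraMap_uniformizer (h : Q.LiesOver P) {t : P.ring}
    (ht : IsLocalRing.maximalIdeal P.ring = Ideal.span {t}) :
    h.val (algebraMap F E t) = exp (-(ramIndex h : ℤ)) := by
  have ht0 : (t : F) ≠ 0 := by
    intro h0
    have : t = 0 := Subtype.ext h0
    exact IsDiscreteValuationRing.not_a_field P.ring (by simp [ht, this])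
  set b : P.intClosure E := algebraMap P.ring (P.intClosure E) t with hb
  have hbE : (b : E) = algebraMap F E t := rfl
  obtain ⟨e, he⟩ := exists_eq_exp_neg_natCast (x := h.val (b : E)) (by simpa [hbE] using ht0)
    (h.val_coe_le_one b)
  have hiff : ∀ i, (IsLocalRing.maximalIdeal P.ring).map (algebraMap P.ring (P.intClosure E)) ≤
      h.center ^ i ↔ i ≤ e := by
    intro i
    rw [ht, Ideal.map_span, Set.image_singleton, Ideal.span_singleton_le_iff_mem, ← hb,
      ← h.val_coe_le_exp_iff, he, exp_le_exp]
    lia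
  rw [← hbE, he, ramIndex, Ideal.ramificationIdx'_spec ((hiff e).2 le_rfl)
    (fun hc ↦ by have := (hiff _).1 hc; lia)]

theorem LiesOver.ramIndex_ne_zero (h : Q.LiesOver P) : ramIndex h ≠ 0 := by
  obtain ⟨t, ht⟩ := (IsPrincipalIdealRing.principal (IsLocalRing.maximalIdeal P.ring)).principal
  intro h0
  have h1 := h.val_algebraMap_uniformizer ht
  rw [h0] at h1
  have : algebraMap P.ring (P.intClosure E) t ∉ h.center :=
    (h.val_coe_eq_one_iff (algebraMap P.ring (P.intClosure E) t)).1 (h1.trans (by simp))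
  apply this
  rw [← Ideal.mem_comap, ← Ideal.under_def, ← Ideal.over_def h.center (IsLocalRing.maximalIdeal P.ring), ht]
  exact Ideal.mem_span_singleton_self t

variable (P E) in
theorem differentOver_eq : P.differentOver E = differentIdeal P.ring (P.intClosure E) := by
  rw [differentOver, ← coeSubmodule_differentIdeal P.ring F, IsLocalization.coeSubmodule,
    Submodule.comap_map_eq_of_injective]
  exact IsFractionRing.injective (P.intClosure E) E

-- `differentIdeal_ne_bot` asks for separability of the abstract fraction fields, so it is
-- transported from `E` over `F`.
variable (P E) in
theorem isSeparable_fractionRing_intClosure :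
    Algebra.IsSeparable (FractionRing P.ring) (FractionRing (P.intClosure E)) := by
  have H : RingHom.comp (algebraMap (FractionRing P.ring) (FractionRing (P.intClosure E)))
      ↑(FractionRing.algEquiv P.ring F).symm.toRingEquiv =
        RingHom.comp ↑(FractionRing.algEquiv (P.intClosure E) E).symm.toRingEquiv
          (algebraMap F E) := by
    apply IsLocalization.ringHom_ext (nonZeroDivisors P.ring)
    ext a
    simp only [RingHom.coe_comp, RingHom.coe_coe,
      AlgEquiv.coe_ringEquiv, Function.comp_apply, AlgEquiv.commutes,
      ← IsScalarTower.algebraMap_apply]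
    rw [IsScalarTower.algebraMap_apply P.ring (P.intClosure E) E, AlgEquiv.commutes,
      ← IsScalarTower.algebraMap_apply]
  exact Algebra.IsSeparable.of_equiv_equiv _ _ H

attribute [local instance] isSeparable_fractionRing_intClosure

variable (P E) in
theorem differentOver_ne_bot : P.differentOver E ≠ ⊥ := by
  rw [differentOver_eq]
  exact differentIdeal_ne_bot

theorem LiesOver.val_eq_exp_neg_diffExponent (h : Q.LiesOver P) {y : P.intClosure E} (hy : y ≠ 0)
    (hD : P.differentOver E = Ideal.span {y}) :
    h.val (y : E) = exp (-(diffExponent h : ℤ)) := by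
  obtain ⟨d, hd⟩ := exists_eq_exp_neg_natCast (x := h.val (y : E)) (by simpa using hy)
    (h.val_coe_le_one y)
  have hiff : ∀ i, h.center ^ i ∣ P.differentOver E ↔ i ≤ d := by
    intro i
    rw [hD, Ideal.dvd_iff_le, Ideal.span_singleton_le_iff_mem, 
      ← h.val_coe_le_exp_iff, hd, exp_le_exp]
    lia
  rw [hd, diffExponent, multiplicity_eq_of_dvd_of_not_dvd ((hiff d).2 le_rfl)
    (fun hc ↦ by have := (hiff _).1 hc; lia)]

theorem LiesOver.mem_ramGroup_iff (h : Q.LiesOver P) (σ : Gal(E/F)) (i : ℕ) :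
    σ ∈ Q.ramGroup F i ↔ ∀ z ∈ Q.ring, h.val (σ z - z) ≤ exp (-((i + 1 : ℕ) : ℤ)) := by
  constructor
  · intro hσ z hz
    obtain ⟨w, hw, hwz⟩ := hσ ⟨z, hz⟩
    rw [← hwz]
    exact (h.mem_maximalIdeal_pow_iff _ _).1 hw
  · intro hσ z
    have hz := hσ z z.2
    have hm : σ (z : E) - z ∈ Q.ring := by
      refine (h.mem_ring_iff _).2 (hz.trans ?_)
      rw [← exp_zero, exp_le_exp]; lia
    exact ⟨⟨_, hm⟩, (h.mem_maximalIdeal_pow_iff _ _).2 hz, rfl⟩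

/-- Write z = b/s with s a unit at Q. Then (σz - z) σs = (σb - b) - z(σs - s), and σs is a unit as
well, so the bound on the integral closure passes to the whole valuation ring. -/
theorem LiesOver.mem_ramGroup_of_intClosure (h : Q.LiesOver P) (σ : Gal(E/F)) (i : ℕ)
    (hσ : ∀ b : P.intClosure E, h.val (σ (b : E) - b) ≤ exp (-((i + 1 : ℕ) : ℤ))) :
    σ ∈ Q.ramGroup F i := by
  rw [h.mem_ramGroup_iff]
  intro z hz
  obtain ⟨b, s, hs, hbs⟩ := h.exists_eq_div ((h.mem_ring_iff z).1 hz)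
  have hs1 := (h.val_coe_eq_one_iff s).2 hs
  have hlt : h.val (σ (s : E) - s) < h.val (s : E) := by
    rw [hs1]
    refine (hσ s).trans_lt ?_
    rw [← exp_zero, exp_lt_exp]; lia
  have hσs : h.val (σ (s : E)) = 1 := by
    rw [← hs1]
    have := Valuation.map_add_eq_of_lt_left h.val hlt
    rwa [add_sub_cancel] at this
  have hz1 : h.val z ≤ 1 := (h.mem_ring_iff z).1 hz
  have e1 : (σ z - z) * σ (s : E) = (σ (b : E) - b) - z * (σ (s : E) - s) := by
    rw [← hbs, map_mul]; ring
  have e2 : h.val (σ z - z) = h.val ((σ (b : E) - b) - z * (σ (s : E) - s)) := by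
    rw [← e1, map_mul, hσs, mul_one]
  rw [e2]
  refine (Valuation.map_sub _ _ _).trans (max_le (hσ b) ?_)
  rw [map_mul]
  exact (mul_le_of_le_one_left' hz1).trans (hσ s)

theorem LiesOver.one_mem_ramGroup (h : Q.LiesOver P) (i : ℕ) : (1 : Gal(E/F)) ∈ Q.ramGroup F i := by
  rw [h.mem_ramGroup_iff]
  intro z _
  simp

end Place

/-! ### Conductor exponents from the conjugates of a generator -/

namespace Place

open IsDedekindDomain WithZero

attribute [local instance] FractionRing.liftAlgebra FractionRing.isScalarTower_liftAlgebra
  faithfulSMul_intClosure isDedekindDomain_intClosure finite_intClosure isFractionRing_intClosure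
  isSeparable_fractionRing_intClosure

variable {k F E : Type*} [Field k] [Field F] [Field E] [Algebra k F] [Algebra k E] [Algebra F E]
  {P : Place k F} {Q : Place k E}
  [IsDiscreteValuationRing P.ring] [FiniteDimensional F E] [IsGalois F E]

theorem LiesOver.ramBound_eq_zero (h : Q.LiesOver P)
    (h0 : ∀ σ ∈ Q.ramGroup F 0, σ = 1) : Q.ramBound F = 0 := by
  have : 0 ∈ {l : ℕ | ∀ i, l ≤ i → Q.ramGroup F i = {1}} := by
    intro i _
    refine Set.eq_singleton_iff_unique_mem.2 ⟨h.one_mem_ramGroup i, fun σ hσ ↦ h0 σ ?_⟩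
    rw [h.mem_ramGroup_iff] at hσ ⊢
    intro z hz
    refine (hσ z hz).trans (exp_le_exp.2 ?_)
    lia
  exact Nat.sInf_eq_zero.2 (Or.inl this)

theorem LiesOver.ramBound_eq_succ (h : Q.LiesOver P) (m : ℕ)
    (h1 : ∀ σ ∈ Q.ramGroup F (m + 1), σ = 1) (h2 : ∃ σ ∈ Q.ramGroup F m, σ ≠ 1) :
    Q.ramBound F = m + 1 := by
  have hmem : m + 1 ∈ {l : ℕ | ∀ i, l ≤ i → Q.ramGroup F i = {1}} := by
    intro i hi
    refine Set.eq_singleton_iff_unique_mem.2 ⟨h.one_mem_ramGroup i, fun σ hσ ↦ h1 σ ?_⟩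
    rw [h.mem_ramGroup_iff] at hσ ⊢
    intro z hz
    refine (hσ z hz).trans (exp_le_exp.2 ?_)
    lia
  refine le_antisymm (Nat.sInf_le hmem) ?_
  by_contra! hlt
  obtain ⟨σ, hσ, hσ1⟩ := h2
  have := Nat.sInf_mem ⟨_, hmem⟩ m (by exact Nat.lt_succ_iff.1 hlt)
  rw [this] at hσ
  exact hσ1 hσ

theorem coe_aeval_derivative_minpoly (π : P.intClosure E) :
    ((aeval π (derivative (minpoly P.ring π)) : P.intClosure E) : E) =
      aeval (π : E) (derivative (minpoly F (π : E))) := by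
  have hint : IsIntegral P.ring π := Algebra.IsIntegral.isIntegral π
  have h := minpoly.isIntegrallyClosed_eq_field_fractions F E hint
  change minpoly F (π : E) = _ at h
  rw [h, derivative_map, aeval_map_algebraMap]
  exact (aeval_algebraMap_apply E π _).symm

/-- The derivative at π is the product of π - a over the other roots a, and by normality each of
them is a conjugate σπ ≠ π. -/
theorem val_aeval_derivative_minpoly_eq_one {Γ : Type*} [LinearOrderedCommGroupWithZero Γ]
    (v : Valuation E Γ) (π : E) (hu : ∀ σ : Gal(E/F), σ π ≠ π → v (σ π - π) = 1) :
    v (aeval π (derivative (minpoly F π))) = 1 := by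
  classical
  have hint : IsIntegral F π := Algebra.IsIntegral.isIntegral π
  set g := (minpoly F π).map (algebraMap F E) with hg
  have hs : g.Splits := Normal.splits inferInstance π
  have hmon : g.Monic := (minpoly.monic hint).map _
  have hroot : π ∈ g.roots := by
    rw [mem_roots hmon.ne_zero, IsRoot, hg, eval_map_algebraMap, minpoly.aeval]
  have hsep : g.Separable := Separable.map (Algebra.IsSeparable.isSeparable F π)
  have hprod : g = (g.roots.map fun a ↦ X - C a).prod := hs.eq_prod_roots_of_monic hmon
  obtain ⟨s, hsr⟩ := Multiset.exists_cons_of_mem hroot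
  rw [hsr, Multiset.map_cons, Multiset.prod_cons] at hprod
  have hder : aeval π (derivative (minpoly F π)) = (s.map fun a ↦ π - a).prod := by
    rw [← eval_map_algebraMap, ← derivative_map, ← hg, hprod]
    simp [derivative_mul, eval_multiset_prod, Multiset.map_map]
  have hnod : (π ::ₘ s).Nodup := hsr ▸ nodup_roots hsep
  rw [hder, map_multiset_prod, Multiset.map_map]
  refine Multiset.prod_eq_one ?_
  intro x hx
  obtain ⟨a, ha, rfl⟩ := Multiset.mem_map.1 hx
  have har : a ∈ g.roots := hsr ▸ Multiset.mem_cons_of_mem ha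
  rw [mem_roots hmon.ne_zero, IsRoot, hg, eval_map_algebraMap] at har
  obtain ⟨σ, rfl⟩ := minpoly.exists_algEquiv_of_root' hint.isAlgebraic har
  have hne : σ π ≠ π := by
    intro he
    rw [he] at ha
    exact (Multiset.nodup_cons.1 hnod).1 ha
  simp only [Function.comp_apply]
  rw [Valuation.map_sub_swap, hu σ hne]

/-- If `E = F(π)` with `π` integral at `P` such that the differences of distinct conjugates of `π`
are units at `Q`, then the conductor exponent vanishes. -/
theorem LiesOver.condExponent_eq_zero (h : Q.LiesOver P) (π : P.intClosure E)
    (hgen : Algebra.adjoin F {(π : E)} = ⊤)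
    (hu : ∀ σ : Gal(E/F), σ ≠ 1 → h.val (σ π - π) = 1) : condExponent h = 0 := by
  have hd : diffExponent h = 0 := by
    rw [diffExponent, multiplicity_eq_zero, differentOver_eq, Ideal.dvd_iff_le]
    intro hle
    -- The derivative of the minimal polynomial at any integral generator lies in the different,
    -- even when π does not generate the integral closure; here it is a unit at Q.
    have hm := hle (aeval_derivative_mem_differentIdeal P.ring F E π hgen)
    rw [← h.val_coe_lt_one_iff, coe_aeval_derivative_minpoly,
      val_aeval_derivative_minpoly_eq_one h.val (π : E) ?_] at hm
    · exact lt_irrefl _ hm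
    · intro σ hσ
      exact hu σ fun h1 ↦ hσ (by rw [h1]; rfl)
  have ha : Q.ramBound F = 0 := h.ramBound_eq_zero fun σ hσ ↦ by
    by_contra hne
    have := (h.mem_ramGroup_iff σ 0).1 hσ π (h.mem_ring π)
    rw [hu σ hne, ← exp_zero, exp_le_exp] at this
    lia
  simp [condExponent, hd, ha]

/-- Every b is f(π) with coefficients in `P.ring`, and σπ - π divides f(σπ) - f(π) = σb - b. So only
the generator has to be tested. -/
theorem LiesOver.mem_ramGroup_of_adjoin_eq_top (h : Q.LiesOver P) {π : P.intClosure E}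
    (hadj : Algebra.adjoin P.ring {π} = ⊤) (σ : Gal(E/F)) (i : ℕ)
    (hσ : h.val (σ π - π) ≤ exp (-((i + 1 : ℕ) : ℤ))) : σ ∈ Q.ramGroup F i := by
  refine h.mem_ramGroup_of_intClosure σ i fun b ↦ ?_
  obtain ⟨f, rfl⟩ : ∃ f : P.ring[X], aeval π f = b := by
    have : b ∈ Algebra.adjoin P.ring {π} := hadj ▸ Algebra.mem_top
    rwa [Algebra.adjoin_singleton_eq_range_aeval] at this
  obtain ⟨c, hc⟩ := sub_dvd_eval_sub (σ • π) π (f.map (algebraMap P.ring (P.intClosure E)))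
  have h1 : (aeval (σ • π) f : P.intClosure E) = σ • aeval π f :=
    (aeval_algHom_apply (MulSemiringAction.toAlgHom P.ring (P.intClosure E) σ) π f)
  rw [eval_map_algebraMap, eval_map_algebraMap, h1] at hc
  have h2 : σ ((aeval π f : P.intClosure E) : E) - (aeval π f : P.intClosure E) =
      (σ π - π) * c := congrArg Subtype.val hc
  rw [h2, map_mul]
  exact (mul_le_of_le_one_right' (h.val_coe_le_one c)).trans hσ

/-- The conductor of the order generated by π times the different is generated by f'(π), and that
conductor is the unit ideal here. -/
theorem differentOver_eq_span {π : P.intClosure E}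
    (hadj : Algebra.adjoin P.ring {π} = ⊤) (hgen : Algebra.adjoin F {(π : E)} = ⊤) :
    P.differentOver E = Ideal.span {aeval π (derivative (minpoly P.ring π))} := by
  have h := conductor_mul_differentIdeal P.ring F E π hgen
  rw [conductor_eq_top_of_adjoin_eq_top hadj, Ideal.top_mul] at h
  rw [differentOver_eq, h]

/-- The conductor exponent in the case that the integral closure of the valuation ring is generated
by one element `π`. -/
theorem LiesOver.condExponent_eq_of_adjoin_eq_top (h : Q.LiesOver P) {π : P.intClosure E}
    (hadj : Algebra.adjoin P.ring {π} = ⊤) (hgen : Algebra.adjoin F {(π : E)} = ⊤)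
    {σ₀ : Gal(E/F)} (hσ₀ : σ₀ ≠ 1)
    (hmax : ∀ σ : Gal(E/F), σ ≠ 1 → h.val (σ₀ π - π) ≤ h.val (σ π - π))
    (hlt : h.val (σ₀ π - π) < 1) {t : P.ring}
    (ht : IsLocalRing.maximalIdeal P.ring = Ideal.span {t}) (N : ℕ)
    (hder : h.val (aeval (π : E) (derivative (minpoly F (π : E)))) * h.val (σ₀ π - π) =
      h.val (algebraMap F E t) ^ N) : condExponent h = N := by
  have hinj : ∀ σ : Gal(E/F), σ π = (π : E) → σ = 1 := by
    intro σ hσ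
    refine AlgEquiv.coe_toAlgHom_injective ?_
    refine AlgHom.ext_of_adjoin_eq_top hgen ?_
    rintro _ rfl
    exact hσ
  have hne : h.val (σ₀ π - π) ≠ 0 := by
    rw [Valuation.ne_zero_iff, sub_ne_zero]
    exact fun hc ↦ hσ₀ (hinj σ₀ hc)
  obtain ⟨a, ha⟩ := exists_eq_exp_neg_natCast hne hlt.le
  -- With ν(σ₀π - π) = m + 1, σ₀ survives in the m-th ramification group and nothing but 1 survives
  -- in the next, so a = m + 1 as well. The hypothesis `hder` then reads d + a = Ne.
  obtain ⟨m, rfl⟩ : ∃ m, a = m + 1 := by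
    refine Nat.exists_eq_succ_of_ne_zero ?_
    rintro rfl
    rw [ha] at hlt
    simp at hlt
  have hram : Q.ramBound F = m + 1 := by
    refine h.ramBound_eq_succ m (fun σ hσ ↦ ?_)
      ⟨σ₀, h.mem_ramGroup_of_adjoin_eq_top hadj σ₀ m ha.le, hσ₀⟩
    by_contra hne
    have h1 := hmax σ hne
    have h2 := (h.mem_ramGroup_iff σ _).1 hσ π (h.mem_ring π)
    rw [ha] at h1
    have := exp_le_exp.1 (h1.trans h2)
    lia
  set y : P.intClosure E := aeval π (derivative (minpoly P.ring π)) with hy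
  have hyE : (y : E) = _ := coe_aeval_derivative_minpoly π
  have hD : P.differentOver E = Ideal.span {y} := differentOver_eq_span hadj hgen
  have hy0 : y ≠ 0 := by
    rintro h0
    exact differentOver_ne_bot E P (by simp [hD, h0])
  have hd := h.val_eq_exp_neg_diffExponent hy0 hD
  rw [← hyE, hd, ha, h.val_algebraMap_uniformizer ht, ← exp_add, ← exp_nsmul, exp_inj] at hder
  have he := h.ramIndex_ne_zero
  rw [condExponent, hram, div_eq_iff (by exact_mod_cast he)]
  have hZ : (diffExponent h : ℤ) + ((m + 1 : ℕ) : ℤ) = N * ramIndex h := by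
    simp only [nsmul_eq_mul] at hder
    lia
  exact_mod_cast hZ

end Place

/-! ### Decomposition groups and the tame bound for the different -/

section DecompositionGroup

open scoped Pointwise

attribute [local instance] FractionRing.liftAlgebra FractionRing.isScalarTower_liftAlgebra

variable {A B G : Type*} [CommRing A] [CommRing B] [Algebra A B] [Group G]
  [Finite G] [MulSemiringAction G B]

theorem Ideal.smul_mem_iff_of_mem_stabilizer {𝔓 : Ideal B} {σ : G}
    (hσ : σ ∈ MulAction.stabilizer G 𝔓) (b : B) : σ • b ∈ 𝔓 ↔ b ∈ 𝔓 := by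
  conv_lhs => rw [← MulAction.mem_stabilizer_iff.1 hσ]
  exact Ideal.smul_mem_pointwise_smul_iff

/-- Compare |G| = (number of primes over p)·e·f with orbit-stabilizer: the orbit of 𝔓 consists of
all primes over p. -/
theorem Ideal.card_stabilizer_eq_mul [IsDomain A] [IsDedekindDomain B] [Module.IsTorsionFree A B]
    [Module.Finite A B] [Module.Flat A B] [IsGaloisGroup G A B] (p : Ideal A) [p.IsPrime] (hp : p ≠ ⊥)
    (𝔓 : Ideal B) [𝔓.IsPrime] [𝔓.LiesOver p] :
    Nat.card (MulAction.stabilizer G 𝔓) = Ideal.ramificationIdx' p 𝔓 * 𝔓.inertiaDeg A := by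
  have h1 := Ideal.ncard_primesOver_mul_ramificationIdxIn_mul_inertiaDegIn p B G
  rw [Ideal.ramificationIdxIn_eq_ramificationIdx p 𝔓 G,
    Ideal.inertiaDegIn_eq_inertiaDeg p 𝔓 G,
    ← Ideal.ramificationIdx'_eq_ramificationIdx p 𝔓 hp,
    ← Algebra.IsInvariant.orbit_eq_primesOver A B G p 𝔓,
    ← Nat.card_congr (MulAction.orbitProdStabilizerEquivGroup G 𝔓), Nat.card_prod,
    Nat.card_coe_set_eq] at h1
  refine (mul_left_cancel₀ ?_ h1).symm
  have : (MulAction.orbit G 𝔓).Finite := Set.finite_range _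
  exact (Set.ncard_pos this).2 ⟨_, MulAction.mem_orbit_self _⟩ |>.ne'

/-- Without residue extension, b is congruent mod 𝔓 to an element of A, which σ fixes. -/
theorem Ideal.smul_sub_mem_of_inertiaDeg_eq_one [SMulCommClass G A B] (p : Ideal A)
    [p.IsMaximal] (𝔓 : Ideal B) [𝔓.IsMaximal] [𝔓.LiesOver p] (hf : 𝔓.inertiaDeg A = 1) {σ : G}
    (hσ : σ ∈ MulAction.stabilizer G 𝔓) (b : B) : σ • b - b ∈ 𝔓 := by
  rw [Ideal.inertiaDeg_eq_of_isMaximal p] at hf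
  let _ : Field (A ⧸ p) := Ideal.Quotient.field _
  obtain ⟨c, hc⟩ := (finrank_eq_one_iff_of_nonzero' (1 : B ⧸ 𝔓)
    one_ne_zero).1 hf (Ideal.Quotient.mk _ b)
  obtain ⟨a, rfl⟩ := Ideal.Quotient.mk_surjective c
  have hba : b - algebraMap A B a ∈ 𝔓 := by
    rw [← Ideal.Quotient.eq_zero_iff_mem, map_sub, ← hc, sub_eq_zero, Algebra.smul_def, mul_one]
    rfl
  have h2 := (Ideal.smul_mem_iff_of_mem_stabilizer hσ _).2 hba
  rw [smul_sub, smul_algebraMap] at h2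
  have h3 := sub_mem h2 hba
  rwa [sub_sub_sub_cancel_right] at h3

/-- Choose x in I with x ≡ 1 mod 𝔓. If σ stabilizes 𝔓 then σx ≡ 1; otherwise σx lies in 𝔓. So the
trace of x is congruent to the order of the stabilizer, which is nonzero mod 𝔓, whereas divisibility
of the different by 𝔓^e would force the trace of x into p. -/
theorem not_dvd_differentIdeal_of_natCard_stabilizer_notMem [Fintype G]
    [IsDedekindDomain A] [IsDedekindDomain B] [Module.IsTorsionFree A B] [Module.Finite A B]
    [IsGaloisGroup G A B]
    [Algebra.IsSeparable (FractionRing A) (FractionRing B)]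
    (htrace : ∀ x : B, algebraMap A B (Algebra.intTrace A B x) = ∑ σ : G, σ • x)
    (p : Ideal A) (𝔓 I : Ideal B) [h𝔓 : 𝔓.IsMaximal] [𝔓.LiesOver p] {e : ℕ}
    (hI : p.map (algebraMap A B) = 𝔓 ^ e * I) (hnle : ¬ I ≤ 𝔓)
    (hcard : (Nat.card (MulAction.stabilizer G 𝔓) : B) ∉ 𝔓) :
    ¬ 𝔓 ^ e ∣ differentIdeal A B := by
  classical
  obtain ⟨x, hxI, c, hc, hxc⟩ : ∃ x ∈ I, ∃ c ∈ 𝔓, x + c = 1 := by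
    have : I ⊔ 𝔓 = ⊤ := by
      rw [sup_comm]
      exact h𝔓.1.2 _ (left_lt_sup.2 hnle)
    exact Submodule.mem_sup.1 (this ▸ Submodule.mem_top (x := (1 : B)))
  refine not_dvd_differentIdeal_of_intTrace_not_mem A _ I hI.symm x hxI fun hmem ↦ hcard ?_
  have h1 : ∑ σ : G, σ • x ∈ 𝔓 := by
    rw [← htrace, ← Ideal.mem_comap, ← Ideal.under_def, ← Ideal.over_def 𝔓 p]
    exact hmem
  have hcongr : ∀ σ : G, σ • x - (if σ ∈ MulAction.stabilizer G 𝔓 then 1 else 0) ∈ 𝔓 := by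
    intro σ
    split_ifs with hσ
    · have : σ • x - 1 = - (σ • c) := by
        rw [eq_sub_of_add_eq hxc, smul_sub, smul_one]; ring
      rw [this, neg_mem_iff]
      exact (Ideal.smul_mem_iff_of_mem_stabilizer hσ c).2 hc
    · rw [sub_zero]
      by_contra hx
      apply hσ
      have hpr : (σ⁻¹ • 𝔓).IsPrime := inferInstance
      -- σ⁻¹𝔓 also lies over p, so being prime it contains 𝔓 (hence equals it, which is excluded) or
      -- contains I, and with it x.
      have hle : 𝔓 ^ e * I ≤ σ⁻¹ • 𝔓 := by
        rw [← hI, Ideal.map_le_iff_le_comap, ← Ideal.under_def,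
          ← Ideal.over_def (σ⁻¹ • 𝔓) p]
      rcases hpr.mul_le.1 hle with h3 | h3
      · have h5 := h𝔓.eq_of_le hpr.ne_top (hpr.le_of_pow_le h3)
        rw [MulAction.mem_stabilizer_iff]
        exact eq_inv_smul_iff.1 h5
      · exact absurd (by simpa [Ideal.mem_inv_pointwise_smul_iff] using h3 hxI) hx
  have h2 := sub_mem h1 (sum_mem fun σ (_ : σ ∈ Finset.univ) ↦ hcongr σ)
  rw [Finset.sum_sub_distrib, sub_sub_cancel, Finset.sum_boole] at h2
  convert h2
  rw [Nat.card_eq_fintype_card, Fintype.card_subtype]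

end DecompositionGroup

/-! ### The decomposition group of a place and tame ramification -/

namespace Place

open IsDedekindDomain WithZero
open scoped Pointwise

attribute [local instance] FractionRing.liftAlgebra FractionRing.isScalarTower_liftAlgebra
  faithfulSMul_intClosure isDedekindDomain_intClosure finite_intClosure isFractionRing_intClosure
  isSeparable_fractionRing_intClosure

variable {k F E : Type*} [Field k] [Field F] [Field E] [Algebra k F] [Algebra k E] [Algebra F E]
  {P : Place k F} {Q : Place k E}
  [IsDiscreteValuationRing P.ring] [FiniteDimensional F E] [IsGalois F E]

instance isGaloisGroup_intClosure : IsGaloisGroup Gal(E/F) P.ring (P.intClosure E) :=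
  IsGaloisGroup.of_isFractionRing Gal(E/F) P.ring (P.intClosure E) F E

theorem coe_galSMul (σ : Gal(E/F)) (b : P.intClosure E) :
    ((σ • b : P.intClosure E) : E) = σ (b : E) := rfl

/-- The decomposition group of `Q`. -/
def LiesOver.decomp (h : Q.LiesOver P) : Subgroup Gal(E/F) :=
  MulAction.stabilizer Gal(E/F) h.center

theorem LiesOver.smul_mem_center_iff (h : Q.LiesOver P) {σ : Gal(E/F)} (hσ : σ ∈ h.decomp)
    (b : P.intClosure E) : σ • b ∈ h.center ↔ b ∈ h.center :=
  Ideal.smul_mem_iff_of_mem_stabilizer hσ b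

/-- An automorphism in the decomposition group preserves the valuation ring. -/
theorem LiesOver.apply_mem_ring_of_mem_decomp (h : Q.LiesOver P) {σ : Gal(E/F)}
    (hσ : σ ∈ h.decomp) {z : E} (hz : z ∈ Q.ring) : σ z ∈ Q.ring := by
  obtain ⟨b, s, hs, hbs⟩ := h.exists_eq_div ((h.mem_ring_iff z).1 hz)
  have hs' : σ • s ∉ h.center := fun hc ↦ hs ((h.smul_mem_center_iff hσ s).1 hc)
  have hs1 := (h.val_coe_eq_one_iff _).2 hs'
  rw [h.mem_ring_iff]
  have : σ z * ((σ • s : P.intClosure E) : E) = (σ • b : P.intClosure E) := by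
    rw [coe_galSMul, coe_galSMul, ← hbs, map_mul]
  calc h.val (σ z) = h.val (σ z * ((σ • s : P.intClosure E) : E)) := by
        rw [map_mul, hs1, mul_one]
    _ ≤ 1 := by rw [this]; exact h.val_coe_le_one _

theorem LiesOver.isMaximal_center (h : Q.LiesOver P) : h.center.IsMaximal :=
  h.isPrime_center.isMaximal h.center_ne_bot

theorem algebraMap_intTrace_eq_sum (x : P.intClosure E) :
    algebraMap P.ring (P.intClosure E) (Algebra.intTrace P.ring (P.intClosure E) x) =
      ∑ σ : Gal(E/F), σ • x := by
  apply IsFractionRing.injective (P.intClosure E) E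
  rw [← IsScalarTower.algebraMap_apply P.ring (P.intClosure E) E,
    IsScalarTower.algebraMap_apply P.ring F E, Algebra.algebraMap_intTrace (L := E),
    trace_eq_sum_automorphisms, map_sum]
  rfl

/-- If the order of the decomposition group is prime to the residue characteristic, then
`d(Q|P) = e(Q|P) - 1`. -/
theorem LiesOver.diffExponent_eq_ramIndex_sub_one (h : Q.LiesOver P)
    (hcard : (Nat.card h.decomp : P.intClosure E) ∉ h.center) :
    diffExponent h = ramIndex h - 1 := by
  have hmax := h.isMaximal_center
  obtain ⟨t, ht⟩ := (IsPrincipalIdealRing.principal (IsLocalRing.maximalIdeal P.ring)).principal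
  have he := h.ramIndex_ne_zero
  have hdvd : h.center ^ ramIndex h ∣
      (IsLocalRing.maximalIdeal P.ring).map (algebraMap P.ring (P.intClosure E)) :=
    Ideal.dvd_iff_le.2 Ideal.le_pow_ramificationIdx'
  obtain ⟨I, hI⟩ := hdvd
  have htm : algebraMap P.ring (P.intClosure E) t ∉ h.center ^ (ramIndex h + 1) := by
    rw [← h.val_coe_le_exp_iff]
    change ¬ h.val (algebraMap F E t) ≤ _
    rw [h.val_algebraMap_uniformizer ht, exp_le_exp]
    lia
  -- The value of t is exactly e, so the cofactor I is not divisible by the center.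
  have hnle : ¬ I ≤ h.center := by
    intro hle
    apply htm
    have := Ideal.mem_map_of_mem (algebraMap P.ring (P.intClosure E))
      (ht ▸ Ideal.mem_span_singleton_self t : t ∈ IsLocalRing.maximalIdeal P.ring)
    rw [hI] at this
    rw [pow_succ]
    exact Ideal.mul_mono_right hle this
  have hlow : h.center ^ (ramIndex h - 1) ∣ differentIdeal P.ring (P.intClosure E) :=
    pow_sub_one_dvd_differentIdeal P.ring h.center (ramIndex h)
      (IsDiscreteValuationRing.not_a_field P.ring) ⟨I, hI⟩
  have hupp : ¬ h.center ^ (ramIndex h - 1 + 1) ∣ differentIdeal P.ring (P.intClosure E) := by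
    rw [Nat.sub_add_cancel (Nat.one_le_iff_ne_zero.2 he)]
    exact not_dvd_differentIdeal_of_natCard_stabilizer_notMem (G := Gal(E/F))
      algebraMap_intTrace_eq_sum (IsLocalRing.maximalIdeal P.ring) h.center I hI hnle hcard
  rw [diffExponent, differentOver_eq]
  exact multiplicity_eq_of_dvd_of_not_dvd hlow hupp

theorem LiesOver.card_decomp_eq (h : Q.LiesOver P) :
    Nat.card h.decomp = ramIndex h * h.center.inertiaDeg P.ring :=
  Ideal.card_stabilizer_eq_mul _ (IsDiscreteValuationRing.not_a_field P.ring) _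

/-- From |D| = ef, the hypothesis gives f = 1, so the whole decomposition group is inertia. -/
theorem LiesOver.mem_ramGroup_zero_of_card_eq (h : Q.LiesOver P)
    (hcard : Nat.card h.decomp = ramIndex h) {σ : Gal(E/F)}
    (hσ : σ ∈ h.decomp) : σ ∈ Q.ramGroup F 0 := by
  have hmax := h.isMaximal_center
  rw [h.card_decomp_eq, mul_eq_left₀ h.ramIndex_ne_zero] at hcard
  refine h.mem_ramGroup_of_intClosure σ 0 fun b ↦ ?_
  have h3 := Ideal.smul_sub_mem_of_inertiaDeg_eq_one (IsLocalRing.maximalIdeal P.ring)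
    h.center hcard hσ b
  rw [← h.val_coe_lt_one_iff, lt_one_iff_le_exp_neg_one] at h3
  exact h3

end Place

/-! ### Conductor exponents from the decomposition group; extending places -/

namespace Place

open WithZero

section

variable {k F E : Type*} [Field k] [Field F] [Field E] [Algebra k F] [Algebra k E] [Algebra F E]
  {P : Place k F} {Q : Place k E}
  [IsDiscreteValuationRing P.ring] [FiniteDimensional F E] [IsGalois F E]

theorem apply_mem_ring_of_mem_ramGroup {σ : Gal(E/F)} {i : ℕ} (hσ : σ ∈ Q.ramGroup F i) {z : E}
    (hz : z ∈ Q.ring) : σ z ∈ Q.ring := by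
  obtain ⟨w, -, hw⟩ := hσ ⟨z, hz⟩
  have : σ z = w + z := by rw [hw]; simp
  rw [this]
  exact add_mem w.2 hz

/-- If the decomposition group is trivial, then the conductor exponent vanishes. -/
theorem LiesOver.condExponent_eq_zero_of_decomp (h : Q.LiesOver P)
    (hD : ∀ σ : Gal(E/F), (∀ z ∈ Q.ring, σ z ∈ Q.ring) → σ = 1) : condExponent h = 0 := by
  have ha : Q.ramBound F = 0 := h.ramBound_eq_zero fun σ hσ ↦
    hD σ fun z hz ↦ apply_mem_ring_of_mem_ramGroup hσ hz
  have hbot : h.decomp = ⊥ := by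
    rw [Subgroup.eq_bot_iff_forall]
    exact fun σ hσ ↦ hD σ fun z hz ↦ h.apply_mem_ring_of_mem_decomp hσ hz
  have hc : Nat.card h.decomp = 1 := by rw [hbot, Subgroup.card_bot]
  have he : ramIndex h = 1 := Nat.eq_one_of_mul_eq_one_right (h.card_decomp_eq.symm.trans hc)
  have hd : diffExponent h = 0 := by
    rw [h.diffExponent_eq_ramIndex_sub_one, he]
    rw [hc, Nat.cast_one]
    exact fun h1 ↦ h.isPrime_center.ne_top ((Ideal.eq_top_iff_one _).2 h1)
  simp [condExponent, hd, ha]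

/-- The conductor exponent of a tamely ramified place without residue field extension. -/
theorem LiesOver.condExponent_eq_one (h : Q.LiesOver P) (H : Subgroup Gal(E/F))
    (hD : ∀ σ : Gal(E/F), (∀ z ∈ Q.ring, σ z ∈ Q.ring) → σ ∈ H) (hH : 1 < Nat.card H)
    (hcast : (Nat.card H : E) = -1) {t : P.ring}
    (ht : IsLocalRing.maximalIdeal P.ring = Ideal.span {t}) (π : E)
    (hπ : h.val π ^ Nat.card H = h.val (algebraMap F E t))
    (hσπ : ∀ σ ∈ H, σ ≠ 1 → h.val (σ π - π) = h.val π) : condExponent h = 1 := by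
  have hle : h.decomp ≤ H := fun σ hσ ↦ hD σ fun z hz ↦ h.apply_mem_ring_of_mem_decomp hσ hz
  have he0 := h.ramIndex_ne_zero
  rw [h.val_algebraMap_uniformizer ht] at hπ
  have hπ0 : h.val π ≠ 0 := by
    intro h0
    rw [h0, zero_pow (by lia)] at hπ
    exact exp_ne_zero hπ.symm
  have hlog : (Nat.card H : ℤ) * log (h.val π) = -(ramIndex h : ℤ) := by
    rw [← exp_log hπ0, ← exp_nsmul, exp_inj] at hπ
    simpa using hπ
  -- |H| divides e by the value of π, e divides |D|, and |D| ≤ |H| by `hle`: so |H| = e = |D| and f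
  -- = 1.
  have hdvd : Nat.card H ∣ ramIndex h := by
    rw [← Int.natCast_dvd_natCast, ← dvd_neg, ← hlog]
    exact dvd_mul_right _ _
  have hdvd' : ramIndex h ∣ Nat.card h.decomp := ⟨_, h.card_decomp_eq⟩
  have hcle : Nat.card h.decomp ≤ Nat.card H := Subgroup.card_le_of_le hle
  have hc1 : Nat.card H ≤ ramIndex h := Nat.le_of_dvd (Nat.pos_of_ne_zero he0) hdvd
  have hc2 : ramIndex h ≤ Nat.card h.decomp := Nat.le_of_dvd Nat.card_pos hdvd'
  have hce : Nat.card h.decomp = ramIndex h := by lia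
  have hcH : Nat.card H = ramIndex h := by lia
  have hd : diffExponent h = ramIndex h - 1 := by
    -- |D| equals -1 in `E`, so it is a unit at Q: this is the tameness.
    refine h.diffExponent_eq_ramIndex_sub_one ?_
    rw [← h.val_coe_eq_one_iff, hce, ← hcH]
    have : (((Nat.card H : ℕ) : P.intClosure E) : E) = -1 := by rw [← hcast]; simp
    rw [this, Valuation.map_neg, map_one]
  have hπ1 : h.val π = exp (-1) := by
    rw [← exp_log hπ0, exp_inj]
    rw [hcH] at hlog
    have : (ramIndex h : ℤ) ≠ 0 := by exact_mod_cast he0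
    refine mul_left_cancel₀ this ?_
    rw [hlog]; ring
  have hDH : h.decomp = H := Subgroup.eq_of_le_of_card_ge hle (by lia)
  -- π is a uniformizer which σ ≠ 1 in H moves by exactly ν = 1, so G_1 is trivial, while G_0 = H is
  -- not.
  have ha : Q.ramBound F = 0 + 1 := by
    refine h.ramBound_eq_succ 0 (fun σ hσ ↦ ?_) ?_
    · by_contra hne
      have hσH : σ ∈ H := hD σ fun z hz ↦ apply_mem_ring_of_mem_ramGroup hσ hz
      have hπm : π ∈ Q.ring := by
        rw [h.mem_ring_iff, hπ1, ← exp_zero, exp_le_exp]; lia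
      have h2 := (h.mem_ramGroup_iff σ _).1 hσ π hπm
      rw [hσπ σ hσH hne, hπ1, exp_le_exp] at h2
      lia
    · have : Nontrivial H := (Finite.one_lt_card_iff_nontrivial).1 hH
      obtain ⟨σ, hσ⟩ := exists_ne (1 : H)
      refine ⟨σ, h.mem_ramGroup_zero_of_card_eq hce (hDH ▸ σ.2), fun h1 ↦ hσ (Subtype.ext h1)⟩
  rw [condExponent, hd, ha, div_eq_one_iff_eq (by exact_mod_cast he0),
    Nat.cast_sub (Nat.one_le_iff_ne_zero.2 he0)]
  push_cast
  ring

/-- The discrete valuation of `Q` is equivalent to any valuation of an extension field whose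
valuation ring lies over that of `Q`. -/
theorem LiesOver.val_isEquiv_comap (h : Q.LiesOver P) {L Γ : Type*} [Field L] [Algebra E L]
    [LinearOrderedCommGroupWithZero Γ] (v : Valuation L Γ)
    (hv : ∀ x : E, v (algebraMap E L x) ≤ 1 ↔ x ∈ Q.ring) :
    h.val.IsEquiv (v.comap (algebraMap E L)) := by
  rw [Valuation.isEquiv_iff_val_le_one]
  intro x
  rw [← h.mem_ring_iff, ← hv, Valuation.comap_apply]

end

variable {k F E : Type*} [Field k] [Field F] [Field E] [Algebra k F] [Algebra k E] [Algebra F E]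

/-- Take a valuation ring W of `E` dominating V. If x ∉ V landed in W, the nonunit x⁻¹ of V would
become a unit of W, contradicting that V → W is local. -/
theorem exists_valuationSubring_comap_eq (V : ValuationSubring F) (E : Type*) [Field E]
    [Algebra F E] : ∃ W : ValuationSubring E, W.comap (algebraMap F E) = V := by
  obtain ⟨W, hW, hloc⟩ := IsLocalRing.exists_factor_valuationRing
    ((algebraMap F E).comp V.subtype)
  refine ⟨W, ?_⟩
  ext x
  rw [ValuationSubring.mem_comap]
  constructor
  · intro hx
    by_contra hxV
    have hx0 : x ≠ 0 := by rintro rfl; exact hxV (zero_mem V)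
    have hxi : x⁻¹ ∈ V := (V.mem_or_inv_mem x).resolve_left hxV
    have hu : IsUnit (⟨x⁻¹, hxi⟩ : V) := by
      refine hloc.map_nonunit _ (IsUnit.of_mul_eq_one ⟨_, hx⟩ (Subtype.ext ?_))
      change algebraMap F E x⁻¹ * algebraMap F E x = 1
      rw [← map_mul, inv_mul_cancel₀ hx0, map_one]
    have := mt (mem_maximalIdeal_iff_inv_notMem V ⟨x⁻¹, hxi⟩ (inv_ne_zero hx0)).2
      (by rwa [IsLocalRing.mem_maximalIdeal, mem_nonunits_iff, not_not])
    rw [not_not, inv_inv] at this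
    exact hxV this
  · exact fun hx ↦ hW ⟨x, hx⟩

theorem exists_liesOver [IsScalarTower k F E] (P : Place k F) : ∃ Q : Place k E, Q.LiesOver P := by
  obtain ⟨W, hW⟩ := exists_valuationSubring_comap_eq P.ring E
  refine ⟨⟨W, fun c ↦ ?_, ?_⟩, hW.symm⟩
  · rw [IsScalarTower.algebraMap_apply k F E, ← ValuationSubring.mem_comap, hW]
    exact P.algebraMap_mem c
  · rintro rfl
    exact P.ne_top (by rw [← hW]; ext; simp)

/-- A field automorphism of finite order that maps a valuation ring into itself preserves the
valuation. -/
theorem valuation_apply_eq_of_forall_mem [FiniteDimensional F E] (V : ValuationSubring E)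
    (σ : Gal(E/F)) (hσ : ∀ z ∈ V, σ z ∈ V) (x : E) : V.valuation (σ x) = V.valuation x := by
  have hmono : ∀ a b : E, V.valuation a ≤ V.valuation b → V.valuation (σ a) ≤ V.valuation (σ b) := by
    intro a b hab
    by_cases hb : b = 0
    · subst hb
      have : a = 0 := by simpa using hab
      simp [this]
    · have hm : a / b ∈ V := by
        rw [← V.valuation_le_one_iff, map_div₀]
        exact div_le_one_of_le₀ hab zero_le
      have := (V.valuation_le_one_iff _).2 (hσ _ hm)
      rw [map_div₀, map_div₀] at this
      exact (div_le_one₀ (by simpa [zero_lt_iff] using hb)).1 this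
  have hpow : (σ ^ orderOf σ) x = x := by rw [pow_orderOf_eq_one]; rfl
  have hsucc : ∀ (i : ℕ) (y : E), (σ ^ (i + 1)) y = σ ((σ ^ i) y) := fun i y ↦ by
    rw [pow_succ']; rfl
  have hpos : 0 < orderOf σ := orderOf_pos σ
  obtain ⟨m, hm⟩ : ∃ m, orderOf σ = m + 1 := Nat.exists_eq_succ_of_ne_zero hpos.ne'
  -- Since σ has finite order, iterating either inequality along the σ-orbit returns to x and gives
  -- the opposite one.
  rcases le_total (V.valuation (σ x)) (V.valuation x) with hle | hle
  · refine le_antisymm hle ?_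
    have : ∀ i : ℕ, V.valuation ((σ ^ (i + 1)) x) ≤ V.valuation (σ x) := by
      intro i
      induction i with
      | zero => simp
      | succ i ih => rw [hsucc]; exact hmono _ _ (ih.trans hle)
    have h1 := this m
    rwa [← hm, hpow] at h1
  · refine le_antisymm ?_ hle
    have : ∀ i : ℕ, V.valuation (σ x) ≤ V.valuation ((σ ^ (i + 1)) x) := by
      intro i
      induction i with
      | zero => simp
      | succ i ih => rw [hsucc]; exact hmono _ _ (hle.trans ih)
    have h1 := this m
    rwa [← hm, hpow] at h1

end Place

/-! ### Eisenstein polynomials and monogenic integral closures -/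

section Eisenstein

variable {A K L : Type*} [CommRing A] [IsDomain A] [IsIntegrallyClosed A] [Field K] [Field L]
  [Algebra A K] [IsFractionRing A K] [Algebra K L] [Algebra A L] [IsScalarTower A K L]

theorem minpoly_eq_map_of_isEisensteinAt {p : Ideal A} (hp : p.IsPrime) {g : A[X]}
    (hg : g.Monic) (hE : g.IsEisensteinAt p) (hdeg : 0 < g.natDegree) {x : L}
    (hx : aeval x g = 0) : minpoly K x = g.map (algebraMap A K) := by
  have hirr : Irreducible g := hE.irreducible hp hg.isPrimitive hdeg
  have hirr' := (hg.irreducible_iff_irreducible_map_fraction_map (K := K)).1 hirr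
  refine (minpoly.eq_of_irreducible_of_monic hirr' ?_ (hg.map _)).symm
  rwa [aeval_map_algebraMap]

/-- Clearing denominators of z in K[x] puts t^n z in A[x], up to a unit of A. As z is integral, the
Eisenstein condition allows the power of t to be cancelled. -/
theorem integralClosure_eq_adjoin_of_isEisensteinAt [IsDiscreteValuationRing A]
    [FiniteDimensional K L] [Algebra.IsSeparable K L] {t : A}
    (ht : IsLocalRing.maximalIdeal A = Ideal.span {t}) {g : A[X]}
    (hg : g.Monic) (hE : g.IsEisensteinAt (IsLocalRing.maximalIdeal A)) (hdeg : 0 < g.natDegree)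
    {x : L} (hx : aeval x g = 0) (hgen : Algebra.adjoin K {x} = ⊤) {z : L} (hz : IsIntegral A z) :
    z ∈ Algebra.adjoin A {x} := by
  have hmp : minpoly A x = g := by
    have h1 := minpoly_eq_map_of_isEisensteinAt (K := K)
      (Ideal.IsMaximal.isPrime inferInstance) hg hE hdeg hx
    rw [minpoly.isIntegrallyClosed_eq_field_fractions' K ⟨g, hg, hx⟩] at h1
    exact map_injective _ (IsFractionRing.injective A K) h1
  have hxint : IsIntegral A x := ⟨g, hg, hx⟩
  have hxK : IsIntegral K x := hxint.tower_top
  let B : PowerBasis K L := PowerBasis.ofAdjoinEqTop hxK hgen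
  have hB : B.gen = x := PowerBasis.ofAdjoinEqTop_gen hxK hgen
  have ht0 : t ≠ 0 := by
    rintro rfl
    exact IsDiscreteValuationRing.not_a_field A (by simp [ht])
  have hirr : Irreducible t := (IsDiscreteValuationRing.irreducible_iff_uniformizer t).2 ht
  obtain ⟨f, rfl⟩ : ∃ f : K[X], aeval x f = z := by
    have : z ∈ Algebra.adjoin K {x} := hgen ▸ Algebra.mem_top
    rwa [Algebra.adjoin_singleton_eq_range_aeval] at this
  obtain ⟨b, hbm, hb⟩ := IsLocalization.integerNormalization_spec (nonZeroDivisors A) f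
  obtain ⟨n, u, hu⟩ := IsDiscreteValuationRing.eq_unit_mul_pow_irreducible
    (nonZeroDivisors.ne_zero hbm) hirr
  have key : t ^ n • aeval x f ∈ Algebra.adjoin A {B.gen} := by
    have h1 : b • aeval x f ∈ Algebra.adjoin A {x} := by
      have := congrArg (aeval x) hb
      rw [aeval_map_algebraMap] at this
      have hsm : aeval x (b • f) = b • aeval x f :=
        map_smul ((aeval x : K[X] →ₐ[K] L).restrictScalars A) b f
      rw [← hsm, ← this]
      exact aeval_mem_adjoin_singleton A x
    have h2 : t ^ n • aeval x f = ((u⁻¹ : Aˣ) : A) • b • aeval x f := by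
      rw [hu, smul_smul, ← mul_assoc, Units.inv_mul, one_mul]
    rw [hB, h2]
    exact Subalgebra.smul_mem _ h1 _
  rw [← hB]
  refine mem_adjoin_of_smul_prime_pow_smul_of_minpoly_isEisensteinAt hirr.prime (hB ▸ hxint) hz key ?_
  rw [ht] at hE
  rw [hB, hmp]
  exact hE

end Eisenstein

namespace Place

section

variable {k F E : Type*} [Field k] [Field F] [Field E] [Algebra k F] [Algebra k E] [Algebra F E]
  {P : Place k F}
  [IsDiscreteValuationRing P.ring] [FiniteDimensional F E] [IsGalois F E]

theorem adjoin_eq_top_of_isEisensteinAt {t : P.ring}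
    (ht : IsLocalRing.maximalIdeal P.ring = Ideal.span {t}) {g : P.ring[X]}
    (hg : g.Monic) (hE : g.IsEisensteinAt (IsLocalRing.maximalIdeal P.ring))
    (hdeg : 0 < g.natDegree) {π : P.intClosure E} (hπ : aeval (π : E) g = 0)
    (hgen : Algebra.adjoin F {(π : E)} = ⊤) : Algebra.adjoin P.ring {π} = ⊤ := by
  rw [eq_top_iff]
  rintro b -
  have h1 := integralClosure_eq_adjoin_of_isEisensteinAt (K := F) ht hg hE hdeg hπ hgen b.2
  have h2 : Algebra.adjoin P.ring {(π : E)} =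
      (Algebra.adjoin P.ring {π}).map (P.intClosure E).val := by
    rw [AlgHom.map_adjoin_singleton]; rfl
  rw [h2] at h1
  obtain ⟨c, hc, hcb⟩ := h1
  rwa [← Subtype.ext hcb]

end

/-! ### Valuation rings of k(y) that contain k[y] -/

section Overring

variable {k K : Type*} [Field k] [Field K] [Algebra k K] {V V' : ValuationSubring K} {y : K}

theorem aeval_mem (hk : ∀ c : k, algebraMap k K c ∈ V) (hy : y ∈ V) (r : k[X]) :
    aeval y r ∈ V := by
  induction r using Polynomial.induction_on' with
  | add p q hp hq => rw [map_add]; exact add_mem hp hq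
  | monomial i a =>
    rw [aeval_monomial]
    exact mul_mem (hk a) (pow_mem hy i)

/-- Every element of a valuation ring that contains `k[y]`, where `K = k(y)`, is a fraction whose
denominator is a unit. -/
theorem exists_eq_div_of_mem (hk : ∀ c : k, algebraMap k K c ∈ V) (hy : y ∈ V)
    (hK : ∀ z : K, ∃ r s : k[X], z = aeval y r / aeval y s) {z : K} (hz : z ∈ V) :
    ∃ r s : k[X], aeval y s ≠ 0 ∧ (aeval y s)⁻¹ ∈ V ∧ z = aeval y r / aeval y s := by
  classical
  obtain ⟨r, s, hrs⟩ := hK z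
  by_cases hs : aeval y s = 0
  · refine ⟨0, 1, by simp, by simp [one_mem], ?_⟩
    simp [hrs, hs]
  have hs0 : s ≠ 0 := by rintro rfl; simp at hs
  obtain ⟨r', s', hco, hr, hs'⟩ : ∃ r' s' : k[X], IsCoprime r' s' ∧
      r = EuclideanDomain.gcd r s * r' ∧ s = EuclideanDomain.gcd r s * s' := by
    obtain ⟨r', hr'⟩ := EuclideanDomain.gcd_dvd_left r s
    obtain ⟨s', hs'⟩ := EuclideanDomain.gcd_dvd_right r s
    refine ⟨r', s', ?_, hr', hs'⟩
    have hg : EuclideanDomain.gcd r s ≠ 0 := fun h0 ↦ hs0 (by rw [hs', h0, zero_mul])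
    have hb := EuclideanDomain.gcd_eq_gcd_ab r s
    refine ⟨EuclideanDomain.gcdA r s, EuclideanDomain.gcdB r s, mul_left_cancel₀ hg ?_⟩
    calc _ = EuclideanDomain.gcd r s * r' * EuclideanDomain.gcdA r s +
          EuclideanDomain.gcd r s * s' * EuclideanDomain.gcdB r s := by ring
      _ = r * EuclideanDomain.gcdA r s + s * EuclideanDomain.gcdB r s := by rw [← hr', ← hs']
      _ = _ := by rw [← hb, mul_one]
  have hd : aeval y (EuclideanDomain.gcd r s) ≠ 0 := fun h0 ↦ hs (by rw [hs', map_mul, h0, zero_mul])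
  have hs'0 : aeval y s' ≠ 0 := fun h0 ↦ hs (by rw [hs', map_mul, h0, mul_zero])
  have hz' : z = aeval y r' / aeval y s' := by
    have h1 := congrArg (aeval y) hr
    have h2 := congrArg (aeval y) hs'
    rw [map_mul] at h1 h2
    rw [hrs, h1, h2]
    field_simp
  refine ⟨r', s', hs'0, ?_, hz'⟩
  obtain ⟨a, b, hab⟩ := hco
  have h1 : aeval y a * aeval y r' + aeval y b * aeval y s' = 1 := by
    rw [← map_mul, ← map_mul, ← map_add, hab, map_one]
  -- In lowest terms, the Bézout relation a r' + b s' = 1 divided by s' writes 1/s' as a z + b,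
  -- which lies in V.
  have h2 : (aeval y s')⁻¹ = aeval y a * z + aeval y b := by
    rw [hz']
    field_simp
    rw [← h1, mul_comm (aeval y b)]
  rw [h2]
  exact add_mem (mul_mem (aeval_mem hk hy a) hz) (aeval_mem hk hy b)

/-- The map `k[X] → V` that sends `X` to `y`. -/
def aevalHom (hk : ∀ c : k, algebraMap k K c ∈ V) (hy : y ∈ V) : k[X] →+* V :=
  (aeval y : k[X] →ₐ[k] K).toRingHom.codRestrict V (aeval_mem hk hy)

/-- Denominators in V can be taken to be units of V, so V is a localization of k[X]. Every ideal of
V is thus extended from k[X] and hence principal. -/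
theorem map_comap_aevalHom (hk : ∀ c : k, algebraMap k K c ∈ V) (hy : y ∈ V)
    (hK : ∀ z : K, ∃ r s : k[X], z = aeval y r / aeval y s) (I : Ideal V) :
    (I.comap (aevalHom hk hy)).map (aevalHom hk hy) = I := by
  refine le_antisymm Ideal.map_comap_le fun z hz ↦ ?_
  obtain ⟨r, s, hs0, hs, hzrs⟩ := exists_eq_div_of_mem hk hy hK z.2
  have h1 : aevalHom hk hy r = z * aevalHom hk hy s := by
    refine Subtype.ext ?_
    change aeval y r = z * aeval y s
    rw [hzrs]; field_simp
  have h2 : z = ⟨_, hs⟩ * aevalHom hk hy r := by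
    refine Subtype.ext ?_
    change (z : K) = (aeval y s)⁻¹ * aeval y r
    rw [hzrs]; field_simp
  rw [h2]
  refine Ideal.mul_mem_left _ _ (Ideal.mem_map_of_mem _ ?_)
  rw [Ideal.mem_comap, h1]
  exact Ideal.mul_mem_right _ _ hz

theorem isDiscreteValuationRing_of_mem (hk : ∀ c : k, algebraMap k K c ∈ V) (hy : y ∈ V)
    (hK : ∀ z : K, ∃ r s : k[X], z = aeval y r / aeval y s) (htop : V ≠ ⊤) :
    IsDiscreteValuationRing V where
  principal I := by
    obtain ⟨g, hg⟩ := (IsPrincipalIdealRing.principal (I.comap (aevalHom hk hy))).principal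
    refine ⟨⟨aevalHom hk hy g, ?_⟩⟩
    rw [← map_comap_aevalHom hk hy hK I, hg, Ideal.submodule_span_eq, Ideal.map_span,
      Set.image_singleton, Ideal.submodule_span_eq]
  not_a_field' hbot := by
    refine htop (eq_top_iff.2 fun x _ ↦ ?_)
    rcases V.mem_or_inv_mem x with hx | hx
    · exact hx
    · by_cases h0 : x = 0
      · rw [h0]; exact zero_mem V
      by_contra hxV
      have := (mem_maximalIdeal_iff_inv_notMem V ⟨x⁻¹, hx⟩ (inv_ne_zero h0)).2
        (by rwa [inv_inv])
      rw [hbot, Ideal.mem_bot] at this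
      exact inv_ne_zero h0 (congrArg Subtype.val this)

theorem maximalIdeal_eq_span (hk : ∀ c : k, algebraMap k K c ∈ V) (hy : y ∈ V)
    (hK : ∀ z : K, ∃ r s : k[X], z = aeval y r / aeval y s)
    (hym : (⟨y, hy⟩ : V) ∈ IsLocalRing.maximalIdeal V) :
    IsLocalRing.maximalIdeal V = Ideal.span {(⟨y, hy⟩ : V)} := by
  have hX : aevalHom hk hy X = ⟨y, hy⟩ := Subtype.ext (by change aeval y X = y; simp)
  have h1 : (IsLocalRing.maximalIdeal V).comap (aevalHom hk hy) = Ideal.span {X} := by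
    have hmax : (Ideal.span {(X : k[X])}).IsMaximal :=
      PrincipalIdealRing.isMaximal_of_irreducible irreducible_X
    refine (hmax.eq_of_le (Ideal.comap_ne_top _ (IsLocalRing.maximalIdeal.isMaximal V).ne_top)
      ?_).symm
    rw [Ideal.span_singleton_le_iff_mem, Ideal.mem_comap, hX]
    exact hym
  rw [← map_comap_aevalHom hk hy hK (IsLocalRing.maximalIdeal V), h1, Ideal.map_span,
    Set.image_singleton, hX]

/-- When y is a nonunit of V, a denominator s(y) that is a unit of V has s(0) ≠ 0. As y is also a
nonunit of V', s(y) is a unit there too. Used in both directions, this shows that y has only one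
zero. -/
theorem le_of_mem_maximalIdeal (hk : ∀ c : k, algebraMap k K c ∈ V)
    (hk' : ∀ c : k, algebraMap k K c ∈ V') (hy : y ∈ V) (hy' : y ∈ V') (hy0 : y ≠ 0)
    (hK : ∀ z : K, ∃ r s : k[X], z = aeval y r / aeval y s)
    (hym : y⁻¹ ∉ V) (hym' : y⁻¹ ∉ V') : V ≤ V' := by
  intro z hz
  obtain ⟨r, s, hs0, hs, rfl⟩ := exists_eq_div_of_mem hk hy hK hz
  rw [div_eq_mul_inv]
  refine mul_mem (aeval_mem hk' hy' r) ?_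
  have hsum : aeval y s = aeval y (divX s) * y + algebraMap k K (s.coeff 0) := by
    conv_lhs => rw [← divX_mul_X_add s]
    simp
  have hc : s.coeff 0 ≠ 0 := by
    intro h0
    rw [h0, map_zero, add_zero] at hsum
    apply hym
    have hd : aeval y (divX s) ≠ 0 := fun h ↦ hs0 (by rw [hsum, h, zero_mul])
    have : y⁻¹ = aeval y (divX s) * (aeval y s)⁻¹ := by rw [hsum]; field_simp
    rw [this]
    exact mul_mem (aeval_mem hk hy _) hs
  by_contra hns
  have h1 := (mem_maximalIdeal_iff_inv_notMem V' ⟨_, aeval_mem hk' hy' s⟩ hs0).2 hns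
  have h2 := (mem_maximalIdeal_iff_inv_notMem V' ⟨y, hy'⟩ hy0).2 hym'
  have h3 := sub_mem h1 (Ideal.mul_mem_left _ ⟨_, aeval_mem hk' hy' (divX s)⟩ h2)
  have hc0 : algebraMap k K (s.coeff 0) ≠ 0 := by simpa using hc
  have h4 : (⟨_, hk' (s.coeff 0)⟩ : V') ∈ IsLocalRing.maximalIdeal V' := by
    convert h3
    change algebraMap k K (s.coeff 0) = aeval y s - aeval y (divX s) * y
    rw [hsum]; ring
  refine (mem_maximalIdeal_iff_inv_notMem V' _ hc0).1 h4 ?_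
  change (algebraMap k K (s.coeff 0))⁻¹ ∈ V'
  rw [← map_inv₀]
  exact hk' _

end Overring

end Place

/-! ### The places of the rational function field -/

section RationalPlaces

open IntermediateField

variable {k : Type*} [Field k] (α : k)

theorem RatFunc.X_sub_C_ne_zero : (RatFunc.X - RatFunc.C α : RatFunc k) ≠ 0 := by
  have := RatFunc.algebraMap_ne_zero (Polynomial.X_sub_C_ne_zero α)
  simpa using this

theorem RatFunc.exists_eq_aeval_X_sub_C_div (z : RatFunc k) : ∃ r s : k[X],
    z = aeval (RatFunc.X - RatFunc.C α) r / aeval (RatFunc.X - RatFunc.C α) s := by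
  rw [← mem_adjoin_simple_iff]
  have hX : RatFunc.X ∈ k⟮RatFunc.X - RatFunc.C α⟯ := by
    have h1 := mem_adjoin_simple_self k (RatFunc.X - RatFunc.C α)
    have h2 := IntermediateField.algebraMap_mem k⟮RatFunc.X - RatFunc.C α⟯ α
    have h3 := add_mem h1 h2
    rwa [RatFunc.algebraMap_eq_C, sub_add_cancel] at h3
  have : (⊤ : IntermediateField k (RatFunc k)) ≤ k⟮RatFunc.X - RatFunc.C α⟯ := by
    rw [← RatFunc.adjoin_X, adjoin_simple_le_iff]
    exact hX
  exact this mem_top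

theorem RatFunc.exists_eq_aeval_inv_X_sub_C_div (z : RatFunc k) : ∃ r s : k[X],
    z = aeval (RatFunc.X - RatFunc.C α)⁻¹ r / aeval (RatFunc.X - RatFunc.C α)⁻¹ s := by
  rw [← mem_adjoin_simple_iff]
  have hX : RatFunc.X - RatFunc.C α ∈ k⟮(RatFunc.X - RatFunc.C α)⁻¹⟯ := by
    have h1 := inv_mem (mem_adjoin_simple_self k (RatFunc.X - RatFunc.C α)⁻¹)
    rwa [inv_inv] at h1
  have hz := (mem_adjoin_simple_iff k z).2 (RatFunc.exists_eq_aeval_X_sub_C_div α z)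
  exact adjoin_simple_le_iff.2 hX hz

theorem placeInfty_X_sub_C_notMem : (RatFunc.X - RatFunc.C α) ∉ (placeInfty k).ring := by
  intro h
  have h2 := add_mem h ((placeInfty k).algebraMap_mem α)
  rw [RatFunc.algebraMap_eq_C, sub_add_cancel] at h2
  classical
  have h3 : RatFunc.inftyValuation k RatFunc.X ≤ 1 := by
    convert! (Valuation.mem_valuationSubring_iff _ _).1 h2
  rw [RatFunc.inftyValuation.X] at h3
  exact absurd h3 (by decide)

theorem placeZero_inv_notMem : (RatFunc.X - RatFunc.C α)⁻¹ ∉ (placeZero α).ring := by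
  intro hmem
  have hlt : (primeXSubC α).valuation (RatFunc k) (algebraMap k[X] (RatFunc k) (X - C α)) < 1 :=
    ((primeXSubC α).valuation_lt_one_iff_mem _).2 (Ideal.mem_span_singleton_self _)
  have he : algebraMap k[X] (RatFunc k) (X - C α) = RatFunc.X - RatFunc.C α := by simp
  rw [he] at hlt
  have h2 := (Valuation.mem_valuationSubring_iff _ _).1 hmem
  rw [map_inv₀] at h2
  refine absurd h2 (not_le.2 ((one_lt_inv₀ (zero_lt_iff.2 ?_)).2 hlt))
  exact (Valuation.ne_zero_iff _).2 (RatFunc.X_sub_C_ne_zero α)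

theorem Place.mem_of_inv_notMem {E : Type*} [Field E] {V : ValuationSubring E} {y : E}
    (hy : y⁻¹ ∉ V) : y ∈ V :=
  (V.mem_or_inv_mem y).resolve_right hy

theorem Place.mem_of_notMem {E : Type*} [Field E] {V : ValuationSubring E} {y : E}
    (hy : y ∉ V) : y⁻¹ ∈ V :=
  (V.mem_or_inv_mem y).resolve_left hy

/-- Every place contains x or x⁻¹, and either one generates k(x) over k. -/
instance Place.isDiscreteValuationRing_ratFunc (P : Place k (RatFunc k)) :
    IsDiscreteValuationRing P.ring := by
  rcases P.ring.mem_or_inv_mem (RatFunc.X - RatFunc.C (0 : k)) with h | h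
  · exact isDiscreteValuationRing_of_mem P.algebraMap_mem h
      (RatFunc.exists_eq_aeval_X_sub_C_div 0) P.ne_top
  · exact isDiscreteValuationRing_of_mem P.algebraMap_mem h
      (RatFunc.exists_eq_aeval_inv_X_sub_C_div 0) P.ne_top

theorem eq_placeInfty {P : Place k (RatFunc k)} (h : RatFunc.X - RatFunc.C α ∉ P.ring) :
    P = placeInfty k := by
  have h0 := RatFunc.X_sub_C_ne_zero α
  have h' := placeInfty_X_sub_C_notMem α
  refine Place.ext (le_antisymm ?_ ?_)
  · exact Place.le_of_mem_maximalIdeal P.algebraMap_mem (placeInfty k).algebraMap_mem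
      (Place.mem_of_notMem h) (Place.mem_of_notMem h') (inv_ne_zero h0)
      (RatFunc.exists_eq_aeval_inv_X_sub_C_div α) (by rwa [inv_inv]) (by rwa [inv_inv])
  · exact Place.le_of_mem_maximalIdeal (placeInfty k).algebraMap_mem P.algebraMap_mem
      (Place.mem_of_notMem h') (Place.mem_of_notMem h) (inv_ne_zero h0)
      (RatFunc.exists_eq_aeval_inv_X_sub_C_div α) (by rwa [inv_inv]) (by rwa [inv_inv])

theorem eq_placeZero {P : Place k (RatFunc k)} (h : (RatFunc.X - RatFunc.C α)⁻¹ ∉ P.ring) :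
    P = placeZero α := by
  have h0 := RatFunc.X_sub_C_ne_zero α
  have h' := placeZero_inv_notMem α
  refine Place.ext (le_antisymm ?_ ?_)
  · exact Place.le_of_mem_maximalIdeal P.algebraMap_mem (placeZero α).algebraMap_mem
      (Place.mem_of_inv_notMem h) (Place.mem_of_inv_notMem h') h0
      (RatFunc.exists_eq_aeval_X_sub_C_div α) h h'
  · exact Place.le_of_mem_maximalIdeal (placeZero α).algebraMap_mem P.algebraMap_mem
      (Place.mem_of_inv_notMem h') (Place.mem_of_inv_notMem h) h0
      (RatFunc.exists_eq_aeval_X_sub_C_div α) h' h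

theorem placeInfty_ne_placeZero : placeInfty k ≠ placeZero α := by
  intro h
  have h1 := placeInfty_X_sub_C_notMem α
  rw [h] at h1
  exact h1 (Place.mem_of_inv_notMem (placeZero_inv_notMem α))

end RationalPlaces

/-! ### Products over the constants of a finite field -/

section FiniteFieldProducts

variable {k L : Type*} [Field k] [Fintype k] [Field L] [Algebra k L]

theorem FiniteField.prod_sub_algebraMap (x : L) :
    ∏ c : k, (x - algebraMap k L c) = x ^ Fintype.card k - x := by
  have hcard : 1 < Fintype.card k := Fintype.one_lt_card
  have hmon : (X ^ Fintype.card k - X : k[X]).Monic :=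
    monic_X_pow_sub (by rw [degree_X]; exact_mod_cast hcard)
  have hprod : (X ^ Fintype.card k - X : k[X]) = ∏ c : k, (X - C c) := by
    have h1 := FiniteField.roots_X_pow_card_sub_X k
    have h2 : Multiset.card (X ^ Fintype.card k - X : k[X]).roots =
        (X ^ Fintype.card k - X : k[X]).natDegree := by
      rw [h1, FiniteField.X_pow_card_sub_X_natDegree_eq k hcard]; rfl
    rw [← prod_multiset_X_sub_C_of_monic_of_roots_card_eq hmon h2, h1]
    rfl
  have := congrArg (aeval x) hprod
  rw [map_prod] at this
  simpa using this.symm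

theorem FiniteField.prod_sub_smul (x y : L) :
    ∏ c : k, (x - c • y) = x ^ Fintype.card k - x * y ^ (Fintype.card k - 1) := by
  have hcard : 1 < Fintype.card k := Fintype.one_lt_card
  by_cases hy : y = 0
  · subst hy
    simp [zero_pow (Nat.sub_ne_zero_of_lt hcard)]
  · have h1 : ∀ c : k, x - c • y = y * (x / y - algebraMap k L c) := by
      intro c
      rw [Algebra.smul_def]
      field_simp
    simp_rw [h1]
    rw [Finset.prod_mul_distrib, Finset.prod_const, Finset.card_univ,
      FiniteField.prod_sub_algebraMap, mul_sub, div_pow]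
    have : y ^ Fintype.card k = y * y ^ (Fintype.card k - 1) := by
      rw [← pow_succ', Nat.sub_add_cancel hcard.le]
    field_simp
    rw [this]
    ring

-- Serves twice: equal (q-1)-st powers differ by a constant factor, and differences of (q-1)-st
-- powers split into factors x - c y whose values are known.
open scoped Classical in
theorem FiniteField.prod_units_sub_smul (x y : L) :
    ∏ c ∈ Finset.univ.erase (0 : k), (x - c • y) =
      x ^ (Fintype.card k - 1) - y ^ (Fintype.card k - 1) := by
  have hcard : 1 < Fintype.card k := Fintype.one_lt_card
  by_cases hx : x = 0
  · subst hx
    have h1 : ∀ c ∈ Finset.univ.erase (0 : k), (0 - c • y) = algebraMap k L (-c) * y := by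
      intro c _
      rw [← Algebra.smul_def]; simp
    rw [Finset.prod_congr rfl h1, Finset.prod_mul_distrib, Finset.prod_const,
      Finset.card_erase_of_mem (Finset.mem_univ _), Finset.card_univ, ← map_prod,
      zero_pow (Nat.sub_ne_zero_of_lt hcard), zero_sub]
    -- Wilson's theorem for k, after the substitution c ↦ -c.
    have h2 : ∏ c ∈ Finset.univ.erase (0 : k), (-c) = -1 := by
      have h3 := Finset.prod_bij' (s := Finset.univ.erase (0 : k)) (t := (Finset.univ : Finset kˣ))
        (f := fun c ↦ -c) (g := fun u ↦ (u : k))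
        (fun c hc ↦ Units.mk0 (-c) (neg_ne_zero.2 (Finset.ne_of_mem_erase hc)))
        (fun u _ ↦ -(u : k)) (fun _ _ ↦ Finset.mem_univ _)
        (fun u _ ↦ by simp) (fun c _ ↦ by simp) (fun u _ ↦ by ext; simp) (fun c _ ↦ by simp)
      rw [h3]
      have h4 := congrArg (fun u : kˣ ↦ (u : k)) (FiniteField.prod_univ_units_id_eq_neg_one (K := k))
      simpa using h4
    rw [h2]; simp
  · have h1 := FiniteField.prod_sub_smul (k := k) x y
    rw [← Finset.mul_prod_erase _ _ (Finset.mem_univ (0 : k)), zero_smul, sub_zero] at h1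
    refine mul_left_cancel₀ hx (h1.trans ?_)
    rw [mul_sub, ← pow_succ', Nat.sub_add_cancel hcard.le]

theorem FiniteField.exists_smul_eq_of_pow_eq {x y : L}
    (h : x ^ (Fintype.card k - 1) = y ^ (Fintype.card k - 1)) : ∃ c : k, x = c • y := by
  classical
  have h1 := FiniteField.prod_units_sub_smul (k := k) x y
  rw [h, sub_self, Finset.prod_eq_zero_iff] at h1
  obtain ⟨c, -, hc⟩ := h1
  exact ⟨c, sub_eq_zero.1 hc⟩

end FiniteFieldProducts

/-! ### The Carlitz polynomials -/

section CarlitzPolynomials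

variable {R : Type*} [CommRing R]

/-- The polynomials `h_j` with `φ^j(z) = z h_j(z^{q-1})`. -/
def carlitzFactor (q : ℕ) (t : R) : ℕ → R[X]
  | 0 => 1
  | j + 1 => X * carlitzFactor q t j ^ q + C t * carlitzFactor q t j

/-- The Eisenstein polynomial whose roots are the `(q-1)`-st powers of the generators of the
`T^{n+1}`-torsion. -/
def carlitzPsi (q : ℕ) (t : R) (n : ℕ) : R[X] :=
  X * carlitzFactor q t n ^ (q - 1) + C t

/-- The polynomial whose roots are the generators of the `T^{n+1}`-torsion. -/
def carlitzPhi (q : ℕ) (t : R) (n : ℕ) : R[X] :=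
  expand R (q - 1) (carlitzPsi q t n)

/-- The polynomial `φ^j(X)`. -/
def carlitzPoly (q : ℕ) (t : R) (j : ℕ) : R[X] :=
  X * expand R (q - 1) (carlitzFactor q t j)

variable {q : ℕ} (t : R)

/-- The degree statement says that φ^j(X) = X h_j(X^{q-1}) has degree q^j; this form makes the
degree of Ψ come out as q^n. -/
theorem carlitzFactor_natDegree_monic [Nontrivial R] (hq : 1 < q) (j : ℕ) :
    (carlitzFactor q t j).Monic ∧ 1 + (q - 1) * (carlitzFactor q t j).natDegree = q ^ j := by
  induction j with
  | zero => simp [carlitzFactor]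
  | succ j ih =>
    obtain ⟨hm, hd⟩ := ih
    have hm1 : (X * carlitzFactor q t j ^ q).Monic := monic_X.mul (hm.pow q)
    have hd1 : (X * carlitzFactor q t j ^ q).natDegree =
        1 + q * (carlitzFactor q t j).natDegree := by
      rw [monic_X.natDegree_mul (hm.pow q), natDegree_X, hm.natDegree_pow]
    have hlt : (C t * carlitzFactor q t j).degree < (X * carlitzFactor q t j ^ q).degree := by
      refine degree_lt_degree ((natDegree_C_mul_le _ _).trans_lt ?_)
      rw [hd1]
      have : (carlitzFactor q t j).natDegree ≤ q * (carlitzFactor q t j).natDegree :=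
        Nat.le_mul_of_pos_left _ (by lia)
      lia
    refine ⟨hm1.add_of_left hlt, ?_⟩
    rw [carlitzFactor, natDegree_add_eq_left_of_degree_lt hlt, hd1, pow_succ, ← hd]
    obtain ⟨m, rfl⟩ : ∃ m, q = m + 1 := ⟨q - 1, by lia⟩
    simp only [Nat.add_sub_cancel]
    ring

theorem carlitzPsi_monic_natDegree [Nontrivial R] (hq : 1 < q) (n : ℕ) :
    (carlitzPsi q t n).Monic ∧ (carlitzPsi q t n).natDegree = q ^ n := by
  obtain ⟨hm, hd⟩ := carlitzFactor_natDegree_monic t hq n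
  have hm1 : (X * carlitzFactor q t n ^ (q - 1)).Monic := monic_X.mul (hm.pow _)
  have hd1 : (X * carlitzFactor q t n ^ (q - 1)).natDegree = q ^ n := by
    rw [monic_X.natDegree_mul (hm.pow _), natDegree_X, hm.natDegree_pow, hd]
  have hlt : (C t : R[X]).degree < (X * carlitzFactor q t n ^ (q - 1)).degree := by
    refine degree_C_le.trans_lt ?_
    rw [degree_eq_natDegree hm1.ne_zero, hd1]
    exact_mod_cast Nat.pow_pos (by lia)
  exact ⟨hm1.add_of_left hlt, by rw [carlitzPsi, natDegree_add_eq_left_of_degree_lt hlt, hd1]⟩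

theorem carlitzPhi_monic_natDegree [Nontrivial R] (hq : 1 < q) (n : ℕ) :
    (carlitzPhi q t n).Monic ∧ (carlitzPhi q t n).natDegree = q ^ n * (q - 1) := by
  obtain ⟨hm, hd⟩ := carlitzPsi_monic_natDegree t hq n
  exact ⟨hm.expand (by lia), by rw [carlitzPhi, natDegree_expand, hd]⟩

theorem carlitzFactor_map {S : Type*} [CommRing S] (f : R →+* S) (j : ℕ) :
    (carlitzFactor q t j).map f = carlitzFactor q (f t) j := by
  induction j with
  | zero => simp [carlitzFactor]
  | succ j ih => simp [carlitzFactor, ih]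

theorem carlitzPsi_map {S : Type*} [CommRing S] (f : R →+* S) (n : ℕ) :
    (carlitzPsi q t n).map f = carlitzPsi q (f t) n := by
  simp [carlitzPsi, carlitzFactor_map]

theorem carlitzPhi_map {S : Type*} [CommRing S] (f : R →+* S) (n : ℕ) :
    (carlitzPhi q t n).map f = carlitzPhi q (f t) n := by
  rw [carlitzPhi, map_expand, carlitzPsi_map, carlitzPhi]

theorem carlitzFactor_zero_eq (j : ℕ) : ∃ N, carlitzFactor q (0 : R) j = X ^ N := by
  induction j with
  | zero => exact ⟨0, by simp [carlitzFactor]⟩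
  | succ j ih =>
    obtain ⟨N, hN⟩ := ih
    exact ⟨1 + N * q, by simp [carlitzFactor, hN, pow_add, pow_mul]⟩

theorem carlitzPsi_coeff_zero (n : ℕ) : (carlitzPsi q t n).coeff 0 = t := by
  simp [carlitzPsi]

/-- Modulo p the constant t vanishes and the recursion leaves a pure power of X, whose exponent is
forced by the degree. -/
theorem carlitzPsi_coeff_mem [Nontrivial R] (hq : 1 < q) (n : ℕ) {p : Ideal R} (hp : p ≠ ⊤)
    (ht : t ∈ p) {i : ℕ} (hi : i < (carlitzPsi q t n).natDegree) :
    (carlitzPsi q t n).coeff i ∈ p := by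
  have : Nontrivial (R ⧸ p) := Ideal.Quotient.nontrivial_iff.2 hp
  rw [← Ideal.Quotient.eq_zero_iff_mem, ← coeff_map, carlitzPsi_map,
    Ideal.Quotient.eq_zero_iff_mem.2 ht]
  obtain ⟨N, hN⟩ := carlitzFactor_zero_eq (R := R ⧸ p) (q := q) n
  have h1 : carlitzPsi q (0 : R ⧸ p) n = X ^ (1 + N * (q - 1)) := by
    simp [carlitzPsi, hN, pow_add, pow_mul]
  have h2 := (carlitzPsi_monic_natDegree (0 : R ⧸ p) hq n).2
  rw [h1, natDegree_X_pow] at h2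
  rw [(carlitzPsi_monic_natDegree t hq n).2] at hi
  rw [h1, coeff_X_pow, if_neg (by lia)]

theorem carlitzPsi_isEisensteinAt [Nontrivial R] (hq : 1 < q) (n : ℕ) {p : Ideal R} (hp : p ≠ ⊤)
    (ht : t ∈ p) (ht2 : t ∉ p ^ 2) : (carlitzPsi q t n).IsEisensteinAt p :=
  (carlitzPsi_monic_natDegree t hq n).1.isEisensteinAt_of_mem_of_notMem hp
    (fun hi ↦ carlitzPsi_coeff_mem t hq n hp ht hi) (by rwa [carlitzPsi_coeff_zero])

theorem carlitzPhi_isEisensteinAt [Nontrivial R] (hq : 1 < q) (n : ℕ) {p : Ideal R} (hp : p ≠ ⊤)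
    (ht : t ∈ p) (ht2 : t ∉ p ^ 2) : (carlitzPhi q t n).IsEisensteinAt p := by
  refine (carlitzPhi_monic_natDegree t hq n).1.isEisensteinAt_of_mem_of_notMem hp
    (fun {i} hi ↦ ?_) ?_
  · rw [carlitzPhi, coeff_expand (by lia)]
    split_ifs with hdvd
    · refine carlitzPsi_coeff_mem t hq n hp ht ?_
      rw [carlitzPhi, natDegree_expand] at hi
      exact Nat.div_lt_of_lt_mul (by rwa [mul_comm])
    · exact zero_mem p
  · rw [carlitzPhi, coeff_expand (by lia)]
    simpa [carlitzPsi_coeff_zero] using ht2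

theorem carlitzPoly_zero : carlitzPoly q t 0 = X := by
  simp [carlitzPoly, carlitzFactor]

theorem carlitzPoly_succ (hq : 1 < q) (j : ℕ) :
    carlitzPoly q t (j + 1) = carlitzPoly q t j ^ q + C t * carlitzPoly q t j := by
  obtain ⟨m, rfl⟩ : ∃ m, q = m + 1 := ⟨q - 1, by lia⟩
  simp only [carlitzPoly, carlitzFactor, map_add, map_mul, expand_X, map_pow, expand_C,
    Nat.add_sub_cancel]
  ring

theorem carlitzPhi_eq (n : ℕ) :
    carlitzPhi q t n = carlitzPoly q t n ^ (q - 1) + C t := by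
  simp only [carlitzPhi, carlitzPsi, carlitzPoly, map_add, map_mul, expand_X, map_pow, expand_C]
  ring

theorem carlitzPoly_succ_eq_mul (hq : 1 < q) (n : ℕ) :
    carlitzPoly q t (n + 1) = carlitzPoly q t n * carlitzPhi q t n := by
  rw [carlitzPoly_succ t hq, carlitzPhi_eq, mul_add, ← pow_succ', Nat.sub_add_cancel hq.le,
    mul_comm (C t)]

/-- Derivatives of q-th powers vanish, so each step of the recursion only contributes a factor t.
This yields both separability and the exact value of Φ' at a generator. -/
theorem derivative_carlitzPoly (hq : 1 < q) (hR : (q : R) = 0) (j : ℕ) :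
    derivative (carlitzPoly q t j) = C (t ^ j) := by
  have hqX : (q : R[X]) = 0 := by
    rw [← map_natCast (C : R →+* R[X]), hR, map_zero]
  induction j with
  | zero => simp [carlitzPoly_zero]
  | succ j ih =>
    rw [carlitzPoly_succ t hq, derivative_add, derivative_pow, hR, derivative_C_mul, ih]
    simp [pow_succ, mul_comm]

theorem carlitzPoly_ne_zero [Nontrivial R] (hq : 1 < q) (j : ℕ) : carlitzPoly q t j ≠ 0 :=
  (monic_X.mul ((carlitzFactor_natDegree_monic t hq j).1.expand (by lia))).ne_zero

end CarlitzPolynomials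

/-! ### The torsion as a cyclic module over k[X]/(X^{n+1}) -/

theorem Polynomial.exists_mul_eq_one_add {k : Type*} [Field k] {M : k[X]} (hM : M.coeff 0 ≠ 0)
    (n : ℕ) : ∃ N S : k[X], N * M = 1 + S * X ^ n := by
  have h1 : IsCoprime M (X ^ n) := by
    refine IsCoprime.pow_right (IsCoprime.symm ?_)
    rw [irreducible_X.coprime_iff_not_dvd, X_dvd_iff]
    exact hM
  obtain ⟨a, b, hab⟩ := h1
  exact ⟨a, -b, by rw [← hab]; ring⟩

/-- In k[X]/(X^{n+1}) every nonzero ideal contains X^n: split off the power of X dividing M and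
invert the rest. On torsion, it moves any nonzero point M(φ)(x) to φ^n(x). -/
theorem Polynomial.exists_mul_eq_X_pow_add {k : Type*} [Field k] {M : k[X]} {n : ℕ}
    (hM : ¬ X ^ (n + 1) ∣ M) : ∃ N S : k[X], N * M = X ^ n + S * X ^ (n + 1) := by
  have hM0 : M ≠ 0 := by rintro rfl; exact hM (dvd_zero _)
  obtain ⟨u, hu, hXu⟩ := exists_eq_pow_rootMultiplicity_mul_and_not_dvd M hM0 0
  rw [map_zero, sub_zero] at hu hXu
  set j := M.rootMultiplicity 0
  have hj : j ≤ n := by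
    by_contra! hlt
    exact hM (hu ▸ (pow_dvd_pow X hlt).mul_right u)
  rw [X_dvd_iff] at hXu
  obtain ⟨N, S, hNS⟩ := Polynomial.exists_mul_eq_one_add hXu 1
  refine ⟨N * X ^ (n - j), S, ?_⟩
  calc N * X ^ (n - j) * M = (N * u) * (X ^ (n - j) * X ^ j) := by rw [hu]; ring
    _ = (1 + S * X ^ 1) * X ^ n := by rw [hNS, ← pow_add, Nat.sub_add_cancel hj]
    _ = _ := by ring

section CarlitzModule

variable {k L : Type*} [Field k] [Fintype k] [Field L] [Algebra k L]

variable (k) in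
/-- The endomorphism `z ↦ z^q + T z` of an extension field of `k`. -/
def carlitzMap (T : L) : Module.End k L :=
  (FiniteField.frobeniusAlgHom k L).toLinearMap + LinearMap.mulLeft k T

theorem carlitzMap_apply (T z : L) : carlitzMap k T z = z ^ Fintype.card k + T * z := rfl

theorem carlitzMap_pow_apply {R : Type*} [CommRing R] [Algebra R L] (t : R) (j : ℕ) (z : L) :
    (carlitzMap k (algebraMap R L t) ^ j) z = aeval z (carlitzPoly (Fintype.card k) t j) := by
  induction j with
  | zero => simp [carlitzPoly_zero]
  | succ j ih =>
    rw [pow_succ', Module.End.mul_apply, ih, carlitzMap_apply,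
      carlitzPoly_succ t Fintype.one_lt_card]
    simp

variable (k) in
/-- `x` generates the `T^{n+1}`-torsion of the Carlitz module. -/
def IsCarlitzGenerator (T : L) (n : ℕ) (x : L) : Prop :=
  ((carlitzMap k T ^ n) x) ^ (Fintype.card k - 1) = -T

variable {T : L} {n : ℕ} {x : L}

theorem card_sub_one_ne_zero : Fintype.card k - 1 ≠ 0 :=
  Nat.sub_ne_zero_of_lt Fintype.one_lt_card

theorem pow_card_eq_mul (y : L) : y ^ Fintype.card k = y ^ (Fintype.card k - 1) * y := by
  rw [← pow_succ, Nat.sub_add_cancel Fintype.one_lt_card.le]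

theorem aeval_carlitzMap_mul_X_pow_apply (S : k[X]) (j : ℕ) (z : L) :
    aeval (carlitzMap k T) (S * X ^ j) z = aeval (carlitzMap k T) S ((carlitzMap k T ^ j) z) := by
  rw [map_mul, map_pow, aeval_X, Module.End.mul_apply]

theorem aeval_carlitzMap_mul_apply (S M : k[X]) (z : L) :
    aeval (carlitzMap k T) (S * M) z =
      aeval (carlitzMap k T) S (aeval (carlitzMap k T) M z) := by
  rw [map_mul, Module.End.mul_apply]

namespace IsCarlitzGenerator

theorem pow_apply_ne_zero (hx : IsCarlitzGenerator k T n x) (hT : T ≠ 0) :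
    (carlitzMap k T ^ n) x ≠ 0 := by
  intro h0
  rw [IsCarlitzGenerator, h0, zero_pow card_sub_one_ne_zero] at hx
  exact hT (neg_eq_zero.1 hx.symm)

theorem pow_succ_apply (hx : IsCarlitzGenerator k T n x) : (carlitzMap k T ^ (n + 1)) x = 0 := by
  rw [pow_succ', Module.End.mul_apply, carlitzMap_apply, pow_card_eq_mul,
    show ((carlitzMap k T ^ n) x) ^ (Fintype.card k - 1) = -T from hx]
  ring

theorem pow_apply_eq_zero (hx : IsCarlitzGenerator k T n x) {j : ℕ} (hj : n < j) :
    (carlitzMap k T ^ j) x = 0 := by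
  obtain ⟨i, rfl⟩ := Nat.exists_eq_add_of_le' (Nat.succ_le_of_lt hj)
  rw [Nat.succ_eq_add_one, pow_add, Module.End.mul_apply, hx.pow_succ_apply, map_zero]

theorem exists_smul_of_apply_eq_zero (hx : IsCarlitzGenerator k T n x) {z : L}
    (hz : carlitzMap k T z = 0) : ∃ c : k, z = c • (carlitzMap k T ^ n) x := by
  by_cases h0 : z = 0
  · exact ⟨0, by simp [h0]⟩
  · rw [carlitzMap_apply, pow_card_eq_mul, ← add_mul] at hz
    have h1 : z ^ (Fintype.card k - 1) = -T := eq_neg_of_add_eq_zero_left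
      ((mul_eq_zero.1 hz).resolve_right h0)
    exact FiniteField.exists_smul_eq_of_pow_eq (h1.trans (show _ = -T from hx).symm)

/-- The torsion is generated by `x` as a `k[φ]`-module. -/
theorem exists_aeval_eq (hx : IsCarlitzGenerator k T n x) {z : L}
    (hz : (carlitzMap k T ^ (n + 1)) z = 0) : ∃ M : k[X], z = aeval (carlitzMap k T) M x := by
  suffices H : ∀ j ≤ n + 1, ∀ z, (carlitzMap k T ^ j) z = 0 →
      ∃ M : k[X], z = aeval (carlitzMap k T) M x from H _ le_rfl z hz
  intro j
  induction j with
  | zero => exact fun _ z hz ↦ ⟨0, by simpa using hz⟩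
  | succ j ih =>
    intro hj z hz
    rw [pow_succ', Module.End.mul_apply] at hz
    obtain ⟨c, hc⟩ := hx.exists_smul_of_apply_eq_zero hz
    have hn : n = j + (n - j) := by lia
    -- φ^j(z) is killed by φ, hence equals c φ^n(x). Subtracting c φ^{n-j}(x) from z leaves a point
    -- already killed by φ^j.
    obtain ⟨M, hM⟩ := ih (by lia) (z - c • (carlitzMap k T ^ (n - j)) x) (by
      rw [map_sub, map_smul, hc, ← Module.End.mul_apply, ← pow_add, ← hn, sub_self])
    refine ⟨M + C c * X ^ (n - j), ?_⟩
    rw [map_add, LinearMap.add_apply, ← hM, aeval_carlitzMap_mul_X_pow_apply, aeval_C]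
    simp [Module.algebraMap_end_apply]

theorem aeval_of_mul_eq (hx : IsCarlitzGenerator k T n x) {N M R S : k[X]}
    (h : N * M = R + S * X ^ (n + 1)) :
    aeval (carlitzMap k T) N (aeval (carlitzMap k T) M x) = aeval (carlitzMap k T) R x := by
  rw [← aeval_carlitzMap_mul_apply, h, map_add, LinearMap.add_apply,
    aeval_carlitzMap_mul_X_pow_apply, hx.pow_succ_apply, map_zero, add_zero]

theorem X_pow_dvd_of_aeval_eq_zero (hx : IsCarlitzGenerator k T n x) (hT : T ≠ 0) {M : k[X]}
    (hM : aeval (carlitzMap k T) M x = 0) : X ^ (n + 1) ∣ M := by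
  by_contra hc
  obtain ⟨N, S, hNS⟩ := exists_mul_eq_X_pow_add hc
  have := hx.aeval_of_mul_eq hNS
  rw [hM, map_zero, map_pow, aeval_X] at this
  exact hx.pow_apply_ne_zero hT this.symm

end IsCarlitzGenerator

theorem isCarlitzGenerator_of_pow_apply_ne_zero {z : L} (hz : (carlitzMap k T ^ (n + 1)) z = 0)
    (hz' : (carlitzMap k T ^ n) z ≠ 0) : IsCarlitzGenerator k T n z := by
  rw [pow_succ', Module.End.mul_apply, carlitzMap_apply, pow_card_eq_mul, ← add_mul] at hz
  exact eq_neg_of_add_eq_zero_left ((mul_eq_zero.1 hz).resolve_right hz')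

/-! ### Absolute values of torsion points -/

section Valuation

variable {Γ : Type*} [LinearOrderedCommGroupWithZero Γ] (v : Valuation L Γ)

theorem Valuation.map_algebraMap_finite {c : k} (hc : c ≠ 0) : v (algebraMap k L c) = 1 := by
  have h1 : v (algebraMap k L c) ^ (Fintype.card k - 1) = 1 := by
    rw [← map_pow, ← map_pow, FiniteField.pow_card_sub_one_eq_one c hc, map_one, map_one]
  exact (pow_eq_one_iff_of_nonneg zero_le card_sub_one_ne_zero).1 h1

theorem Valuation.map_smul_le (c : k) (z : L) : v (c • z) ≤ v z := by
  by_cases hc : c = 0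
  · simp [hc]
  · rw [Algebra.smul_def, map_mul, v.map_algebraMap_finite hc, one_mul]

theorem valuation_carlitzMap_le (hT : v T ≤ 1) {z : L} (hz : v z ≤ 1) :
    v (carlitzMap k T z) ≤ v z := by
  rw [carlitzMap_apply, pow_card_eq_mul]
  refine (v.map_add _ _).trans (max_le ?_ ?_)
  · rw [map_mul, map_pow]
    exact mul_le_of_le_one_left' (pow_le_one' hz _)
  · rw [map_mul]
    exact mul_le_of_le_one_left' hT

/-- For integral T and z, both z^q and Tz are no larger than z, so no operator in k[φ] increases
absolute values. -/
theorem valuation_aeval_carlitzMap_le (hT : v T ≤ 1) (N : k[X]) {z : L} (hz : v z ≤ 1) :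
    v (aeval (carlitzMap k T) N z) ≤ v z := by
  have hpow : ∀ j : ℕ, v ((carlitzMap k T ^ j) z) ≤ v z := by
    intro j
    induction j with
    | zero => simp
    | succ j ih =>
      rw [pow_succ', Module.End.mul_apply]
      exact (valuation_carlitzMap_le v hT (ih.trans hz)).trans ih
  induction N using Polynomial.induction_on' with
  | add p r hp hr =>
    rw [map_add, LinearMap.add_apply]
    exact (v.map_add _ _).trans (max_le hp hr)
  | monomial i a =>
    rw [← C_mul_X_pow_eq_monomial, aeval_carlitzMap_mul_X_pow_apply, aeval_C,
      Module.algebraMap_end_apply]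
    exact (v.map_smul_le a _).trans (hpow i)

namespace IsCarlitzGenerator

/-- If |z| > 1, then z^q dominates Tz and |φ(z)| > 1. All iterates of x would stay larger than 1,
contradicting φ^n(x)^{q-1} = -T. -/
theorem valuation_le_one (hx : IsCarlitzGenerator k T n x) (hT : v T ≤ 1) : v x ≤ 1 := by
  by_contra! hlt
  have hstep : ∀ z : L, 1 < v z → 1 < v (carlitzMap k T z) := by
    intro z hz
    have h1 : 1 < v z ^ (Fintype.card k - 1) := one_lt_pow₀ hz card_sub_one_ne_zero
    have h2 : v (T * z) < v (z ^ Fintype.card k) := by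
      rw [pow_card_eq_mul, map_mul, map_mul, map_pow]
      exact mul_lt_mul_of_pos_right (hT.trans_lt h1) (zero_lt_one.trans hz)
    rw [carlitzMap_apply, v.map_add_eq_of_lt_left h2, map_pow]
    exact one_lt_pow₀ hz Fintype.card_ne_zero
  have hpow : ∀ j : ℕ, 1 < v ((carlitzMap k T ^ j) x) := by
    intro j
    induction j with
    | zero => simpa using hlt
    | succ j ih =>
      rw [pow_succ', Module.End.mul_apply]
      exact hstep _ ih
  have h1 := congrArg v (show _ = -T from hx)
  rw [map_pow, Valuation.map_neg] at h1
  exact absurd (h1 ▸ hT) (not_le.2 (one_lt_pow₀ (hpow n) card_sub_one_ne_zero))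

/-- Some N(φ) maps the nonzero point M(φ)(x) to φ^n(x), and N(φ) does not increase absolute values.
So no nonzero torsion point is smaller than φ^n(x). -/
theorem valuation_pow_apply_le (hx : IsCarlitzGenerator k T n x) (hT : v T ≤ 1) {M : k[X]}
    (hM : ¬ X ^ (n + 1) ∣ M) :
    v ((carlitzMap k T ^ n) x) ≤ v (aeval (carlitzMap k T) M x) := by
  obtain ⟨N, S, hNS⟩ := exists_mul_eq_X_pow_add hM
  have h1 := hx.aeval_of_mul_eq hNS
  rw [map_pow, aeval_X] at h1
  rw [← h1]
  have hx1 := hx.valuation_le_one v hT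
  exact valuation_aeval_carlitzMap_le v hT N
    ((valuation_aeval_carlitzMap_le v hT M hx1).trans hx1)

/-- M is invertible modulo X^{n+1}, so M(φ) and its inverse are both non-increasing. -/
theorem valuation_aeval_eq (hx : IsCarlitzGenerator k T n x) (hT : v T ≤ 1) {M : k[X]}
    (hM : M.coeff 0 ≠ 0) : v (aeval (carlitzMap k T) M x) = v x := by
  obtain ⟨N, S, hNS⟩ := exists_mul_eq_one_add hM (n + 1)
  have h1 := hx.aeval_of_mul_eq hNS
  rw [map_one, Module.End.one_apply] at h1
  have hx1 := hx.valuation_le_one v hT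
  have h2 := valuation_aeval_carlitzMap_le v hT M hx1
  refine le_antisymm h2 ?_
  conv_lhs => rw [← h1]
  exact valuation_aeval_carlitzMap_le v hT N (h2.trans hx1)

theorem valuation_pow_apply_pow (hx : IsCarlitzGenerator k T n x) :
    v ((carlitzMap k T ^ n) x) ^ (Fintype.card k - 1) = v T := by
  rw [← map_pow, show _ = -T from hx, Valuation.map_neg]

end IsCarlitzGenerator

/-- If `T` has a pole, an element of `φ(Λ)` is larger than some element of `Λ`. -/
theorem IsCarlitzGenerator.exists_valuation_lt (hx : IsCarlitzGenerator k T n x) (hT : 1 < v T)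
    {z : L} (hz0 : z ≠ 0) (hz : (carlitzMap k T ^ n) z = 0) :
    ∃ y : L, y ≠ 0 ∧ (carlitzMap k T ^ (n + 1)) y = 0 ∧ v y < v z := by
  classical
  have hT0 : T ≠ 0 := by rintro rfl; simp at hT
  set y₁ := (carlitzMap k T ^ n) x with hy₁
  have hy₁0 : y₁ ≠ 0 := hx.pow_apply_ne_zero hT0
  have hv₁ : v y₁ ^ (Fintype.card k - 1) = v T := hx.valuation_pow_apply_pow v
  have hφy₁ : carlitzMap k T y₁ = 0 := by
    rw [hy₁, ← Module.End.mul_apply, ← pow_succ', hx.pow_succ_apply]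
  -- On Λ the kernel of φ^n is φ(Λ), by cyclicity.
  obtain ⟨y, rfl⟩ : ∃ y, z = carlitzMap k T y := by
    have hz1 : (carlitzMap k T ^ (n + 1)) z = 0 := by
      rw [pow_succ', Module.End.mul_apply, hz, map_zero]
    obtain ⟨M, rfl⟩ := hx.exists_aeval_eq hz1
    have h2 : aeval (carlitzMap k T) (X ^ n * M) x = 0 := by
      rw [aeval_carlitzMap_mul_apply, map_pow, aeval_X, hz]
    have h3 := hx.X_pow_dvd_of_aeval_eq_zero hT0 h2
    rw [pow_succ] at h3
    obtain ⟨M', rfl⟩ := (mul_dvd_mul_iff_left (pow_ne_zero n X_ne_zero)).1 h3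
    exact ⟨_, by rw [aeval_carlitzMap_mul_apply, aeval_X]⟩
  have hmem : ∀ y', carlitzMap k T y' = carlitzMap k T y → (carlitzMap k T ^ (n + 1)) y' = 0 := by
    intro y' hy'
    rw [pow_succ, Module.End.mul_apply, hy', hz]
  have hne : ∀ y', carlitzMap k T y' = carlitzMap k T y → y' ≠ 0 := by
    rintro y' hy' rfl
    rw [map_zero] at hy'
    exact hz0 hy'.symm
  -- If |y'| ≠ |y₁|, the terms y'^q and Ty' have different absolute values. The larger one gives
  -- |φ(y')|, and it exceeds |y'| because |T| > 1.
  have hcase : ∀ y', carlitzMap k T y' = carlitzMap k T y → v y' ≠ v y₁ →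
      v y' < v (carlitzMap k T y) := by
    intro y' hy' hvy
    have hpos : 0 < v y' := by simpa [zero_lt_iff] using hne y' hy'
    rw [← hy', carlitzMap_apply, pow_card_eq_mul]
    rcases lt_or_gt_of_ne hvy with hlt | hlt
    · have h1 : v y' ^ (Fintype.card k - 1) < v T := by
        rw [← hv₁]; exact pow_lt_pow_left₀ hlt zero_le card_sub_one_ne_zero
      have h2 : v (y' ^ (Fintype.card k - 1) * y') < v (T * y') := by
        rw [map_mul, map_mul, map_pow]; exact mul_lt_mul_of_pos_right h1 hpos
      rw [v.map_add_eq_of_lt_right h2, map_mul]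
      exact lt_mul_of_one_lt_left hpos hT
    · have h1 : v T < v y' ^ (Fintype.card k - 1) := by
        rw [← hv₁]; exact pow_lt_pow_left₀ hlt zero_le card_sub_one_ne_zero
      have h2 : v (T * y') < v (y' ^ (Fintype.card k - 1) * y') := by
        rw [map_mul, map_mul, map_pow]; exact mul_lt_mul_of_pos_right h1 hpos
      rw [v.map_add_eq_of_lt_left h2, map_mul, map_pow]
      exact lt_mul_of_one_lt_left hpos (hT.trans h1)
  have hshift : ∀ c : k, carlitzMap k T (y - c • y₁) = carlitzMap k T y := by
    intro c
    rw [map_sub, map_smul, hφy₁, smul_zero, sub_zero]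
  by_cases hall : ∀ c : k, v (y - c • y₁) = v y₁
  · refine ⟨y, hne y rfl, hmem y rfl, ?_⟩
    -- In the remaining case all y - c y₁ have absolute value |y₁|, so their product φ(y) has
    -- absolute value |y₁|^q = |T||y₁| > |y|.
    have hprod : carlitzMap k T y = ∏ c : k, (y - c • y₁) := by
      rw [FiniteField.prod_sub_smul, show y₁ ^ (Fintype.card k - 1) = -T from hx, carlitzMap_apply]
      ring
    have hvy : v y = v y₁ := by simpa using hall 0
    have h2 : v (carlitzMap k T y) = v T * v y₁ := by
      rw [hprod, map_prod, Finset.prod_congr rfl fun c _ ↦ hall c, Finset.prod_const,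
        Finset.card_univ, ← hv₁, ← pow_succ, Nat.sub_add_cancel Fintype.one_lt_card.le]
    rw [h2, hvy]
    exact lt_mul_of_one_lt_left (by simpa [zero_lt_iff] using hy₁0) hT
  · push Not at hall
    obtain ⟨c, hc⟩ := hall
    exact ⟨_, hne _ (hshift c), hmem _ (hshift c), hcase _ (hshift c) hc⟩

theorem finite_setOf_carlitzMap_pow_apply_eq_zero (T : L) (j : ℕ) :
    {z : L | (carlitzMap k T ^ j) z = 0}.Finite := by
  refine ((carlitzPoly (Fintype.card k) T j).rootSet_finite L).subset fun z hz ↦ ?_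
  rw [mem_rootSet]
  refine ⟨carlitzPoly_ne_zero T Fintype.one_lt_card j, ?_⟩
  rw [← carlitzMap_pow_apply]
  exact hz

/-- If `T` has a pole, an element of minimal absolute value of `Λ` is a generator, and it is
smaller than all the elements of `φ(Λ)`. -/
theorem IsCarlitzGenerator.exists_minimal (hx : IsCarlitzGenerator k T n x) (hT : 1 < v T) :
    ∃ x' : L, IsCarlitzGenerator k T n x' ∧
      ∀ z, (carlitzMap k T ^ n) z = 0 → v z ≤ v x' → z = 0 := by
  have hT0 : T ≠ 0 := by rintro rfl; simp at hT
  set s : Set L := {z : L | (carlitzMap k T ^ (n + 1)) z = 0} \ {0} with hs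
  have hfin : s.Finite := (finite_setOf_carlitzMap_pow_apply_eq_zero T (n + 1)).subset
    Set.sdiff_subset
  have hx0 : x ≠ 0 := by
    rintro rfl
    exact hx.pow_apply_ne_zero hT0 (map_zero _)
  obtain ⟨x', hx's, hmin⟩ := hfin.exists_minimalFor v s ⟨x, hx.pow_succ_apply, hx0⟩
  have key : ∀ z, (carlitzMap k T ^ n) z = 0 → v z ≤ v x' → z = 0 := by
    intro z hz hle
    by_contra hz0
    obtain ⟨y, hy0, hy, hlt⟩ := hx.exists_valuation_lt v hT hz0 hz
    have h1 := hmin (show y ∈ s from ⟨hy, hy0⟩) (hlt.le.trans hle)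
    exact absurd (hlt.trans_le hle) (not_lt.2 h1)
  -- Applied to x' itself, `key` shows that φ^n does not kill x', so x' is a generator.
  refine ⟨x', isCarlitzGenerator_of_pow_apply_ne_zero hx's.1 fun h0 ↦ hx's.2 (key x' h0 le_rfl),
    key⟩

end Valuation

/-! ### The Galois action on the torsion -/

section Galois

variable {K : Type*} [Field K] [Algebra k K] [Algebra K L] [IsScalarTower k K L] {T : K} {x : L}

theorem galois_smul (σ : Gal(L/K)) (c : k) (z : L) : σ (c • z) = c • σ z :=
  LinearMap.map_smul_of_tower σ.toLinearMap c z

theorem galois_carlitzMap_pow (σ : Gal(L/K)) (j : ℕ) (z : L) :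
    σ ((carlitzMap k (algebraMap K L T) ^ j) z) = (carlitzMap k (algebraMap K L T) ^ j) (σ z) := by
  rw [carlitzMap_pow_apply, carlitzMap_pow_apply]
  exact (aeval_algHom_apply σ z _).symm

theorem galois_aeval_carlitzMap (σ : Gal(L/K)) (M : k[X]) (z : L) :
    σ (aeval (carlitzMap k (algebraMap K L T)) M z) =
      aeval (carlitzMap k (algebraMap K L T)) M (σ z) := by
  induction M using Polynomial.induction_on' with
  | add p r hp hr => rw [map_add, LinearMap.add_apply, map_add, hp, hr, LinearMap.add_apply]
  | monomial i a =>
    rw [← C_mul_X_pow_eq_monomial, aeval_carlitzMap_mul_X_pow_apply,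
      aeval_carlitzMap_mul_X_pow_apply, aeval_C, Module.algebraMap_end_apply,
      Module.algebraMap_end_apply, galois_smul, galois_carlitzMap_pow]

namespace IsCarlitzGenerator

theorem galois (hx : IsCarlitzGenerator k (algebraMap K L T) n x) (σ : Gal(L/K)) :
    IsCarlitzGenerator k (algebraMap K L T) n (σ x) := by
  have h : ((carlitzMap k (algebraMap K L T) ^ n) x) ^ (Fintype.card k - 1) = -algebraMap K L T := hx
  rw [IsCarlitzGenerator, ← galois_carlitzMap_pow, ← map_pow, h, map_neg, AlgEquiv.commutes]

theorem exists_galois_eq (hx : IsCarlitzGenerator k (algebraMap K L T) n x) (hT : T ≠ 0)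
    (σ : Gal(L/K)) : ∃ M : k[X], M.coeff 0 ≠ 0 ∧
      σ x = aeval (carlitzMap k (algebraMap K L T)) M x := by
  have hT' : algebraMap K L T ≠ 0 := by simpa using hT
  obtain ⟨M, hM⟩ := hx.exists_aeval_eq (hx.galois σ).pow_succ_apply
  refine ⟨M, fun h0 ↦ ?_, hM⟩
  obtain ⟨M', rfl⟩ := X_dvd_iff.2 h0
  have h1 := (hx.galois σ).pow_apply_ne_zero hT'
  apply h1
  have h2 : (carlitzMap k (algebraMap K L T) ^ n) =
      aeval (carlitzMap k (algebraMap K L T)) (X ^ n : k[X]) := by simp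
  rw [hM, h2, ← aeval_carlitzMap_mul_apply, show X ^ n * (X * M') = M' * X ^ (n + 1) by ring,
    aeval_carlitzMap_mul_X_pow_apply, hx.pow_succ_apply, map_zero]

/-- If `T` has a pole, then an automorphism that preserves the absolute values of the torsion
points acts on them by a constant. -/
theorem exists_galois_eq_smul {Γ : Type*} [LinearOrderedCommGroupWithZero Γ] (v : Valuation L Γ)
    (hx : IsCarlitzGenerator k (algebraMap K L T) n x) (hT : 1 < v (algebraMap K L T))
    (σ : Gal(L/K))
    (hσ : ∀ z, (carlitzMap k (algebraMap K L T) ^ (n + 1)) z = 0 → v (σ z) = v z) :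
    ∃ c : k, σ x = c • x := by
  have hT0 : T ≠ 0 := by rintro rfl; simp at hT
  obtain ⟨x', hx', hmin⟩ := hx.exists_minimal v hT
  obtain ⟨M, -, hM⟩ := hx'.exists_galois_eq hT0 σ
  have hsub : σ x' - M.coeff 0 • x' =
      aeval (carlitzMap k (algebraMap K L T)) (divX M * X ^ 1) x' := by
    rw [hM]
    conv_lhs => rw [← divX_mul_X_add M]
    rw [map_add, LinearMap.add_apply, aeval_C, Module.algebraMap_end_apply, pow_one]
    simp
  -- The difference is (M - M(0))(φ)(x'), which lies in φ(Λ), and it is no larger than x' because σ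
  -- preserves |x'|. Minimality then forces it to be zero.
  have hzero : σ x' - M.coeff 0 • x' = 0 := by
    refine hmin _ ?_ ?_
    · have h2 : (carlitzMap k (algebraMap K L T) ^ n) =
        aeval (carlitzMap k (algebraMap K L T)) (X ^ n : k[X]) := by simp
      rw [hsub, h2, ← aeval_carlitzMap_mul_apply,
        show X ^ n * (divX M * X ^ 1) = divX M * X ^ (n + 1) by ring,
        aeval_carlitzMap_mul_X_pow_apply, hx'.pow_succ_apply, map_zero]
    · refine (v.map_sub _ _).trans (max_le ?_ (v.map_smul_le _ _))
      rw [hσ x' hx'.pow_succ_apply]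
  refine ⟨M.coeff 0, ?_⟩
  obtain ⟨N, rfl⟩ := hx'.exists_aeval_eq hx.pow_succ_apply
  rw [galois_aeval_carlitzMap, sub_eq_zero.1 hzero, map_smul]

end IsCarlitzGenerator

end Galois

end CarlitzModule

/-! ### Differences of conjugates of x and of x^{q-1} -/

section CarlitzExtension

variable {k K L : Type*} [Field k] [Fintype k] [Field K] [Field L] [Algebra k K] [Algebra k L]
  [Algebra K L] [IsScalarTower k K L] {T : K} {n : ℕ} {x : L}

theorem aeval_carlitzPhi_eq_zero_iff {R : Type*} [CommRing R] [Algebra R L] {t : R} :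
    aeval x (carlitzPhi (Fintype.card k) t n) = 0 ↔
      IsCarlitzGenerator k (algebraMap R L t) n x := by
  rw [carlitzPhi_eq, map_add, map_pow, ← carlitzMap_pow_apply, aeval_C, add_eq_zero_iff_eq_neg,
    IsCarlitzGenerator]

theorem aeval_carlitzPsi_pow {R : Type*} [CommRing R] [Algebra R L] {t : R} {q : ℕ} :
    aeval (x ^ (q - 1)) (carlitzPsi q t n) = aeval x (carlitzPhi q t n) := by
  rw [carlitzPhi, expand_aeval]

variable (k) in
theorem cast_card_eq_zero_of_algebra : (Fintype.card k : L) = 0 := by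
  rw [← map_natCast (algebraMap k L), FiniteField.cast_card_eq_zero, map_zero]

variable (k) in
theorem cast_card_sub_one_eq_neg_one : ((Fintype.card k - 1 : ℕ) : L) = -1 := by
  rw [Nat.cast_sub Fintype.one_lt_card.le, cast_card_eq_zero_of_algebra]
  simp

theorem smul_pow_card_sub_one {c : k} (hc : c ≠ 0) (z : L) :
    (c • z) ^ (Fintype.card k - 1) = z ^ (Fintype.card k - 1) := by
  rw [_root_.smul_pow, FiniteField.pow_card_sub_one_eq_one c hc, one_smul]

namespace IsCarlitzGenerator

theorem ne_zero (hx : IsCarlitzGenerator k (algebraMap K L T) n x) (hT : T ≠ 0) : x ≠ 0 := by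
  rintro rfl
  exact hx.pow_apply_ne_zero (by simpa using hT) (map_zero _)

theorem ne_zero_of_galois_apply_eq_smul (hx : IsCarlitzGenerator k (algebraMap K L T) n x)
    (hT : T ≠ 0) {σ : Gal(L/K)} {c : k} (hc : σ x = c • x) : c ≠ 0 := by
  rintro rfl
  rw [zero_smul, map_eq_zero_iff _ (AlgEquiv.injective _)] at hc
  exact hx.ne_zero hT hc

/-- Differentiate φ^{n+1}(X) = φ^n(X) Φ(X) and evaluate at the root x of Φ; the left side is the
constant T^{n+1}. This identity is where the n + 1 in the conductor comes from. -/
theorem aeval_derivative_carlitzPhi_mul (hx : IsCarlitzGenerator k (algebraMap K L T) n x) :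
    aeval x (derivative (carlitzPhi (Fintype.card k) T n)) *
      (carlitzMap k (algebraMap K L T) ^ n) x = algebraMap K L T ^ (n + 1) := by
  have h1 := congrArg derivative (carlitzPoly_succ_eq_mul T (Fintype.one_lt_card (α := k)) n)
  rw [derivative_carlitzPoly T Fintype.one_lt_card (cast_card_eq_zero_of_algebra k),
    derivative_mul] at h1
  have h2 := congrArg (aeval x) h1
  rw [map_add, map_mul, map_mul, aeval_carlitzPhi_eq_zero_iff.2 hx, mul_zero, zero_add,
    ← carlitzMap_pow_apply, aeval_C, map_pow] at h2
  rw [mul_comm, h2]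

/-- Chain rule for Φ(X) = Ψ(X^{q-1}); the factor q - 1 equals -1 in L. -/
theorem valuation_aeval_derivative_carlitzPhi {Γ : Type*} [LinearOrderedCommGroupWithZero Γ]
    (v : Valuation L Γ) :
    v (aeval x (derivative (carlitzPhi (Fintype.card k) T n))) =
      v (aeval (x ^ (Fintype.card k - 1)) (derivative (carlitzPsi (Fintype.card k) T n))) *
        v x ^ (Fintype.card k - 2) := by
  rw [carlitzPhi, derivative_expand, map_mul, expand_aeval, map_mul v]
  congr 1
  rw [map_mul, map_natCast, cast_card_sub_one_eq_neg_one k, map_mul, Valuation.map_neg, map_one,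
    one_mul, map_pow, aeval_X, map_pow, Nat.sub_sub]

section Galois

theorem algEquiv_ext (hgen : Algebra.adjoin K {x} = ⊤) {σ τ : Gal(L/K)} (h : σ x = τ x) :
    σ = τ := by
  refine AlgEquiv.coe_toAlgHom_injective (AlgHom.ext_of_adjoin_eq_top hgen ?_)
  rintro _ rfl
  exact h

/-- Automorphisms act on x through polynomials in φ, and these commute. -/
theorem galois_mul_comm (hx : IsCarlitzGenerator k (algebraMap K L T) n x) (hT : T ≠ 0)
    (hgen : Algebra.adjoin K {x} = ⊤) (σ τ : Gal(L/K)) : σ * τ = τ * σ := by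
  obtain ⟨M, -, hM⟩ := hx.exists_galois_eq hT σ
  obtain ⟨N, -, hN⟩ := hx.exists_galois_eq hT τ
  refine algEquiv_ext hgen ?_
  rw [AlgEquiv.mul_apply, AlgEquiv.mul_apply, hN, hM, galois_aeval_carlitzMap,
    galois_aeval_carlitzMap, hN, hM, ← aeval_carlitzMap_mul_apply, ← aeval_carlitzMap_mul_apply,
    mul_comm]

theorem exists_galois_apply_eq [FiniteDimensional K L] [IsGalois K L]
    (hmin : minpoly K x = carlitzPhi (Fintype.card k) T n)
    {y : L} (hy : IsCarlitzGenerator k (algebraMap K L T) n y) : ∃ σ : Gal(L/K), σ x = y := by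
  refine minpoly.exists_algEquiv_of_root' (Algebra.IsAlgebraic.isAlgebraic x) ?_
  rw [hmin, aeval_carlitzPhi_eq_zero_iff]
  exact hy

theorem smul (hx : IsCarlitzGenerator k (algebraMap K L T) n x) {c : k} (hc : c ≠ 0) :
    IsCarlitzGenerator k (algebraMap K L T) n (c • x) := by
  have h : ((carlitzMap k (algebraMap K L T) ^ n) x) ^ (Fintype.card k - 1) =
    -algebraMap K L T := hx
  rw [IsCarlitzGenerator, map_smul, smul_pow_card_sub_one hc, h]

/-- φ^n kills φ^n(x) since 2n > n. It supplies a conjugate of x at the smallest possible distance;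
for n = 0 the point would be 2x. -/
theorem add_pow_apply (hx : IsCarlitzGenerator k (algebraMap K L T) n x) (hn : 1 ≤ n) :
    IsCarlitzGenerator k (algebraMap K L T) n (x + (carlitzMap k (algebraMap K L T) ^ n) x) := by
  rw [IsCarlitzGenerator, map_add, ← Module.End.mul_apply, ← pow_add,
    hx.pow_apply_eq_zero (j := n + n) (by lia), add_zero]
  exact hx

theorem galois_apply_sub_smul {σ : Gal(L/K)} {M : k[X]}
    (hM : σ x = aeval (carlitzMap k (algebraMap K L T)) M x) (c : k) :
    σ x - c • x = aeval (carlitzMap k (algebraMap K L T)) (M - C c) x := by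
  rw [map_sub, LinearMap.sub_apply, ← hM, aeval_C, Module.algebraMap_end_apply]

variable {Γ : Type*} [LinearOrderedCommGroupWithZero Γ] (v : Valuation L Γ)

theorem valuation_pow_apply_le_sub_smul (hx : IsCarlitzGenerator k (algebraMap K L T) n x)
    (hT : T ≠ 0) (hv : v (algebraMap K L T) ≤ 1) {σ : Gal(L/K)} {c : k} (hσ : σ x ≠ c • x) :
    v ((carlitzMap k (algebraMap K L T) ^ n) x) ≤ v (σ x - c • x) := by
  obtain ⟨M, -, hM⟩ := hx.exists_galois_eq hT σ
  rw [galois_apply_sub_smul hM]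
  refine hx.valuation_pow_apply_le v hv fun ⟨N, hN⟩ ↦ hσ ?_
  rw [← sub_eq_zero, galois_apply_sub_smul hM, hN, mul_comm, aeval_carlitzMap_mul_X_pow_apply,
    hx.pow_succ_apply, map_zero]

theorem valuation_pow_apply_le_sub (hx : IsCarlitzGenerator k (algebraMap K L T) n x)
    (hT : T ≠ 0) (hv : v (algebraMap K L T) ≤ 1) {σ : Gal(L/K)} (hσ : σ x ≠ x) :
    v ((carlitzMap k (algebraMap K L T) ^ n) x) ≤ v (σ x - x) := by
  have := hx.valuation_pow_apply_le_sub_smul v hT hv (σ := σ) (c := 1) (by rwa [one_smul])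
  rwa [one_smul] at this

/-- Factor the difference as the product of σx - c x over c ≠ 0. For c ≠ M(0) the polynomial M - c
is invertible modulo X^{n+1}, so these q - 2 factors have the absolute value of x. -/
theorem valuation_galois_pow_sub_pow (hx : IsCarlitzGenerator k (algebraMap K L T) n x)
    (hv : v (algebraMap K L T) ≤ 1) {σ : Gal(L/K)} {M : k[X]} (hM0 : M.coeff 0 ≠ 0)
    (hM : σ x = aeval (carlitzMap k (algebraMap K L T)) M x) :
    v (σ (x ^ (Fintype.card k - 1)) - x ^ (Fintype.card k - 1)) =
      v x ^ (Fintype.card k - 2) * v (σ x - M.coeff 0 • x) := by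
  classical
  rw [map_pow, ← FiniteField.prod_units_sub_smul (k := k) (σ x) x,
    ← Finset.prod_erase_mul _ _ (Finset.mem_erase.2 ⟨hM0, Finset.mem_univ _⟩), map_mul, map_prod]
  congr 1
  rw [Finset.prod_congr rfl fun c hc ↦ ?_, Finset.prod_const (v x),
    Finset.card_erase_of_mem (Finset.mem_erase.2 ⟨hM0, Finset.mem_univ _⟩),
    Finset.card_erase_of_mem (Finset.mem_univ _), Finset.card_univ, Nat.sub_sub]
  rw [galois_apply_sub_smul hM, hx.valuation_aeval_eq v hv]
  rw [coeff_sub, coeff_C_zero, sub_ne_zero]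
  exact (Finset.ne_of_mem_erase hc).symm

theorem le_valuation_galois_pow_sub_pow (hx : IsCarlitzGenerator k (algebraMap K L T) n x)
    (hT : T ≠ 0) (hv : v (algebraMap K L T) ≤ 1) {σ : Gal(L/K)}
    (hσ : σ (x ^ (Fintype.card k - 1)) ≠ x ^ (Fintype.card k - 1)) :
    v x ^ (Fintype.card k - 2) * v ((carlitzMap k (algebraMap K L T) ^ n) x) ≤
      v (σ (x ^ (Fintype.card k - 1)) - x ^ (Fintype.card k - 1)) := by
  obtain ⟨M, hM0, hM⟩ := hx.exists_galois_eq hT σ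
  rw [hx.valuation_galois_pow_sub_pow v hv hM0 hM]
  refine mul_le_mul_right (hx.valuation_pow_apply_le_sub_smul v hT hv fun h ↦ hσ ?_) _
  rw [map_pow, h, smul_pow_card_sub_one hM0]

theorem valuation_galois_pow_sub_pow_of_add (hx : IsCarlitzGenerator k (algebraMap K L T) n x)
    (hv : v (algebraMap K L T) ≤ 1) (hn : 1 ≤ n) {σ : Gal(L/K)}
    (hσ : σ x = x + (carlitzMap k (algebraMap K L T) ^ n) x) :
    v (σ (x ^ (Fintype.card k - 1)) - x ^ (Fintype.card k - 1)) =
      v x ^ (Fintype.card k - 2) * v ((carlitzMap k (algebraMap K L T) ^ n) x) := by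
  have h0 : (1 + X ^ n : k[X]).coeff 0 = 1 := by
    rw [coeff_add, coeff_one_zero, coeff_X_pow, if_neg (by lia), add_zero]
  rw [hx.valuation_galois_pow_sub_pow v hv (M := 1 + X ^ n) (by simp [h0]) (by simp [hσ]), h0, hσ,
    one_smul, add_sub_cancel_left]

theorem valuation_pow_apply_lt_one (hx : IsCarlitzGenerator k (algebraMap K L T) n x)
    (hv : v (algebraMap K L T) < 1) : v ((carlitzMap k (algebraMap K L T) ^ n) x) < 1 := by
  rw [← hx.valuation_pow_apply_pow v] at hv
  exact (pow_lt_one_iff card_sub_one_ne_zero).1 hv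

theorem valuation_pow_apply_eq_one (hx : IsCarlitzGenerator k (algebraMap K L T) n x)
    (hv : v (algebraMap K L T) = 1) : v ((carlitzMap k (algebraMap K L T) ^ n) x) = 1 := by
  rw [← hx.valuation_pow_apply_pow v] at hv
  exact (pow_eq_one_iff_of_nonneg zero_le card_sub_one_ne_zero).1 hv

theorem valuation_eq_one (hx : IsCarlitzGenerator k (algebraMap K L T) n x)
    (hv : v (algebraMap K L T) = 1) : v x = 1 := by
  refine le_antisymm (hx.valuation_le_one v hv.le) ?_
  rw [← hx.valuation_pow_apply_eq_one v hv]
  have := hx.valuation_pow_apply_le v hv.le (M := 1) fun h ↦ by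
    have h2 := X_dvd_iff.1 ((dvd_pow_self (X : k[X]) n.succ_ne_zero).trans h)
    simp at h2
  simpa using this

theorem valuation_galois_apply_eq_one (hx : IsCarlitzGenerator k (algebraMap K L T) n x)
    (hv : v (algebraMap K L T) = 1) (σ : Gal(L/K)) : v (σ x) = 1 :=
  (hx.galois σ).valuation_eq_one v hv

theorem valuation_galois_sub_eq_one (hx : IsCarlitzGenerator k (algebraMap K L T) n x)
    (hT : T ≠ 0) (hv : v (algebraMap K L T) = 1) {σ : Gal(L/K)} (hσ : σ x ≠ x) :
    v (σ x - x) = 1 := by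
  refine le_antisymm ((v.map_sub _ _).trans (max_le ?_ ?_)) ?_
  · exact (hx.valuation_galois_apply_eq_one v hv σ).le
  · exact (hx.valuation_eq_one v hv).le
  · rw [← hx.valuation_pow_apply_eq_one v hv]
    exact hx.valuation_pow_apply_le_sub v hT hv.le hσ

theorem valuation_galois_pow_sub_pow_eq_one (hx : IsCarlitzGenerator k (algebraMap K L T) n x)
    (hT : T ≠ 0) (hv : v (algebraMap K L T) = 1) {σ : Gal(L/K)}
    (hσ : σ (x ^ (Fintype.card k - 1)) ≠ x ^ (Fintype.card k - 1)) :
    v (σ (x ^ (Fintype.card k - 1)) - x ^ (Fintype.card k - 1)) = 1 := by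
  refine le_antisymm ((v.map_sub _ _).trans (max_le ?_ ?_)) ?_
  · rw [map_pow, map_pow, hx.valuation_galois_apply_eq_one v hv σ, one_pow]
  · rw [map_pow, hx.valuation_eq_one v hv, one_pow]
  · have := hx.le_valuation_galois_pow_sub_pow v hT hv.le hσ
    rwa [hx.valuation_pow_apply_eq_one v hv, hx.valuation_eq_one v hv, one_pow, one_mul] at this

/-- The automorphisms that multiply `x` by a constant form a group of order `q - 1`. -/
theorem card_of_mem_iff [FiniteDimensional K L] [IsGalois K L]
    (hx : IsCarlitzGenerator k (algebraMap K L T) n x) (hT : T ≠ 0)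
    (hgen : Algebra.adjoin K {x} = ⊤) (hmin : minpoly K x = carlitzPhi (Fintype.card k) T n)
    {H : Subgroup Gal(L/K)} (hH : ∀ σ, σ ∈ H ↔ ∃ c : k, σ x = c • x) :
    Nat.card H = Fintype.card k - 1 := by
  have hx0 := hx.ne_zero hT
  have hex : ∀ c : kˣ, ∃ σ : H, (σ : Gal(L/K)) x = (c : k) • x := fun c ↦ by
    obtain ⟨σ, hσ⟩ := exists_galois_apply_eq hmin (hx.smul c.ne_zero)
    exact ⟨⟨σ, (hH σ).2 ⟨c, hσ⟩⟩, hσ⟩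
  choose f hf using hex
  have hbij : Function.Bijective f := by
    refine ⟨fun c d hcd ↦ ?_, fun σ ↦ ?_⟩
    · have h1 := hf c
      rw [hcd, hf d] at h1
      exact Units.ext (smul_left_injective k hx0 h1).symm
    · obtain ⟨c, hc⟩ := (hH σ).1 σ.2
      exact ⟨Units.mk0 c (hx.ne_zero_of_galois_apply_eq_smul hT hc),
        Subtype.ext (algEquiv_ext hgen ((hf _).trans hc.symm))⟩
  rw [← Nat.card_congr (Equiv.ofBijective f hbij), Nat.card_units, Nat.card_eq_fintype_card]

end Galois

end IsCarlitzGenerator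

end CarlitzExtension

/-! ### Local conductor exponents of K(x) -/

namespace Place

section

variable {k F E : Type*} [Field k] [Field F] [Field E] [Algebra k F] [Algebra k E] [Algebra F E]
  {P : Place k F} {Q : Place k E} [IsDiscreteValuationRing P.ring]

theorem notMem_maximalIdeal_sq {t : P.ring}
    (ht : IsLocalRing.maximalIdeal P.ring = Ideal.span {t}) :
    t ∉ IsLocalRing.maximalIdeal P.ring ^ 2 := by
  have ht0 : t ≠ 0 := by
    rintro rfl
    exact IsDiscreteValuationRing.not_a_field P.ring (by simpa using ht)
  have htm : t ∈ IsLocalRing.maximalIdeal P.ring := ht ▸ Ideal.mem_span_singleton_self t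
  rw [ht, Ideal.span_singleton_pow, Ideal.mem_span_singleton]
  rintro ⟨c, hc⟩
  refine (IsLocalRing.mem_maximalIdeal t).1 htm (IsUnit.of_mul_eq_one c ?_)
  refine mul_left_cancel₀ ht0 ?_
  rw [mul_one, ← mul_assoc, ← sq, ← hc]

variable [FiniteDimensional F E] [IsGalois F E]

theorem LiesOver.val_algebraMap_le_one_iff (h : Q.LiesOver P) (x : F) :
    h.val (algebraMap F E x) ≤ 1 ↔ x ∈ P.ring := by
  rw [← h.mem_ring_iff, h.algebraMap_mem_iff]

end

section Carlitz

variable {k K L : Type*} [Field k] [Fintype k] [Field K] [Field L] [Algebra k K] [Algebra k L]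
  [Algebra K L] [IsScalarTower k K L] {T : K} {n : ℕ} {x : L}
  {P : Place k K}

theorem minpoly_eq_carlitzPhi [IsDiscreteValuationRing P.ring] {t : P.ring}
    (ht : IsLocalRing.maximalIdeal P.ring = Ideal.span {t})
    (hx : IsCarlitzGenerator k (algebraMap K L t) n x) :
    minpoly K x = carlitzPhi (Fintype.card k) (t : K) n := by
  have hE := carlitzPhi_isEisensteinAt t (Fintype.one_lt_card (α := k)) n
    (IsLocalRing.maximalIdeal.isMaximal P.ring).ne_top (ht ▸ Ideal.mem_span_singleton_self t)
    (notMem_maximalIdeal_sq ht)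
  obtain ⟨hm, hd⟩ := carlitzPhi_monic_natDegree t (Fintype.one_lt_card (α := k)) n
  rw [minpoly_eq_map_of_isEisensteinAt (Ideal.IsMaximal.isPrime inferInstance) hm hE ?_
    (x := x) (aeval_carlitzPhi_eq_zero_iff.2 hx), carlitzPhi_map]
  · rfl
  · rw [hd]
    exact Nat.mul_pos (Nat.pow_pos Fintype.card_pos) (Nat.pos_of_ne_zero card_sub_one_ne_zero)

section Full

variable [FiniteDimensional K L] [IsGalois K L] {Q : Place k L}

/-- x generates the integral closure by Eisenstein, the nearest conjugate is x + φ^n(x), and Φ'(x)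
φ^n(x) = T^{n+1}. -/
theorem LiesOver.condExponent_carlitz_zero [IsDiscreteValuationRing P.ring] (h : Q.LiesOver P)
    {t : P.ring}
    (ht : IsLocalRing.maximalIdeal P.ring = Ideal.span {t})
    (hx : IsCarlitzGenerator k (algebraMap K L t) n x) (hn : 1 ≤ n)
    (hgen : Algebra.adjoin K {x} = ⊤) : condExponent h = (n + 1 : ℕ) := by
  have hmin := minpoly_eq_carlitzPhi ht hx
  have htm : t ∈ IsLocalRing.maximalIdeal P.ring := ht ▸ Ideal.mem_span_singleton_self t
  have ht0 : (t : K) ≠ 0 := by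
    intro h0
    have : t = 0 := Subtype.ext h0
    exact IsDiscreteValuationRing.not_a_field P.ring (by simp [ht, this])
  have hE := carlitzPhi_isEisensteinAt t (Fintype.one_lt_card (α := k)) n
    (IsLocalRing.maximalIdeal.isMaximal P.ring).ne_top htm (notMem_maximalIdeal_sq ht)
  obtain ⟨hm, hd⟩ := carlitzPhi_monic_natDegree t (Fintype.one_lt_card (α := k)) n
  have hroot : aeval x (carlitzPhi (Fintype.card k) t n) = 0 := aeval_carlitzPhi_eq_zero_iff.2 hx
  let π : P.intClosure L := ⟨x, _, hm, hroot⟩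
  have hadj : Algebra.adjoin P.ring {π} = ⊤ := by
    refine adjoin_eq_top_of_isEisensteinAt ht hm hE ?_ (π := π) hroot hgen
    rw [hd]
    exact Nat.mul_pos (Nat.pow_pos Fintype.card_pos) (Nat.pos_of_ne_zero card_sub_one_ne_zero)
  have hv : h.val (algebraMap K L t) < 1 := by
    rw [h.val_algebraMap_uniformizer ht, ← WithZero.exp_zero, WithZero.exp_lt_exp]
    have := h.ramIndex_ne_zero
    lia
  have ht0' : algebraMap K L t ≠ 0 := by simpa using ht0
  obtain ⟨σ₀, hσ₀⟩ := IsCarlitzGenerator.exists_galois_apply_eq hmin (hx.add_pow_apply hn)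
  have hsub : σ₀ x - x = (carlitzMap k (algebraMap K L t) ^ n) x := by
    rw [hσ₀, add_sub_cancel_left]
  refine h.condExponent_eq_of_adjoin_eq_top hadj (π := π) hgen (σ₀ := σ₀) ?_ ?_ ?_ ht (n + 1) ?_
  · rintro rfl
    exact hx.pow_apply_ne_zero ht0' (by rw [← hsub]; simp)
  · intro σ hσ
    change h.val (σ₀ x - x) ≤ h.val (σ x - x)
    rw [hsub]
    exact hx.valuation_pow_apply_le_sub h.val ht0 hv.le
      fun h1 ↦ hσ (IsCarlitzGenerator.algEquiv_ext hgen h1)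
  · change h.val (σ₀ x - x) < 1
    rw [hsub]
    exact hx.valuation_pow_apply_lt_one h.val hv
  · change h.val (aeval x (derivative (minpoly K x))) * h.val (σ₀ x - x) = _
    rw [hsub, hmin, ← map_mul, hx.aeval_derivative_carlitzPhi_mul, map_pow]

theorem LiesOver.condExponent_carlitz_unit [IsDiscreteValuationRing P.ring] (h : Q.LiesOver P)
    (hx : IsCarlitzGenerator k (algebraMap K L T) n x) (hT : T ≠ 0)
    (hT1 : T ∈ P.ring) (hT2 : T⁻¹ ∈ P.ring)
    (hgen : Algebra.adjoin K {x} = ⊤) : condExponent h = 0 := by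
  have hv : h.val (algebraMap K L T) = 1 := by
    refine le_antisymm ((h.val_algebraMap_le_one_iff T).2 hT1) ?_
    have h2 := (h.val_algebraMap_le_one_iff T⁻¹).2 hT2
    rw [map_inv₀, map_inv₀] at h2
    exact (inv_le_one₀ (by simpa [zero_lt_iff] using hT)).1 h2
  have hroot : aeval x (carlitzPhi (Fintype.card k) (⟨T, hT1⟩ : P.ring) n) = 0 :=
    aeval_carlitzPhi_eq_zero_iff.2 hx
  let π : P.intClosure L := ⟨x, _, (carlitzPhi_monic_natDegree _ Fintype.one_lt_card n).1, hroot⟩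
  refine h.condExponent_eq_zero π hgen fun σ hσ ↦ ?_
  exact hx.valuation_galois_sub_eq_one h.val hT hv
    fun h1 ↦ hσ (IsCarlitzGenerator.algEquiv_ext hgen h1)

theorem exists_apply_eq_smul_of_forall_mem (h : Q.LiesOver P)
    (hx : IsCarlitzGenerator k (algebraMap K L T) n x) (hT : T ∉ P.ring)
    {σ : Gal(L/K)} (hσ : ∀ z ∈ Q.ring, σ z ∈ Q.ring) : ∃ c : k, σ x = c • x := by
  refine hx.exists_galois_eq_smul Q.ring.valuation ?_ σ fun z _ ↦
    valuation_apply_eq_of_forall_mem Q.ring σ hσ z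
  rw [← not_le, Q.ring.valuation_le_one_iff, h.algebraMap_mem_iff]
  exact hT

theorem LiesOver.condExponent_carlitz_pole_of_card_eq_two [IsDiscreteValuationRing P.ring]
    (h : Q.LiesOver P) (hx : IsCarlitzGenerator k (algebraMap K L T) n x) (hT : T ∉ P.ring)
    (hgen : Algebra.adjoin K {x} = ⊤) (hq : Fintype.card k = 2) : condExponent h = 0 := by
  have hT0 : T ≠ 0 := by rintro rfl; exact hT (zero_mem _)
  refine h.condExponent_eq_zero_of_decomp fun σ hσ ↦ IsCarlitzGenerator.algEquiv_ext hgen ?_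
  obtain ⟨c, hc⟩ := exists_apply_eq_smul_of_forall_mem h hx hT hσ
  have hc0 := hx.ne_zero_of_galois_apply_eq_smul hT0 hc
  have hc1 := FiniteField.pow_card_sub_one_eq_one c hc0
  rw [hq, pow_one] at hc1
  rw [hc, hc1, one_smul, AlgEquiv.one_apply]

/-- The decomposition group lies in the group H of order q - 1 acting by constants. The (q-1)-st
power of φ^n(x)⁻¹ is -1/T, so this element witnesses total tame ramification. -/
theorem LiesOver.condExponent_carlitz_pole [IsDiscreteValuationRing P.ring] (h : Q.LiesOver P)
    (hx : IsCarlitzGenerator k (algebraMap K L T) n x) {t : P.ring} (hT : T ∉ P.ring)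
    (ht : IsLocalRing.maximalIdeal P.ring = Ideal.span {t}) (htT : (t : K) = T⁻¹)
    (hgen : Algebra.adjoin K {x} = ⊤) (hmin : minpoly K x = carlitzPhi (Fintype.card k) T n)
    {H : Subgroup Gal(L/K)} (hH : ∀ σ, σ ∈ H ↔ ∃ c : k, σ x = c • x)
    (hq : 2 < Fintype.card k) : condExponent h = 1 := by
  have hT0 : T ≠ 0 := by rintro rfl; exact hT (zero_mem _)
  have hcard := hx.card_of_mem_iff hT0 hgen hmin hH
  refine h.condExponent_eq_one H (fun σ hσ ↦ (hH σ).2 ?_) (by lia) ?_ ht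
    ((carlitzMap k (algebraMap K L T) ^ n) x)⁻¹ ?_ ?_
  · exact exists_apply_eq_smul_of_forall_mem h hx hT hσ
  · rw [hcard, cast_card_sub_one_eq_neg_one k]
  · rw [hcard, map_inv₀, inv_pow, hx.valuation_pow_apply_pow, htT, map_inv₀, map_inv₀]
  · intro σ hσ hσ1
    obtain ⟨c, hc⟩ := (hH σ).1 hσ
    have hc1 : c⁻¹ - 1 ≠ 0 := by
      rw [sub_ne_zero, ne_eq, inv_eq_one]
      rintro rfl
      exact hσ1 (IsCarlitzGenerator.algEquiv_ext hgen (by rw [hc, one_smul, AlgEquiv.one_apply]))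
    have : σ ((carlitzMap k (algebraMap K L T) ^ n) x)⁻¹ -
        ((carlitzMap k (algebraMap K L T) ^ n) x)⁻¹ =
        algebraMap k L (c⁻¹ - 1) * ((carlitzMap k (algebraMap K L T) ^ n) x)⁻¹ := by
      rw [map_inv₀, galois_carlitzMap_pow, hc, map_smul, Algebra.smul_def, mul_inv, map_sub,
        map_inv₀, map_one]
      ring
    rw [this, map_mul, Valuation.map_algebraMap_finite _ hc1, one_mul]

end Full

/-! ### Local conductor exponents of the fixed field -/

section Fixed

variable {F : Type*} [Field F] [Algebra k F] [Algebra K F] [Algebra F L] [IsScalarTower K F L]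
  [FiniteDimensional K L] [IsGalois K L] [FiniteDimensional K F] [IsGalois K F]
  [IsDiscreteValuationRing P.ring] {Q : Place k F} {y : F}

/-- Differences of conjugates of y factor only over L, so Q is extended to L. The criteria for F use
only comparisons and equalities of values, for which equivalence suffices. -/
theorem LiesOver.exists_valuation_isEquiv (h : Q.LiesOver P) (L : Type*) [Field L] [Algebra F L] :
    ∃ W : ValuationSubring L, W.comap (algebraMap F L) = Q.ring ∧
      h.val.IsEquiv (W.valuation.comap (algebraMap F L)) := by
  obtain ⟨W, hW⟩ := exists_valuationSubring_comap_eq Q.ring L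
  refine ⟨W, hW, h.val_isEquiv_comap W.valuation fun z ↦ ?_⟩
  rw [W.valuation_le_one_iff, ← ValuationSubring.mem_comap, hW]

theorem galois_liftNormal_apply_ne (hy : algebraMap F L y = x ^ (Fintype.card k - 1))
    (hgen : Algebra.adjoin K {y} = ⊤) {σ : Gal(F/K)} (hσ : σ ≠ 1) :
    σ.liftNormal L (x ^ (Fintype.card k - 1)) ≠ x ^ (Fintype.card k - 1) := by
  rw [← hy, AlgEquiv.liftNormal_commutes]
  intro h1
  exact hσ (IsCarlitzGenerator.algEquiv_ext hgen ((algebraMap F L).injective h1))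

theorem LiesOver.condExponent_carlitzFixed_zero (h : Q.LiesOver P) {t : P.ring}
    (ht : IsLocalRing.maximalIdeal P.ring = Ideal.span {t})
    (hx : IsCarlitzGenerator k (algebraMap K L t) n x) (hn : 1 ≤ n)
    (hy : algebraMap F L y = x ^ (Fintype.card k - 1)) (hgen : Algebra.adjoin K {y} = ⊤) :
    condExponent h = (n + 1 : ℕ) := by
  have htm : t ∈ IsLocalRing.maximalIdeal P.ring := ht ▸ Ideal.mem_span_singleton_self t
  have ht0 : (t : K) ≠ 0 := by
    intro h0
    have : t = 0 := Subtype.ext h0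
    exact IsDiscreteValuationRing.not_a_field P.ring (by simp [ht, this])
  have hE := carlitzPsi_isEisensteinAt t (Fintype.one_lt_card (α := k)) n
    (IsLocalRing.maximalIdeal.isMaximal P.ring).ne_top htm (notMem_maximalIdeal_sq ht)
  obtain ⟨hm, hd⟩ := carlitzPsi_monic_natDegree t (Fintype.one_lt_card (α := k)) n
  have hd0 : 0 < (carlitzPsi (Fintype.card k) t n).natDegree := by
    rw [hd]; exact Nat.pow_pos Fintype.card_pos
  have hrootL : aeval x (carlitzPhi (Fintype.card k) (t : K) n) = 0 :=
    aeval_carlitzPhi_eq_zero_iff.2 hx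
  have hmap : (carlitzPsi (Fintype.card k) t n).map (algebraMap P.ring K) =
      carlitzPsi (Fintype.card k) (t : K) n := carlitzPsi_map t _ n
  have hroot : aeval y (carlitzPsi (Fintype.card k) t n) = 0 := by
    rw [← aeval_map_algebraMap K, hmap]
    refine (algebraMap F L).injective ?_
    rw [map_zero, ← aeval_algebraMap_apply, hy, aeval_carlitzPsi_pow, hrootL]
  have hmin : minpoly K y = carlitzPsi (Fintype.card k) (t : K) n := by
    rw [minpoly_eq_map_of_isEisensteinAt (Ideal.IsMaximal.isPrime inferInstance) hm hE hd0 hroot,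
      hmap]
  let π : P.intClosure F := ⟨y, _, hm, hroot⟩
  have hadj : Algebra.adjoin P.ring {π} = ⊤ :=
    adjoin_eq_top_of_isEisensteinAt ht hm hE hd0 (π := π) hroot hgen
  obtain ⟨W, -, hW⟩ := h.exists_valuation_isEquiv L
  set v := W.valuation with hvdef
  have hv : v (algebraMap K L t) < 1 := by
    rw [IsScalarTower.algebraMap_apply K F L]
    have h1 : h.val (algebraMap K F t) < 1 := by
      rw [h.val_algebraMap_uniformizer ht, ← WithZero.exp_zero, WithZero.exp_lt_exp]
      have := h.ramIndex_ne_zero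
      lia
    exact hW.lt_one_iff_lt_one.1 h1
  have ht0' : algebraMap K L t ≠ 0 := by simpa using ht0
  obtain ⟨σ₀, hσ₀⟩ := IsCarlitzGenerator.exists_galois_apply_eq (minpoly_eq_carlitzPhi ht hx)
    (hx.add_pow_apply hn)
  have hval := hx.valuation_galois_pow_sub_pow_of_add v hv.le hn hσ₀
  have hlift : algebraMap F L (σ₀.restrictNormal F y - y) =
      σ₀ (x ^ (Fintype.card k - 1)) - x ^ (Fintype.card k - 1) := by
    rw [map_sub, AlgEquiv.restrictNormal_commutes, hy]
  refine h.condExponent_eq_of_adjoin_eq_top hadj (π := π) hgen (σ₀ := σ₀.restrictNormal F)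
    ?_ ?_ ?_ ht (n + 1) ?_
  · intro h1
    rw [h1, AlgEquiv.one_apply, sub_self, map_zero] at hlift
    rw [← hlift, map_zero] at hval
    refine mul_ne_zero (pow_ne_zero _ ?_) ?_ hval.symm
    · exact (Valuation.ne_zero_iff _).2 (hx.ne_zero ht0)
    · exact (Valuation.ne_zero_iff _).2 (hx.pow_apply_ne_zero ht0')
  · intro σ hσ
    refine (hW _ _).2 ?_
    change v (algebraMap F L (σ₀.restrictNormal F y - y)) ≤ v (algebraMap F L (σ y - y))
    rw [hlift, hval, map_sub, ← AlgEquiv.liftNormal_commutes, hy]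
    exact hx.le_valuation_galois_pow_sub_pow v ht0 hv.le (galois_liftNormal_apply_ne hy hgen hσ)
  · refine hW.lt_one_iff_lt_one.2 ?_
    change v (algebraMap F L (σ₀.restrictNormal F y - y)) < 1
    rw [hlift, hval]
    exact (mul_le_of_le_one_left' (pow_le_one' (hx.valuation_le_one v hv.le) _)).trans_lt
      (hx.valuation_pow_apply_lt_one v hv)
  · rw [← map_mul, ← map_pow]
    refine hW.eq_iff.2 ?_
    change v (algebraMap F L (aeval y (derivative (minpoly K y)) *
      (σ₀.restrictNormal F y - y))) = v (algebraMap F L (algebraMap K F t ^ (n + 1)))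
    -- |σ₀y - y| = |x|^{q-2} |φ^n(x)|, and the factor |x|^{q-2} turns |Ψ'(y)| into |Φ'(x)|, which
    -- reduces to the identity for Φ.
    rw [map_mul, hlift, map_mul v, hval, ← aeval_algebraMap_apply, hy, hmin, ← mul_assoc,
      ← IsCarlitzGenerator.valuation_aeval_derivative_carlitzPhi, ← map_mul,
      hx.aeval_derivative_carlitzPhi_mul, map_pow (algebraMap F L),
      ← IsScalarTower.algebraMap_apply]

theorem LiesOver.condExponent_carlitzFixed_unit (h : Q.LiesOver P)
    (hx : IsCarlitzGenerator k (algebraMap K L T) n x) (hT : T ≠ 0)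
    (hT1 : T ∈ P.ring) (hT2 : T⁻¹ ∈ P.ring)
    (hy : algebraMap F L y = x ^ (Fintype.card k - 1)) (hgen : Algebra.adjoin K {y} = ⊤) :
    condExponent h = 0 := by
  obtain ⟨W, -, hW⟩ := h.exists_valuation_isEquiv L
  have hv : W.valuation (algebraMap K L T) = 1 := by
    rw [IsScalarTower.algebraMap_apply K F L]
    refine (hW.eq_one_iff_eq_one (x := algebraMap K F T)).1 ?_
    refine le_antisymm ((h.val_algebraMap_le_one_iff T).2 hT1) ?_
    have h2 := (h.val_algebraMap_le_one_iff T⁻¹).2 hT2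
    rw [map_inv₀, map_inv₀] at h2
    exact (inv_le_one₀ (by simpa [zero_lt_iff] using hT)).1 h2
  have hroot : aeval y (carlitzPsi (Fintype.card k) (⟨T, hT1⟩ : P.ring) n) = 0 := by
    refine (algebraMap F L).injective ?_
    rw [map_zero, ← aeval_algebraMap_apply, hy, aeval_carlitzPsi_pow, aeval_carlitzPhi_eq_zero_iff]
    exact hx
  let π : P.intClosure F := ⟨y, _, (carlitzPsi_monic_natDegree _ Fintype.one_lt_card n).1, hroot⟩
  refine h.condExponent_eq_zero π hgen fun σ hσ ↦ ?_
  refine hW.eq_one_iff_eq_one.2 ?_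
  change W.valuation (algebraMap F L (σ y - y)) = 1
  rw [map_sub, ← AlgEquiv.liftNormal_commutes, hy]
  exact hx.valuation_galois_pow_sub_pow_eq_one W.valuation hT hv
    (galois_liftNormal_apply_ne hy hgen hσ)

/-- Lift σ to L. The (q-1)-st powers of torsion points lie in F, so the lift preserves absolute
values on the torsion. It then multiplies x by a constant and fixes y, so the decomposition group of
Q is trivial. -/
theorem LiesOver.condExponent_carlitzFixed_pole (h : Q.LiesOver P)
    (hx : IsCarlitzGenerator k (algebraMap K L T) n x) (hT : T ∉ P.ring)
    (hy : algebraMap F L y = x ^ (Fintype.card k - 1)) (hgen : Algebra.adjoin K {y} = ⊤)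
    (hF : ∀ z : L, (carlitzMap k (algebraMap K L T) ^ (n + 1)) z = 0 →
      z ^ (Fintype.card k - 1) ∈ Set.range (algebraMap F L)) :
    condExponent h = 0 := by
  have hT0 : T ≠ 0 := by rintro rfl; exact hT (zero_mem _)
  obtain ⟨W, hWQ, hW⟩ := h.exists_valuation_isEquiv L
  refine h.condExponent_eq_zero_of_decomp fun σ hσ ↦ ?_
  by_contra hσ1
  refine galois_liftNormal_apply_ne hy hgen hσ1 ?_
  have hval : ∀ z, Q.ring.valuation (σ z) = Q.ring.valuation z :=
    valuation_apply_eq_of_forall_mem Q.ring σ hσ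
  have heq : Q.ring.valuation.IsEquiv (W.valuation.comap (algebraMap F L)) := by
    rw [Valuation.isEquiv_iff_val_le_one]
    intro z
    rw [Q.ring.valuation_le_one_iff, Valuation.comap_apply, W.valuation_le_one_iff,
      ← ValuationSubring.mem_comap, hWQ]
  have hpole : 1 < W.valuation (algebraMap K L T) := by
    rw [← not_le, W.valuation_le_one_iff, IsScalarTower.algebraMap_apply K F L,
      ← ValuationSubring.mem_comap, hWQ, h.algebraMap_mem_iff]
    exact hT
  have hpres : ∀ z : L, (carlitzMap k (algebraMap K L T) ^ (n + 1)) z = 0 →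
      W.valuation (σ.liftNormal L z) = W.valuation z := by
    intro z hz
    obtain ⟨w, hw⟩ := hF z hz
    refine (pow_left_inj₀ zero_le zero_le (card_sub_one_ne_zero (k := k))).1 ?_
    rw [← map_pow, ← map_pow, ← map_pow, ← hw, AlgEquiv.liftNormal_commutes]
    exact heq.eq_iff.1 (hval w)
  obtain ⟨c, hc⟩ := hx.exists_galois_eq_smul W.valuation hpole (σ.liftNormal L) hpres
  have hc0 := hx.ne_zero_of_galois_apply_eq_smul hT0 hc
  rw [map_pow, hc, smul_pow_card_sub_one hc0]

end Fixed

end Carlitz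

end Place

/-! ### The cyclotomic function field and its subfield fixed by the constants -/

theorem IntermediateField.algebra_adjoin_eq_top {K L : Type*} [Field K] [Field L] [Algebra K L]
    [Algebra.IsAlgebraic K L] (F : IntermediateField K L) (y : F)
    (hF : F ≤ IntermediateField.adjoin K {(y : L)}) : Algebra.adjoin K {y} = ⊤ := by
  rw [← IntermediateField.adjoin_eq_top_iff, eq_top_iff]
  intro z _
  rw [← IntermediateField.mem_lift, IntermediateField.lift_adjoin_simple]
  exact hF z.2

theorem aeval_carlitzMap_mem {k K L : Type*} [Field k] [Fintype k] [Field K] [Field L]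
    [Algebra k K] [Algebra k L] [Algebra K L] [IsScalarTower k K L] {T : K}
    (S : IntermediateField K L) {z : L} (hz : z ∈ S) (M : k[X]) :
    aeval (carlitzMap k (algebraMap K L T)) M z ∈ S := by
  induction M using Polynomial.induction_on' with
  | add p r hp hr =>
    rw [map_add, LinearMap.add_apply]
    exact add_mem hp hr
  | monomial i a =>
    rw [← C_mul_X_pow_eq_monomial, aeval_carlitzMap_mul_X_pow_apply, aeval_C,
      Module.algebraMap_end_apply, Algebra.smul_def, IsScalarTower.algebraMap_apply k K L,
      carlitzMap_pow_apply]
    refine mul_mem (S.algebraMap_mem _) ?_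
    exact aeval_algebraMap_apply L (⟨z, hz⟩ : S) (carlitzPoly _ T i) ▸ SetLike.coe_mem _

section CyclotomicFunctionField

variable {k : Type*} [Field k] [Fintype k]

theorem mem_carlitzTorsion_iff {T : RatFunc k} {n : ℕ} {z : AlgebraicClosure (RatFunc k)} :
    z ∈ carlitzTorsion T (X ^ (n + 1)) ↔
      (carlitzMap k (algebraMap _ (AlgebraicClosure (RatFunc k)) T) ^ (n + 1)) z = 0 := by
  change (aeval (carlitzMap k _) (X ^ (n + 1) : k[X])) z = 0 ↔ _
  rw [map_pow, aeval_X]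

theorem carlitzTorsion_eq_rootSet (T : RatFunc k) (n : ℕ) :
    carlitzTorsion T (X ^ (n + 1)) = (carlitzPoly (Fintype.card k) T (n + 1)).rootSet
      (AlgebraicClosure (RatFunc k)) := by
  ext z
  rw [mem_carlitzTorsion_iff, mem_rootSet, carlitzMap_pow_apply]
  exact ⟨fun h ↦ ⟨carlitzPoly_ne_zero T Fintype.one_lt_card _, h⟩, fun h ↦ h.2⟩

theorem carlitzPoly_separable {K : Type*} [Field K] [Algebra k K] {T : K} (hT : T ≠ 0) (j : ℕ) :
    (carlitzPoly (Fintype.card k) T j).Separable := by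
  rw [Polynomial.Separable, derivative_carlitzPoly T Fintype.one_lt_card
    (cast_card_eq_zero_of_algebra k)]
  exact ⟨0, C (T ^ j)⁻¹, by
    rw [zero_mul, zero_add, ← C_mul, inv_mul_cancel₀ (pow_ne_zero j hT), C_1]⟩

theorem isSplittingField_cyclotomicFunctionField (T : RatFunc k) (n : ℕ) :
    (carlitzPoly (Fintype.card k) T (n + 1)).IsSplittingField (RatFunc k)
      (cyclotomicFunctionField T (X ^ (n + 1))) := by
  rw [cyclotomicFunctionField, carlitzTorsion_eq_rootSet]
  exact IntermediateField.adjoin_rootSet_isSplittingField (IsAlgClosed.splits _)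

theorem finiteDimensional_cyclotomicFunctionField (T : RatFunc k) (n : ℕ) :
    FiniteDimensional (RatFunc k) (cyclotomicFunctionField T (X ^ (n + 1))) :=
  have := isSplittingField_cyclotomicFunctionField T n
  Polynomial.IsSplittingField.finiteDimensional _ (carlitzPoly (Fintype.card k) T (n + 1))

theorem isGalois_cyclotomicFunctionField {T : RatFunc k} (hT : T ≠ 0) (n : ℕ) :
    IsGalois (RatFunc k) (cyclotomicFunctionField T (X ^ (n + 1))) :=
  have := isSplittingField_cyclotomicFunctionField T n
  IsGalois.of_separable_splitting_field (p := carlitzPoly (Fintype.card k) T (n + 1))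
    (carlitzPoly_separable hT _)

/-- Any root of Φ will do: it generates the torsion as a k[φ]-module, hence also the field. -/
theorem exists_isCarlitzGenerator {T : RatFunc k} (n : ℕ) :
    ∃ x : cyclotomicFunctionField T (X ^ (n + 1)),
      IsCarlitzGenerator k (algebraMap _ (cyclotomicFunctionField T (X ^ (n + 1))) T) n x ∧
        Algebra.adjoin (RatFunc k) {x} = ⊤ := by
  obtain ⟨hm, hd⟩ := carlitzPhi_monic_natDegree T (Fintype.one_lt_card (α := k)) n
  obtain ⟨z, hz⟩ := IsAlgClosed.exists_aeval_eq_zero (AlgebraicClosure (RatFunc k))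
    (carlitzPhi (Fintype.card k) T n) (by
      refine (natDegree_pos_iff_degree_pos.1 ?_).ne'
      rw [hd]
      exact Nat.mul_pos (Nat.pow_pos Fintype.card_pos) (Nat.pos_of_ne_zero card_sub_one_ne_zero))
  have hzg := aeval_carlitzPhi_eq_zero_iff.1 hz
  have hzt : z ∈ carlitzTorsion T (X ^ (n + 1)) := mem_carlitzTorsion_iff.2 hzg.pow_succ_apply
  refine ⟨⟨z, IntermediateField.subset_adjoin _ _ hzt⟩, ?_, ?_⟩
  · rw [← aeval_carlitzPhi_eq_zero_iff]
    refine (algebraMap (cyclotomicFunctionField T (X ^ (n + 1)))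
      (AlgebraicClosure (RatFunc k))).injective ?_
    rw [map_zero, ← aeval_algebraMap_apply]
    exact hz
  · refine IntermediateField.algebra_adjoin_eq_top _ _ ?_
    refine IntermediateField.adjoin_le_iff.2 fun w hw ↦ ?_
    obtain ⟨M, rfl⟩ := hzg.exists_aeval_eq (mem_carlitzTorsion_iff.1 hw)
    exact aeval_carlitzMap_mem _ (IntermediateField.mem_adjoin_simple_self _ _) M

theorem coe_mem_carlitzTorsion_iff {T : RatFunc k} {n : ℕ}
    {z : cyclotomicFunctionField T (X ^ (n + 1))} :
    (z : AlgebraicClosure (RatFunc k)) ∈ carlitzTorsion T (X ^ (n + 1)) ↔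
      (carlitzMap k (algebraMap _ (cyclotomicFunctionField T (X ^ (n + 1))) T) ^ (n + 1)) z =
        0 := by
  rw [mem_carlitzTorsion_iff, carlitzMap_pow_apply, carlitzMap_pow_apply,
    ← (algebraMap (cyclotomicFunctionField T (X ^ (n + 1)))
      (AlgebraicClosure (RatFunc k))).injective.eq_iff, map_zero, ← aeval_algebraMap_apply]
  rfl

variable {T : RatFunc k} {n : ℕ} {x : cyclotomicFunctionField T (X ^ (n + 1))}

theorem mem_constUnits_iff (hT : T ≠ 0)
    (hx : IsCarlitzGenerator k (algebraMap _ (cyclotomicFunctionField T (X ^ (n + 1))) T) n x)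
    (σ : Gal(cyclotomicFunctionField T (X ^ (n + 1))/RatFunc k)) :
    σ ∈ constUnits T (X ^ (n + 1)) ↔ ∃ c : k, σ x = c • x := by
  constructor
  · rintro ⟨a, ha⟩
    exact ⟨a, ha x (coe_mem_carlitzTorsion_iff.2 hx.pow_succ_apply)⟩
  · rintro ⟨c, hc⟩
    refine ⟨Units.mk0 c (hx.ne_zero_of_galois_apply_eq_smul hT hc), fun z hz ↦ ?_⟩
    obtain ⟨M, rfl⟩ := hx.exists_aeval_eq (coe_mem_carlitzTorsion_iff.1 hz)
    rw [galois_aeval_carlitzMap, hc, map_smul, Units.val_mk0]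

theorem pow_mem_constUnitsFixedField {z : cyclotomicFunctionField T (X ^ (n + 1))}
    (hz : (carlitzMap k (algebraMap _ (cyclotomicFunctionField T (X ^ (n + 1))) T) ^ (n + 1)) z =
      0) : z ^ (Fintype.card k - 1) ∈ constUnitsFixedField T (X ^ (n + 1)) := by
  rw [IntermediateField.mem_fixedField_iff]
  rintro σ ⟨a, ha⟩
  rw [map_pow, ha z (coe_mem_carlitzTorsion_iff.2 hz)]
  exact smul_pow_card_sub_one a.ne_zero z

/-- By the Galois correspondence, it is enough that an automorphism fixing x^{q-1} multiplies x by a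
constant. -/
theorem constUnitsFixedField_le (hT : T ≠ 0)
    (hx : IsCarlitzGenerator k (algebraMap _ (cyclotomicFunctionField T (X ^ (n + 1))) T) n x) :
    constUnitsFixedField T (X ^ (n + 1)) ≤
      IntermediateField.adjoin (RatFunc k) {x ^ (Fintype.card k - 1)} := by
  have := finiteDimensional_cyclotomicFunctionField T n
  have := isGalois_cyclotomicFunctionField hT n
  rw [← IsGalois.fixedField_fixingSubgroup
    (IntermediateField.adjoin (RatFunc k) {x ^ (Fintype.card k - 1)})]
  refine IntermediateField.fixedField_antitone fun σ hσ ↦ ?_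
  rw [mem_constUnits_iff hT hx]
  refine FiniteField.exists_smul_eq_of_pow_eq ?_
  rw [← map_pow]
  exact (IntermediateField.mem_fixingSubgroup_iff _ σ).1 hσ _
    (IntermediateField.mem_adjoin_simple_self _ _)

theorem isAbelianGalois_cyclotomicFunctionField (hT : T ≠ 0) (n : ℕ) :
    IsAbelianGalois (RatFunc k) (cyclotomicFunctionField T (X ^ (n + 1))) := by
  obtain ⟨x, hx, hgen⟩ := exists_isCarlitzGenerator (T := T) n
  exact { isGalois_cyclotomicFunctionField hT n with
    is_comm.comm := hx.galois_mul_comm hT hgen }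

end CyclotomicFunctionField

/-! ### The two conductors -/

section Conductor

variable {k : Type*} [Field k] (α : k) {P : Place k (RatFunc k)}

theorem maximalIdeal_eq_span_inv_X_sub_C (h : RatFunc.X - RatFunc.C α ∉ P.ring) :
    IsLocalRing.maximalIdeal P.ring =
      Ideal.span {(⟨(RatFunc.X - RatFunc.C α)⁻¹, Place.mem_of_notMem h⟩ : P.ring)} := by
  refine Place.maximalIdeal_eq_span P.algebraMap_mem _
    (RatFunc.exists_eq_aeval_inv_X_sub_C_div α) ?_
  refine (Place.mem_maximalIdeal_iff_inv_notMem _ _ ?_).2 ?_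
  · exact inv_ne_zero (RatFunc.X_sub_C_ne_zero α)
  · rwa [inv_inv]

theorem maximalIdeal_eq_span_X_sub_C (h : (RatFunc.X - RatFunc.C α)⁻¹ ∉ P.ring) :
    IsLocalRing.maximalIdeal P.ring =
      Ideal.span {(⟨RatFunc.X - RatFunc.C α, Place.mem_of_inv_notMem h⟩ : P.ring)} := by
  refine Place.maximalIdeal_eq_span P.algebraMap_mem _ (RatFunc.exists_eq_aeval_X_sub_C_div α) ?_
  exact (Place.mem_maximalIdeal_iff_inv_notMem _ _ (RatFunc.X_sub_C_ne_zero α)).2 h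

variable [Fintype k] {n : ℕ}

theorem isConductor_cyclotomicK (hn : 1 ≤ n) : IsConductor k (RatFunc k) (cyclotomicK α n)
    (Finsupp.single (placeInfty k) ((n : ℤ) + 1) +
      Finsupp.single (placeZero α) (min 1 ((Fintype.card k : ℤ) - 2))) := by
  have hT : (RatFunc.X - RatFunc.C α)⁻¹ ≠ 0 := inv_ne_zero (RatFunc.X_sub_C_ne_zero α)
  have hfin := finiteDimensional_cyclotomicFunctionField (RatFunc.X - RatFunc.C α)⁻¹ n
  have hgal := isGalois_cyclotomicFunctionField hT n
  have hne := placeInfty_ne_placeZero α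
  obtain ⟨x, hx, hgen⟩ := exists_isCarlitzGenerator (T := (RatFunc.X - RatFunc.C α)⁻¹) n
  refine ⟨hfin, isAbelianGalois_cyclotomicFunctionField hT n, Place.exists_liesOver,
    fun P Q h ↦ ?_⟩
  rw [Finsupp.add_apply]
  by_cases h1 : RatFunc.X - RatFunc.C α ∈ P.ring
  · have hP : P ≠ placeInfty k := by
      rintro rfl
      exact placeInfty_X_sub_C_notMem α h1
    rw [Finsupp.single_eq_of_ne hP, zero_add]
    by_cases h2 : (RatFunc.X - RatFunc.C α)⁻¹ ∈ P.ring
    · have hP : P ≠ placeZero α := by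
        rintro rfl
        exact placeZero_inv_notMem α h2
      rw [Finsupp.single_eq_of_ne hP,
        h.condExponent_carlitz_unit hx hT h2 (by rwa [inv_inv]) hgen, Int.cast_zero]
    · have hq : 1 < Fintype.card k := Fintype.one_lt_card
      rw [← eq_placeZero α h2, Finsupp.single_eq_same]
      rcases Nat.lt_or_ge 2 (Fintype.card k) with hq2 | hq2
      · have hmin := Place.minpoly_eq_carlitzPhi
          (maximalIdeal_eq_span_inv_X_sub_C α (placeInfty_X_sub_C_notMem α)) hx
        rw [h.condExponent_carlitz_pole hx h2 (maximalIdeal_eq_span_X_sub_C α h2) (inv_inv _).symm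
          hgen hmin (mem_constUnits_iff hT hx) hq2, min_eq_left (by lia), Int.cast_one]
      · have hq2' : Fintype.card k = 2 := by lia
        rw [h.condExponent_carlitz_pole_of_card_eq_two hx h2 hgen hq2', hq2']
        simp
  · have hP := eq_placeInfty α h1
    rw [← hP] at hne
    rw [← hP, Finsupp.single_eq_same, Finsupp.single_eq_of_ne hne, add_zero,
      h.condExponent_carlitz_zero (maximalIdeal_eq_span_inv_X_sub_C α h1) hx hn hgen]
    push_cast
    rfl

theorem isConductor_cyclotomicF (hn : 1 ≤ n) : IsConductor k (RatFunc k) (cyclotomicF α n)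
    (Finsupp.single (placeInfty k) ((n : ℤ) + 1)) := by
  have hT : (RatFunc.X - RatFunc.C α)⁻¹ ≠ 0 := inv_ne_zero (RatFunc.X_sub_C_ne_zero α)
  have hfin := finiteDimensional_cyclotomicFunctionField (RatFunc.X - RatFunc.C α)⁻¹ n
  have hab := isAbelianGalois_cyclotomicFunctionField hT n
  obtain ⟨x, hx, hgen⟩ := exists_isCarlitzGenerator (T := (RatFunc.X - RatFunc.C α)⁻¹) n
  set y : cyclotomicF α n :=
    ⟨x ^ (Fintype.card k - 1), pow_mem_constUnitsFixedField hx.pow_succ_apply⟩ with hy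
  have hyx : algebraMap (cyclotomicF α n) (cyclotomicK α n) y = x ^ (Fintype.card k - 1) := rfl
  have hgeny : Algebra.adjoin (RatFunc k) {y} = ⊤ :=
    IntermediateField.algebra_adjoin_eq_top _ y (constUnitsFixedField_le hT hx)
  refine ⟨inferInstance, inferInstance, Place.exists_liesOver, fun P Q h ↦ ?_⟩
  by_cases h1 : RatFunc.X - RatFunc.C α ∈ P.ring
  · have hP : P ≠ placeInfty k := by
      rintro rfl
      exact placeInfty_X_sub_C_notMem α h1
    rw [Finsupp.single_eq_of_ne hP, Int.cast_zero]
    by_cases h2 : (RatFunc.X - RatFunc.C α)⁻¹ ∈ P.ring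
    · rw [h.condExponent_carlitzFixed_unit hx hT h2 (by rwa [inv_inv]) hyx hgeny]
    · rw [h.condExponent_carlitzFixed_pole hx h2 hyx hgeny]
      exact fun z hz ↦ ⟨⟨_, pow_mem_constUnitsFixedField hz⟩, rfl⟩
  · rw [← eq_placeInfty α h1, Finsupp.single_eq_same,
      h.condExponent_carlitzFixed_zero (maximalIdeal_eq_span_inv_X_sub_C α h1) hx hn hyx hgeny]
    push_cast
    rfl

end Conductor

end

theorem proposition3p4 {k : Type*} [Field k] [Fintype k] (α : k) (n : ℕ) (hn : 1 ≤ n) :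
    IsConductor k (RatFunc k) (cyclotomicK α n)
        (Finsupp.single (placeInfty k) ((n : ℤ) + 1) +
          Finsupp.single (placeZero α) (min 1 ((Fintype.card k : ℤ) - 2))) ∧
      IsConductor k (RatFunc k) (cyclotomicF α n)
        (Finsupp.single (placeInfty k) ((n : ℤ) + 1)) :=
  ⟨isConductor_cyclotomicK α hn, isConductor_cyclotomicF α hn⟩
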